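/- Let $\Omega\subseteq\mathbb C$ be open and let ${\bf f}_1,\dots,{\bf f}_k$ be i.i.d. Gaussian analytic functions on $\Omega$ (random analytic functions whose finite-dimensional distributions are mean zero complex Gaussian, i.e. laws of $Ba$ with $B$ a complex matrix and $a$ a vector of i.i.d. standard complex Gaussians), with covariance kernel $K(z,w)=\mathbf E[{\bf f}_i(z)\overline{{\bf f}_i(w)}]$. Assume $K(z,z)\neq 0$ for all $z\in\Omega$. Let $Q\neq 0$ be a homogeneous polynomial of degree $d$ in $k$ variables with complex coefficients, let ${\bf F}(z)=Q({\bf f}_1(z),\dots,{\bf f}_k(z))$, and let $X$ be the counting measure, with multiplicities, of the zeros of ${\bf F}$ in $\Omega$. Let $m$ be Lebesgue measure on $\mathbb C$ and $\Delta=\partial_x^2+\partial_y^2$. Let $a_1,\dots,a_k$ be i.i.d. standard complex Gaussians (density $\frac1\pi e^{-|z|^2}$). Let $:a^m\bar a^n:\;=\sum_{r=0}^{\min(m,n)}(-1)^r r!\binom mr\binom nr a^{m-r}\bar a^{\,n-r}$ be the Wick powers, and for multi-indices ${\bf m},{\bf n}\in\mathbb Z_{\ge0}^k$ let $$C_{{\bf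 m},{\bf n}}=\frac1{\sqrt{{\bf m}!\,{\bf n}!}}\,\mathbf E\Big[\log|Q(a_1,\dots,a_k)|\prod_{j=1}^k:\bar a_j^{m_j}a_j^{n_j}:\Big],\qquad |\tilde C_p|^2=\sum_{|{\bf m}|=|{\bf n}|=p}|C_{{\bf m},{\bf n}}|^2 ,$$ so that $C_{{\bf m},{\bf n}}/\sqrt{{\bf m}!\,{\bf n}!}$ are the coefficients of the Wick expansion of $\log|Q(a)|$; they depend only on $Q$. Let $$U=\{(z,w)\in\Omega\times\Omega:\ |K(z,w)|^2<K(z,z)K(w,w)\},$$ the set of pairs at which ${\bf f}_i(z),{\bf f}_i(w)$ are linearly independent random variables (so $z\ne w$ on $U$). Then $\log|Q(a)|$ is square integrable, and there are continuous functions $\rho_1:\Omega\to[0,\infty)$ and $\rho_2:U\to[0,\infty)$ with the following properties. 1. (First intensity.) $\rho_1$ is the first intensity of the zeros of ${\bf F}$, that is, $\mathbf E[X(D)]=\int_D\rho_1\,dm$ for every Borel set $D\subseteq\Omega$, and for all $z\in\Omega$ $$\rho_1(z)=\frac{d}{4\pi}\,\Delta_z\log K(z,z).$$ 2. (Two-point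 correlations.) $\rho_2$ is the two-point correlation function of the zeros of ${\bf F}$ on $U$, that is, $\mathbf E[(X\otimes X)(B)]=\int_B\rho_2\,d(m\otimes m)$ for every Borel set $B\subseteq U$ (in particular $\mathbf E[X(D_1)X(D_2)]=\int_{D_1\times D_2}\rho_2$ whenever $D_1\times D_2\subseteq U$), and for all $(z,w)\in U$ $$\rho_2(z,w)-\rho_1(z)\rho_1(w)=\frac1{(2\pi)^2}\sum_{p=0}^\infty|\tilde C_p|^2\,\Delta_z\Delta_w\frac{|K(z,w)|^{2p}}{K(z,z)^pK(w,w)^p},$$ where the series converges absolutely. -/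

import Mathlib

open MeasureTheory ProbabilityTheory
open scoped ENNReal ComplexConjugate

noncomputable section

namespace Polygaf

/-- The standard complex Gaussian distribution: density `(1/π) e^{-|z|²}` with respect to
Lebesgue measure on the plane. -/
def stdComplexGaussian : Measure ℂ :=
  volume.withDensity fun z => ENNReal.ofReal (Real.pi⁻¹ * Real.exp (-‖z‖ ^ 2))

/-- The law of `k` i.i.d. standard complex Gaussians `(a₁, …, a_k)`. -/
def stdGaussianVector (k : ℕ) : Measure (Fin k → ℂ) :=
  Measure.pi fun _ => stdComplexGaussian

/-- A law on `ℂⁿ` is mean zero complex Gaussian if it is the law of `B a` for a matrix `B`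
and a vector `a` of i.i.d. standard complex Gaussians. -/
def IsCenteredComplexGaussian {n : ℕ} (μ : Measure (Fin n → ℂ)) : Prop :=
  ∃ (m : ℕ) (B : Matrix (Fin n) (Fin m) ℂ),
    μ = (stdGaussianVector m).map fun a => B.mulVec a

/-- `f` is a Gaussian analytic function on `Ω`: a random analytic function on `Ω` whose finite
dimensional distributions are mean zero complex Gaussian. -/
structure IsGAF {S : Type*} [MeasurableSpace S] (P : Measure S) (Ω : Set ℂ)
    (f : S → ℂ → ℂ) : Prop where
  measurable : ∀ z ∈ Ω, Measurable fun s => f s z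
  analytic : ∀ s, AnalyticOnNhd ℂ (f s) Ω
  gaussian : ∀ (n : ℕ) (z : Fin n → ℂ), (∀ i, z i ∈ Ω) →
    IsCenteredComplexGaussian (P.map fun s i => f s (z i))

/-- `K` is the covariance kernel `K(z,w) = E[f(z) conj f(w)]` of `f` on `Ω`. -/
def IsCovarianceKernel {S : Type*} [MeasurableSpace S] (P : Measure S) (Ω : Set ℂ)
    (f : S → ℂ → ℂ) (K : ℂ → ℂ → ℂ) : Prop :=
  ∀ z ∈ Ω, ∀ w ∈ Ω, K z w = ∫ s, f s z * conj (f s w) ∂P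

/-- The counting measure of the zeros in `Ω`, with multiplicities, of a function `F` that is
analytic on `Ω`. (The order is `⊤` at the points near which `F` vanishes identically.) -/
def zeroMeasure (Ω : Set ℂ) (F : ℂ → ℂ) : Measure ℂ :=
  Measure.sum fun z : Ω => ((analyticOrderAt F z : ℕ∞) : ℝ≥0∞) • Measure.dirac (z : ℂ)

/-- `ρ` is the first intensity on `U`, with respect to Lebesgue measure, of the random
measure `X`: `E[X(D)] = ∫_D ρ` for Borel sets `D ⊆ U`. -/
structure IsFirstIntensity {S : Type*} [MeasurableSpace S] (P : Measure S)
    (X : S → Measure ℂ) (U : Set ℂ) (ρ : ℂ → ℝ) : Prop where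
  nonneg : ∀ z ∈ U, 0 ≤ ρ z
  aemeasurable : ∀ D : Set ℂ, MeasurableSet D → D ⊆ U → AEMeasurable (fun s => X s D) P
  mean : ∀ D : Set ℂ, MeasurableSet D → D ⊆ U →
    ∫⁻ s, X s D ∂P = ∫⁻ z in D, ENNReal.ofReal (ρ z)

/-- `ρ` is the two-point correlation function on `U`, with respect to Lebesgue measure, of the
random counting measure `X`; here `U` is a set of pairs of distinct points. For every Borel set
`B ⊆ U` the expected number of ordered pairs of points of `X` in `B`, counted with
multiplicities, is `∫_B ρ`. With `B = D₁ × D₂` this reads `E[X(D₁) X(D₂)] = ∫_{D₁ × D₂} ρ`. -/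
structure IsTwoPointCorrelation {S : Type*} [MeasurableSpace S] (P : Measure S)
    (X : S → Measure ℂ) (U : Set (ℂ × ℂ)) (ρ : ℂ × ℂ → ℝ) : Prop where
  nonneg : ∀ q ∈ U, 0 ≤ ρ q
  aemeasurable : ∀ B : Set (ℂ × ℂ), MeasurableSet B → B ⊆ U →
    AEMeasurable (fun s => ((X s).prod (X s)) B) P
  mean : ∀ B : Set (ℂ × ℂ), MeasurableSet B → B ⊆ U →
    ∫⁻ s, ((X s).prod (X s)) B ∂P = ∫⁻ q in B, ENNReal.ofReal (ρ q)

/-- The Wick power `:aᵐ āⁿ:` of a standard complex Gaussian `a`. -/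
def wickPower (m n : ℕ) (a : ℂ) : ℂ :=
  ∑ r ∈ Finset.range (min m n + 1),
    (-1) ^ r * (r.factorial : ℂ) * (m.choose r : ℂ) * (n.choose r : ℂ) *
      a ^ (m - r) * conj a ^ (n - r)

/-- The coefficient `C_{m,n}` of the Wick expansion
`log |Q(a)| = ∑ C_{m,n} / √(m! n!) ∏ⱼ :aⱼ^{mⱼ} āⱼ^{nⱼ}:`, that is
`C_{m,n} = (m! n!)^{-1/2} E[log |Q(a)| ∏ⱼ :āⱼ^{mⱼ} aⱼ^{nⱼ}:]`. -/
def wickCoeff {k : ℕ} (Q : MvPolynomial (Fin k) ℂ) (m n : Fin k → ℕ) : ℂ :=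
  ((Real.sqrt (((∏ j, (m j).factorial) * ∏ j, (n j).factorial : ℕ) : ℝ) : ℝ) : ℂ)⁻¹ *
    ∫ a, (Real.log ‖MvPolynomial.eval a Q‖ : ℂ) * ∏ j, wickPower (n j) (m j) (a j)
      ∂(stdGaussianVector k)

/-- `|C̃_p|² = ∑ |C_{m,n}|²` over the multi-indices with `|m| = |n| = p`. -/
def wickWeight {k : ℕ} (Q : MvPolynomial (Fin k) ℂ) (p : ℕ) : ℝ :=
  ∑ m ∈ Finset.piAntidiag (Finset.univ : Finset (Fin k)) p,
    ∑ n ∈ Finset.piAntidiag (Finset.univ : Finset (Fin k)) p, ‖wickCoeff Q m n‖ ^ 2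

/-- `|K(z,w)|^{2p} / (K(z,z)^p K(w,w)^p)`. -/
def normalizedPower (K : ℂ → ℂ → ℂ) (p : ℕ) (z w : ℂ) : ℝ :=
  ‖K z w‖ ^ (2 * p) / ((K z z).re ^ p * (K w w).re ^ p)

/-- The pairs `(z,w)` of points of `Ω` with `|K(z,w)|² < K(z,z) K(w,w)`; in particular `z ≠ w`.
For a centered complex Gaussian process with kernel `K` these are the pairs at which its two
values have a nonsingular covariance matrix. -/
def nondegeneratePairs (Ω : Set ℂ) (K : ℂ → ℂ → ℂ) : Set (ℂ × ℂ) :=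
  {q | q.1 ∈ Ω ∧ q.2 ∈ Ω ∧ ‖K q.1 q.2‖ ^ 2 < (K q.1 q.1).re * (K q.2 q.2).re}

end Polygaf

end

namespace Polygaf

/-! ### The standard complex Gaussian -/

/-! For an analytic F that is not identically zero near any point, the zeros counted with
multiplicity form the distribution (2π)⁻¹ Δ log|F| (`lintegral_ofReal_zeroMeasure`). Hence ∫ φ dX =
(2π)⁻¹ ∫ log|F| Δφ for test functions φ. After taking expectations and moving the Laplacians off the
test functions, the intensities become Laplacians of moments of log|F|: ρ₁ = (2π)⁻¹ Δ E log|F(z)|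
and ρ₂ = (2π)⁻² Δ_z Δ_w E[log|F(z)| log|F(w)|]. It remains to compute these moments, to see that
they are smooth, and to pass from test functions to Borel sets.

Moments (`moments_log_norm_eval`). With σ² = K(z,z), τ² = K(w,w) and θ = |K(z,w)|² / (K(z,z)
K(w,w)), the pairs (f_i(z), f_i(w)) are i.i.d. with the law of (σ a, τ (c a + t b)), where a, b are
independent standard Gaussians, |c|² = θ and t² = 1 - θ. Homogeneity of Q extracts d log σ and d log
τ. So E log|F(z)| = (d/2) log K(z,z) + const, and the second moment reduces to E[L(a) L(c a + t b)]
with L = log|Q|. The normalized Wick products are a Hilbert basis of L² of the Gaussian vector, and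
correlating two copies multiplies the contribution of the index (m, n) by c^|m| c̄^|n| (Mehler's
formula, `hasSum_inner_comp`). Since L is invariant under a common phase, only |m| = |n|
contributes, and the expectation is ∑ |C̃_p|² θ^p (`hasSum_wickWeight_mul_pow`). That L is in L² is
proved by induction on the number of variables, splitting Q into linear factors in one of them
(`lintegral_negLogSq_eval_ne_top`).

Smoothness. A Gaussian analytic function is holomorphic as a map into L²
(`IsGAF.differentiableOn_gafLp`), so K(z,z) and |K(z,w)|² are smooth. On U one has θ < 1, and the
weights |C̃_p|² are bounded, so the series in θ may be differentiated term by term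
(`IsPowerSeriesOperator`). In Δ_z Δ_w the product of the two means gives ρ₁(z) ρ₁(w), and the power
series gives the stated sum.

Borel sets. `IsRandomPotential` isolates what is used about log|F|. Smooth functions increasing to
indicators give the intensities on small open sets or rectangles, and a π-λ argument with a
countable cover extends them to all Borel sets. -/

theorem measurable_gaussianDensity :
    Measurable fun z : ℂ => ENNReal.ofReal (Real.pi⁻¹ * Real.exp (-‖z‖ ^ 2)) := by
  fun_prop

theorem integrable_exp_neg_sq_norm : Integrable fun z : ℂ => Real.exp (-‖z‖ ^ 2) := by
  have h := (GaussianFourier.integrable_cexp_neg_mul_sq_norm_add (V := ℂ) (b := 1)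
    (by simp) 0 0).norm
  refine h.congr (Filter.Eventually.of_forall fun z => ?_)
  simp only [Complex.norm_exp]
  norm_num
  norm_cast

instance isProbabilityMeasure_stdComplexGaussian : IsProbabilityMeasure stdComplexGaussian := by
  constructor
  rw [stdComplexGaussian, withDensity_apply _ MeasurableSet.univ, Measure.restrict_univ,
    ← ofReal_integral_eq_lintegral_ofReal (integrable_exp_neg_sq_norm.const_mul _)
      (Filter.Eventually.of_forall fun z => by positivity), integral_const_mul]
  have := GaussianFourier.integral_rexp_neg_mul_sq_norm (V := ℂ) (b := 1) one_pos
  simp only [neg_mul, one_mul, Complex.finrank_real_complex, Nat.cast_ofNat, div_one, ne_eq,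
    OfNat.ofNat_ne_zero, not_false_eq_true, div_self, Real.rpow_one] at this
  rw [this, inv_mul_cancel₀ Real.pi_ne_zero, ENNReal.ofReal_one]

instance isProbabilityMeasure_stdGaussianVector (k : ℕ) :
    IsProbabilityMeasure (stdGaussianVector k) := by
  unfold stdGaussianVector; infer_instance

theorem integral_stdComplexGaussian {E : Type*} [NormedAddCommGroup E] [NormedSpace ℝ E]
    (g : ℂ → E) :
    ∫ z, g z ∂stdComplexGaussian = ∫ z, (Real.pi⁻¹ * Real.exp (-‖z‖ ^ 2)) • g z := by
  rw [stdComplexGaussian, integral_withDensity_eq_integral_toReal_smul measurable_gaussianDensity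
    (Filter.Eventually.of_forall fun _ => ENNReal.ofReal_lt_top)]
  refine integral_congr_ae (Filter.Eventually.of_forall fun z => ?_)
  simp only
  rw [ENNReal.toReal_ofReal (by positivity)]

theorem integrable_stdComplexGaussian_iff {E : Type*} [NormedAddCommGroup E] [NormedSpace ℝ E]
    (g : ℂ → E) :
    Integrable g stdComplexGaussian ↔
      Integrable fun z => (Real.pi⁻¹ * Real.exp (-‖z‖ ^ 2)) • g z := by
  rw [stdComplexGaussian, integrable_withDensity_iff_integrable_smul' measurable_gaussianDensity
    (Filter.Eventually.of_forall fun _ => ENNReal.ofReal_lt_top)]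
  refine integrable_congr (Filter.Eventually.of_forall fun z => ?_)
  simp only
  rw [ENNReal.toReal_ofReal (by positivity)]

/-- Completing the square gives c‖z‖ ≤ ‖z‖²/2 + c²/2, so half of the Gaussian weight absorbs the
exponential. This is the dominating function for all polynomial integrands below. -/
theorem integrable_exp_mul_norm (c : ℝ) :
    Integrable (fun z : ℂ => Real.exp (c * ‖z‖)) stdComplexGaussian := by
  rw [integrable_stdComplexGaussian_iff]
  have h := (GaussianFourier.integrable_cexp_neg_mul_sq_norm_add (V := ℂ) (b := 1 / 2)
    (by norm_num) 0 0).norm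
  refine (h.const_mul (Real.pi⁻¹ * Real.exp (c ^ 2 / 2))).mono'
    (by fun_prop) (Filter.Eventually.of_forall fun z => ?_)
  have h1 : ‖Complex.exp (-(1 / 2 : ℂ) * (‖z‖ : ℂ) ^ 2 + 0 * ((inner ℝ (0 : ℂ) z : ℝ) : ℂ))‖
      = Real.exp (-(‖z‖ ^ 2) / 2) := by
    rw [Complex.norm_exp]
    congr 1
    have : (-(1 / 2 : ℂ) * (‖z‖ : ℂ) ^ 2 + 0 * ((inner ℝ (0 : ℂ) z : ℝ) : ℂ))
      = ((-(‖z‖ ^ 2) / 2 : ℝ) : ℂ) := by push_cast; ring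
    rw [this, Complex.ofReal_re]
  rw [h1, smul_eq_mul, Real.norm_of_nonneg (by positivity), mul_assoc, mul_assoc, ← Real.exp_add,
    ← Real.exp_add]
  refine mul_le_mul_of_nonneg_left (Real.exp_le_exp.mpr ?_) (by positivity)
  nlinarith [sq_nonneg (c - ‖z‖)]

theorem integral_exp_re_mul_stdComplexGaussian (v : ℂ) :
    ∫ z, Complex.exp (((v * z).re : ℂ) * Complex.I) ∂stdComplexGaussian
      = Complex.exp (-(‖v‖ ^ 2 / 4 : ℝ)) := by
  rw [integral_stdComplexGaussian]
  have h := GaussianFourier.integral_cexp_neg_mul_sq_norm_add (V := ℂ) (b := 1)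
    (by simp) Complex.I (conj v)
  have h2 : (fun z : ℂ => (Real.pi⁻¹ * Real.exp (-‖z‖ ^ 2)) •
      Complex.exp (((v * z).re : ℂ) * Complex.I)) = fun z : ℂ => (Real.pi⁻¹ : ℂ) *
      Complex.exp (-1 * (‖z‖ : ℂ) ^ 2 + Complex.I * ((inner ℝ (conj v) z : ℝ) : ℂ)) := by
    funext z
    rw [Complex.exp_add, Complex.real_smul, Complex.inner]
    push_cast
    simp only [Complex.conj_conj, neg_mul, one_mul, mul_comm, mul_left_comm]
  rw [h2, integral_const_mul, h, Complex.finrank_real_complex]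
  simp only [div_one, Nat.cast_ofNat]
  have : (2 / 2 : ℂ) = 1 := by norm_num
  rw [this, Complex.cpow_one, ← mul_assoc, inv_mul_cancel₀ (by exact_mod_cast Real.pi_ne_zero),
    one_mul]
  congr 1
  rw [Complex.I_sq, RCLike.norm_conj]
  push_cast
  ring

theorem integrable_pow_mul_conj_pow (m n : ℕ) :
    Integrable (fun z : ℂ => z ^ m * conj z ^ n) stdComplexGaussian := by
  refine ((integrable_exp_mul_norm 1).const_mul ((m + n).factorial : ℝ)).mono'
    (by fun_prop) (Filter.Eventually.of_forall fun z => ?_)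
  rw [norm_mul, norm_pow, norm_pow, RCLike.norm_conj, ← pow_add, one_mul]
  have := Real.pow_div_factorial_le_exp ‖z‖ (norm_nonneg z) (m + n)
  rw [div_le_iff₀ (by positivity)] at this
  linarith

/-! ### Gaussian vectors -/

theorem integral_stdGaussianVector_prod {k : ℕ} (g : Fin k → ℂ → ℂ) :
    ∫ a, ∏ j, g j (a j) ∂stdGaussianVector k = ∏ j, ∫ z, g j z ∂stdComplexGaussian :=
  integral_fintype_prod_eq_prod g

theorem integral_exp_re_sum_stdGaussianVector {k : ℕ} (v : Fin k → ℂ) :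
    ∫ a, Complex.exp (((∑ j, v j * a j).re : ℂ) * Complex.I) ∂stdGaussianVector k
      = Complex.exp (-((∑ j, ‖v j‖ ^ 2) / 4 : ℝ)) := by
  have : ∀ a : Fin k → ℂ, Complex.exp (((∑ j, v j * a j).re : ℂ) * Complex.I)
      = ∏ j, Complex.exp (((v j * a j).re : ℂ) * Complex.I) := by
    intro a
    rw [← Complex.exp_sum, Complex.re_sum, Complex.ofReal_sum, Finset.sum_mul]
  simp_rw [this]
  rw [integral_stdGaussianVector_prod fun j z => Complex.exp (((v j * z).re : ℂ) * Complex.I)]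
  simp_rw [integral_exp_re_mul_stdComplexGaussian]
  rw [← Complex.exp_sum]
  congr 1
  push_cast
  rw [Finset.sum_div, Finset.sum_neg_distrib]

/-- Characteristic functions on ℂⁿ are indexed by real-linear functionals. The coefficient u_j =
ℓ(e_j) - i ℓ(i e_j) puts these in complex form, where Gaussian integrals depend on u only through a
Hermitian form. -/
theorem exists_dual_eq_re_sum {n : ℕ} (ℓ : StrongDual ℝ (Fin n → ℂ)) :
    ∃ u : Fin n → ℂ, ∀ x, ℓ x = (∑ j, u j * x j).re := by
  refine ⟨fun j => ⟨ℓ (Pi.single j 1), -ℓ (Pi.single j Complex.I)⟩, fun x => ?_⟩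
  have hx : x = ∑ j, ((x j).re • (Pi.single j (1 : ℂ) : Fin n → ℂ) +
      (x j).im • (Pi.single j Complex.I : Fin n → ℂ)) := by
    funext i
    rw [Finset.sum_apply, Finset.sum_eq_single i]
    · simp [Complex.re_add_im]
    · intro b _ hb
      simp [Pi.single_eq_of_ne (Ne.symm hb)]
    · simp
  conv_lhs => rw [hx]
  rw [map_sum, Complex.re_sum]
  refine Finset.sum_congr rfl fun j _ => ?_
  simp only [map_add, map_smul, smul_eq_mul, Complex.mul_re]
  ring

theorem measurable_mulVec {n m : ℕ} (B : Matrix (Fin n) (Fin m) ℂ) :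
    Measurable fun a : Fin m → ℂ => B.mulVec a := by
  refine Continuous.measurable ?_
  exact Continuous.matrix_mulVec continuous_const continuous_id

theorem sum_norm_sq_vecMul {n m : ℕ} (B : Matrix (Fin n) (Fin m) ℂ) (u : Fin n → ℂ) :
    ((∑ l, ‖B.transpose.mulVec u l‖ ^ 2 : ℝ) : ℂ)
      = dotProduct u ((B * B.conjTranspose).mulVec (star u)) := by
  have h : (∑ l, ((‖B.transpose.mulVec u l‖ ^ 2 : ℝ) : ℂ))
      = dotProduct (Matrix.vecMul u B) (star (Matrix.vecMul u B)) := by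
    simp only [dotProduct, Matrix.mulVec_transpose]
    refine Finset.sum_congr rfl fun l _ => ?_
    rw [Pi.star_apply, Complex.star_def, Complex.mul_conj, Complex.normSq_eq_norm_sq]
  rw [Complex.ofReal_sum, h, Matrix.star_vecMul, ← Matrix.mulVec_mulVec, Matrix.dotProduct_mulVec,
    Matrix.dotProduct_mulVec, Matrix.dotProduct_mulVec]

theorem integral_exp_re_sum_map_mulVec {n m : ℕ} (B : Matrix (Fin n) (Fin m) ℂ) (u : Fin n → ℂ) :
    ∫ x, Complex.exp (((∑ j, u j * x j).re : ℂ) * Complex.I)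
        ∂((stdGaussianVector m).map fun a => B.mulVec a)
      = Complex.exp (-(dotProduct u ((B * B.conjTranspose).mulVec (star u)) / 4)) := by
  rw [integral_map (measurable_mulVec B).aemeasurable
    (Continuous.aestronglyMeasurable (by fun_prop))]
  have : ∀ a : Fin m → ℂ, ∑ j, u j * B.mulVec a j = ∑ l, B.transpose.mulVec u l * a l := by
    intro a
    change dotProduct u (B.mulVec a) = dotProduct (B.transpose.mulVec u) a
    rw [Matrix.mulVec_transpose, Matrix.dotProduct_mulVec]
  simp_rw [this]
  rw [integral_exp_re_sum_stdGaussianVector, ← sum_norm_sq_vecMul]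
  push_cast
  rfl

/-- The law of `B a` depends only on its covariance matrix `B Bᴴ`. -/
theorem map_mulVec_eq_of_covariance_eq {n m m' : ℕ} (B : Matrix (Fin n) (Fin m) ℂ)
    (C : Matrix (Fin n) (Fin m') ℂ) (h : B * B.conjTranspose = C * C.conjTranspose) :
    (stdGaussianVector m).map (fun a => B.mulVec a)
      = (stdGaussianVector m').map fun a => C.mulVec a := by
  have := Measure.isProbabilityMeasure_map (μ := stdGaussianVector m)
    (measurable_mulVec B).aemeasurable
  have := Measure.isProbabilityMeasure_map (μ := stdGaussianVector m')
    (measurable_mulVec C).aemeasurable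
  refine Measure.ext_of_charFunDual ?_
  funext ℓ
  obtain ⟨u, hu⟩ := exists_dual_eq_re_sum ℓ
  rw [charFunDual_apply, charFunDual_apply]
  simp_rw [hu]
  rw [integral_exp_re_sum_map_mulVec, integral_exp_re_sum_map_mulVec, h]

/-- The characteristic function depends only on the modulus of the frequency, and multiplication by
ω merely rotates the frequency. -/
theorem map_mul_stdComplexGaussian {ω : ℂ} (hω : ‖ω‖ = 1) :
    MeasurePreserving (fun z => ω * z) stdComplexGaussian stdComplexGaussian := by
  refine ⟨by fun_prop, ?_⟩
  have := Measure.isProbabilityMeasure_map (μ := stdComplexGaussian)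
    (f := fun z => ω * z) (by fun_prop)
  refine Measure.ext_of_charFunDual ?_
  funext ℓ
  rw [charFunDual_apply, charFunDual_apply]
  have hl : ∀ x : ℂ, ℓ x = ((⟨ℓ 1, -ℓ Complex.I⟩ : ℂ) * x).re := by
    intro x
    conv_lhs => rw [← Complex.re_add_im x]
    have h1 : (x.re : ℂ) + x.im * Complex.I = x.re • (1 : ℂ) + x.im • Complex.I := by simp
    rw [h1, map_add, map_smul, map_smul]
    simp only [smul_eq_mul, Complex.mul_re]
    ring
  rw [integral_congr_ae (Filter.Eventually.of_forall fun x => by simp only [hl x]; rfl),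
    integral_congr_ae (μ := stdComplexGaussian)
      (Filter.Eventually.of_forall fun x => by simp only [hl x]; rfl)]
  rw [integral_map (by fun_prop) (by fun_prop)]
  simp_rw [← mul_assoc]
  rw [integral_exp_re_mul_stdComplexGaussian, integral_exp_re_mul_stdComplexGaussian, norm_mul, hω,
    mul_one]

/-- On the diagonal this is a radial Gamma integral; off the diagonal a suitable rotation changes
the sign of the integrand. -/
theorem integral_pow_mul_conj_pow (m n : ℕ) :
    ∫ z : ℂ, z ^ m * conj z ^ n ∂stdComplexGaussian = if m = n then (m.factorial : ℂ) else 0 := by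
  split_ifs with h
  · subst h
    rw [integral_stdComplexGaussian]
    have h1 := Complex.integral_rpow_mul_exp_neg_rpow (p := 2) (q := 2 * m) (by norm_num)
      (by linarith [(Nat.cast_nonneg m : (0 : ℝ) ≤ m)])
    have h2 : (fun z : ℂ => (Real.pi⁻¹ * Real.exp (-‖z‖ ^ 2)) • (z ^ m * conj z ^ m))
        = fun z : ℂ => ((Real.pi⁻¹ * (‖z‖ ^ (2 * m : ℝ) * Real.exp (-‖z‖ ^ (2 : ℝ))) : ℝ) : ℂ) := by
      funext z
      rw [← mul_pow, Complex.mul_conj, Complex.normSq_eq_norm_sq, Complex.real_smul]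
      rw [Real.rpow_mul (norm_nonneg _), Real.rpow_natCast, Real.rpow_ofNat]
      push_cast
      ring
    rw [h2, integral_complex_ofReal, integral_const_mul, h1]
    have h3 : ((2 * m + 2) / 2 : ℝ) = m + 1 := by ring
    rw [h3, Real.Gamma_nat_eq_factorial]
    push_cast
    have : (Real.pi : ℂ) ≠ 0 := by exact_mod_cast Real.pi_ne_zero
    field_simp
  -- The angle π/(m - n) makes ω^m ω̄^n equal to e^{iπ} = -1.
  · set ω : ℂ := Complex.exp (((Real.pi / ((m : ℝ) - n) : ℝ) : ℂ) * Complex.I) with hω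
    have hn : ‖ω‖ = 1 := Complex.norm_exp_ofReal_mul_I _
    have hmn : ((m : ℂ) - n) ≠ 0 := by
      rw [sub_ne_zero]; exact_mod_cast h
    have hpow : ω ^ m * conj ω ^ n = -1 := by
      rw [hω, ← Complex.exp_conj, ← Complex.exp_nat_mul, ← Complex.exp_nat_mul, ← Complex.exp_add,
        ← Complex.exp_pi_mul_I]
      congr 1
      simp only [map_mul, Complex.conj_ofReal, Complex.conj_I]
      push_cast
      field_simp
      ring
    have h1 := (map_mul_stdComplexGaussian hn).integral_comp'
      (f := (MeasurableEquiv.mulLeft₀ ω (by rw [hω]; exact Complex.exp_ne_zero _)))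
      (fun z => z ^ m * conj z ^ n)
    simp only [MeasurableEquiv.coe_mulLeft₀, map_mul, mul_pow] at h1
    have h2 : ∀ z : ℂ, ω ^ m * z ^ m * (conj ω ^ n * conj z ^ n) = -(z ^ m * conj z ^ n) := by
      intro z
      rw [mul_mul_mul_comm, hpow]; ring
    simp_rw [h2] at h1
    rw [integral_neg] at h1
    have := neg_eq_self.mp h1
    exact this

/-! ### Wick polynomials -/

section Wick

variable {R : Type*} [CommRing R]

/-- The `r`-th term of the Wick polynomial. -/
def wickTerm (m n : ℕ) (x y : R) (r : ℕ) : R :=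
  (-1) ^ r * (r.factorial : R) * (m.choose r : R) * (n.choose r : R) * x ^ (m - r) * y ^ (n - r)

/-- The Wick polynomial `:xᵐ yⁿ:` for commuting `x, y` of covariance one. -/
def wick (m n : ℕ) (x y : R) : R :=
  ∑ r ∈ Finset.range (min m n + 1), wickTerm m n x y r

/-- Past `min m n` one of the binomial coefficients is zero. The freedom in the upper limit lets
sums with different indices be compared term by term. -/
theorem wick_eq_sum_range {m n N : ℕ} (h : min m n < N) (x y : R) :
    wick m n x y = ∑ r ∈ Finset.range N, wickTerm m n x y r := by
  refine Finset.sum_subset (Finset.range_subset_range.mpr h) fun r _ hr => ?_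
  rw [Finset.mem_range, not_lt] at hr
  rcases min_lt_iff.mp (Nat.lt_of_succ_le hr) with h | h <;>
    simp [wickTerm, Nat.choose_eq_zero_of_lt h]

theorem wick_symm (m n : ℕ) (x y : R) : wick m n x y = wick n m y x := by
  rw [wick, wick, min_comm]
  refine Finset.sum_congr rfl fun r _ => ?_
  unfold wickTerm; ring

@[simp] theorem wick_zero_left (n : ℕ) (x y : R) : wick 0 n x y = y ^ n := by
  simp [wick, wickTerm]

/-- Pascal's rule in m, with r! C(n, r) rewritten by absorption. The second summand is the
contraction of the new x with one of the n factors y. -/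
theorem wickTerm_succ_succ (m n q : ℕ) (x y : R) :
    wickTerm (m + 1) n x y (q + 1) = x * wickTerm m n x y (q + 1) - n * wickTerm m (n - 1) x y q := by
  have h1 : ((q + 1).factorial : R) * (n.choose (q + 1) : R)
      = n * ((q.factorial : R) * ((n - 1).choose q : R)) := by
    cases n with
    | zero => simp
    | succ n =>
      have := Nat.add_one_mul_choose_eq n q
      rw [Nat.add_sub_cancel, Nat.factorial_succ]
      have h2 : (((n + 1 : ℕ) : R)) * (n.choose q : R) = ((n + 1).choose (q + 1) : R) * ((q + 1 : ℕ) : R) := by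
        rw [← Nat.cast_mul, ← Nat.cast_mul, this]
      rw [Nat.cast_mul]
      linear_combination -(q.factorial : R) * h2
  have h3 : (m.choose (q + 1) : R) * (x * x ^ (m - (q + 1))) = (m.choose (q + 1) : R) * x ^ (m - q) := by
    rcases Nat.lt_or_ge q m with h | h
    · rw [← pow_succ', show m - (q + 1) + 1 = m - q by omega]
    · rw [Nat.choose_eq_zero_of_lt (by omega)]; simp
  have e1 : m + 1 - (q + 1) = m - q := by omega
  have e2 : n - 1 - q = n - (q + 1) := by omega
  unfold wickTerm
  rw [e1, e2, Nat.choose_succ_succ', Nat.cast_add]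
  linear_combination (-(-1) ^ q * (m.choose q : R) * x ^ (m - q) * y ^ (n - (q + 1))) * h1
    + ((-1) ^ q * ((q + 1).factorial : R) * (n.choose (q + 1) : R) * y ^ (n - (q + 1))) * h3

/-- Adding a factor x means multiplying by x and subtracting its n possible contractions. The
truncated `n - 1` is harmless at n = 0 because of the factor n. -/
theorem wick_succ_left (m n : ℕ) (x y : R) :
    wick (m + 1) n x y = x * wick m n x y - n * wick m (n - 1) x y := by
  rw [wick_eq_sum_range (N := m + 1 + 1) (by omega), wick_eq_sum_range (N := m + 1 + 1) (m := m) (by omega),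
    wick_eq_sum_range (N := m + 1) (m := m) (by omega), Finset.sum_range_succ',
    Finset.sum_range_succ' (fun r => wickTerm m n x y r), Finset.sum_congr rfl
      fun q _ => wickTerm_succ_succ m n q x y, Finset.sum_sub_distrib, mul_add, Finset.mul_sum,
    Finset.mul_sum]
  have : wickTerm (m + 1) n x y 0 = x * wickTerm m n x y 0 := by
    simp only [wickTerm, pow_zero, Nat.factorial_zero, Nat.cast_one, Nat.choose_zero_right,
      Nat.sub_zero]
    ring
  rw [this]
  ring

theorem wick_succ_right (m n : ℕ) (x y : R) :
    wick m (n + 1) x y = y * wick m n x y - m * wick (m - 1) n x y := by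
  rw [wick_symm, wick_succ_left, wick_symm n m, wick_symm n (m - 1)]

/-- The Appell property: Wick powers are differentiated as if they were ordinary monomials. A
general derivation is allowed so that it can be applied to the partial derivatives of
`MvPolynomial`. -/
theorem derivation_wick {A : Type*} [CommRing A] [Algebra A R] (D : Derivation A R R) (m n : ℕ)
    (x y : R) :
    D (wick m n x y) = m * wick (m - 1) n x y * D x + n * wick m (n - 1) x y * D y := by
  induction m generalizing n with
  | zero =>
    simp only [wick_zero_left, Nat.cast_zero, zero_mul, zero_add]
    rw [Derivation.leibniz_pow, smul_eq_mul, nsmul_eq_mul]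
    ring
  | succ m ih =>
    have hn : ∀ z : R, D ((n : R) * z) = n * D z := by
      intro z
      rw [← nsmul_eq_mul, map_nsmul, nsmul_eq_mul]
    rw [wick_succ_left, map_sub, Derivation.leibniz, smul_eq_mul, smul_eq_mul, hn, ih, ih]
    have h1 : (m : R) * wick m n x y = m * (x * wick (m - 1) n x y - n * wick (m - 1) (n - 1) x y) := by
      cases m with
      | zero => simp
      | succ m => rw [wick_succ_left, Nat.add_sub_cancel]
    have h2 := wick_succ_left m (n - 1) x y
    have h3 : (n : R) * ((n - 1 : ℕ) : R) * wick m (n - 1 - 1) x y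
        = n * (x * wick m (n - 1) x y - wick (m + 1) (n - 1) x y) := by
      rw [h2]; ring
    rw [Nat.add_sub_cancel]
    push_cast
    linear_combination (-D x) * h1 - D y * h3

theorem map_wick {S : Type*} [CommRing S] (φ : R →+* S) (m n : ℕ) (x y : R) :
    φ (wick m n x y) = wick m n (φ x) (φ y) := by
  simp [wick, wickTerm]

end Wick

theorem wickPower_eq_wick (m n : ℕ) (a : ℂ) : wickPower m n a = wick m n a (conj a) := rfl

theorem conj_wickPower (m n : ℕ) (a : ℂ) : conj (wickPower m n a) = wickPower n m a := by
  rw [wickPower_eq_wick, wickPower_eq_wick, map_wick, Complex.conj_conj, wick_symm]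

theorem continuous_wickPower (m n : ℕ) : Continuous (wickPower m n) := by
  unfold wickPower
  have : Continuous (fun z : ℂ => conj z) := Complex.continuous_conj
  fun_prop

/-! ### Gaussian expectation of polynomials in two variables and their conjugates -/

/-- The values of `(a, ā, b, b̄)`. -/
def conjVars (x : Fin 2 → ℂ) : Fin 4 → ℂ := ![x 0, conj (x 0), x 1, conj (x 1)]

theorem eval_conjVars_monomial (s : Fin 4 →₀ ℕ) (c : ℂ) (x : Fin 2 → ℂ) :
    MvPolynomial.eval (conjVars x) (MvPolynomial.monomial s c)
      = c * ∏ j : Fin 2, (x j ^ (![s 0, s 2] j) * conj (x j) ^ (![s 1, s 3] j)) := by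
  rw [MvPolynomial.eval_monomial, Finsupp.prod_fintype _ _ (by simp)]
  simp only [conjVars, Fin.prod_univ_four, Fin.prod_univ_two, Matrix.cons_val_zero,
    Matrix.cons_val_one, Matrix.cons_val]
  ring

theorem integrable_eval_conjVars (p : MvPolynomial (Fin 4) ℂ) :
    Integrable (fun x => MvPolynomial.eval (conjVars x) p) (stdGaussianVector 2) := by
  induction p using MvPolynomial.induction_on' with
  | monomial s c =>
    simp_rw [eval_conjVars_monomial]
    exact (Integrable.fintype_prod (f := fun j z => z ^ (![s 0, s 2] j) * conj z ^ (![s 1, s 3] j))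
      fun j => integrable_pow_mul_conj_pow _ _).const_mul _
  | add p q hp hq =>
    simp only [map_add]
    exact hp.add hq

/-- The expectation of a polynomial in `(a, ā, b, b̄)`. -/
noncomputable def gaussianExp : MvPolynomial (Fin 4) ℂ →ₗ[ℂ] ℂ where
  toFun p := ∫ x, MvPolynomial.eval (conjVars x) p ∂stdGaussianVector 2
  map_add' p q := by
    simp only [map_add]
    exact integral_add (integrable_eval_conjVars p) (integrable_eval_conjVars q)
  map_smul' c p := by
    simp only [MvPolynomial.smul_eval, RingHom.id_apply, smul_eq_mul]
    exact integral_const_mul _ _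

theorem gaussianExp_monomial (s : Fin 4 →₀ ℕ) (c : ℂ) :
    gaussianExp (MvPolynomial.monomial s c) = c * ((if s 0 = s 1 then ((s 0).factorial : ℂ) else 0)
      * (if s 2 = s 3 then ((s 2).factorial : ℂ) else 0)) := by
  change ∫ x, MvPolynomial.eval (conjVars x) _ ∂stdGaussianVector 2 = _
  simp_rw [eval_conjVars_monomial]
  rw [integral_const_mul, integral_stdGaussianVector_prod
    fun j z => z ^ (![s 0, s 2] j) * conj z ^ (![s 1, s 3] j)]
  simp only [Fin.prod_univ_two, Matrix.cons_val_zero, Matrix.cons_val_one, integral_pow_mul_conj_pow]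
  rfl

/-- Gaussian integration by parts. -/
theorem gaussianExp_X_mul (i j : Fin 4)
    (hij : (i, j) ∈ ({(0, 1), (1, 0), (2, 3), (3, 2)} : Finset (Fin 4 × Fin 4)))
    (p : MvPolynomial (Fin 4) ℂ) :
    gaussianExp (MvPolynomial.X i * p) = gaussianExp (MvPolynomial.pderiv j p) := by
  induction p using MvPolynomial.induction_on' with
  | monomial s c =>
    rw [MvPolynomial.pderiv_monomial, MvPolynomial.X, MvPolynomial.monomial_mul,
      gaussianExp_monomial, gaussianExp_monomial, one_mul, mul_assoc]
    congr 1
    -- On monomials, integration by parts is (a+1)! = (a+1) a! on the diagonal a + 1 = b. The two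
    -- versions cover integration by parts against a variable and against its conjugate; the case b
    -- = 0 is killed by the factor b.
    have key : ∀ a b : ℕ, (if a + 1 = b then ((a + 1).factorial : ℂ) else 0)
        = b * (if a = b - 1 then (a.factorial : ℂ) else 0) := by
      intro a b
      cases b with
      | zero => simp
      | succ b =>
        by_cases h : a = b
        · subst h; simp [Nat.factorial_succ]
        · simp [h]
    have key' : ∀ a b : ℕ, (if b = a + 1 then (b.factorial : ℂ) else 0)
        = b * (if b - 1 = a then ((b - 1).factorial : ℂ) else 0) := by
      intro a b
      cases b with
      | zero => simp
      | succ b =>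
        by_cases h : b = a
        · subst h; simp [Nat.factorial_succ]
        · simp [h]
    simp only [Finset.mem_insert, Finset.mem_singleton, Prod.mk.injEq] at hij
    rcases hij with ⟨rfl, rfl⟩ | ⟨rfl, rfl⟩ | ⟨rfl, rfl⟩ | ⟨rfl, rfl⟩ <;>
      simp only [Finsupp.add_apply, Finsupp.tsub_apply, Finsupp.single_apply] <;>
      simp [add_comm 1, key, key', mul_assoc, mul_left_comm]
  | add p q hp hq => rw [mul_add, map_add, map_add, map_add, hp, hq]

open MvPolynomial in
/-- The expectation of `:ā^{m'} a^{n'}: :b^m b̄^n:` for `b = c a + s a'`. -/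
theorem gaussianExp_wick_wick {c s : ℂ} (hcs : c * conj c + s * conj s = 1) (m' n' m n : ℕ) :
    gaussianExp (wick n' m' (X 0) (X 1) *
      wick m n (C c * X 0 + C s * X 2) (C (conj c) * X 1 + C (conj s) * X 3))
      = if m = m' ∧ n = n' then (m.factorial * n.factorial : ℂ) * (c ^ m * conj c ^ n) else 0 := by
  have hC : ∀ (z : ℂ) p, gaussianExp (C z * p) = z * gaussianExp p := by
    intro z p; rw [C_mul', map_smul, smul_eq_mul]
  have hN : ∀ (z : ℕ) p, gaussianExp ((z : MvPolynomial (Fin 4) ℂ) * p) = z * gaussianExp p := by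
    intro z p
    rw [← hC, map_natCast]
  set B : MvPolynomial (Fin 4) ℂ := C c * X 0 + C s * X 2
  set B' : MvPolynomial (Fin 4) ℂ := C (conj c) * X 1 + C (conj s) * X 3
  have d1B : pderiv 1 B = 0 := by simp [B, pderiv_X]
  have d0B : pderiv 0 B = C c := by simp [B, pderiv_X]
  have d2B : pderiv 2 B = C s := by simp [B, pderiv_X]
  have d3B : pderiv 3 B = 0 := by simp [B, pderiv_X]
  have d0B' : pderiv 0 B' = 0 := by simp [B', pderiv_X]
  have d1B' : pderiv 1 B' = C (conj c) := by simp [B', pderiv_X]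
  have d2B' : pderiv 2 B' = 0 := by simp [B', pderiv_X]
  have d3B' : pderiv 3 B' = C (conj s) := by simp [B', pderiv_X]
  -- Expand one factor B by the Wick recursion and integrate by parts. Contracting it with the B' of
  -- the same Wick polynomial gives c c̄ + s s̄ = 1 times n, which cancels the Wick correction; only
  -- the contraction with the other Wick polynomial survives. `rec2` is the same for B'.
  have rec1 : ∀ m' n' m n, gaussianExp (wick n' m' (X 0) (X 1) * wick (m + 1) n B B')
      = c * m' * gaussianExp (wick n' (m' - 1) (X 0) (X 1) * wick m n B B') := by
    intro m' n' m n
    have e : wick n' m' (X 0) (X 1) * wick (m + 1) n B B'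
        = C c * (X 0 * (wick n' m' (X 0) (X 1) * wick m n B B'))
          + C s * (X 2 * (wick n' m' (X 0) (X 1) * wick m n B B'))
          - (n : MvPolynomial (Fin 4) ℂ) * (wick n' m' (X 0) (X 1) * wick m (n - 1) B B') := by
      rw [wick_succ_left]; simp only [B]; ring
    rw [e, map_sub, map_add, hC, hC, hN, gaussianExp_X_mul 0 1 (by decide),
      gaussianExp_X_mul 2 3 (by decide)]
    simp only [Derivation.leibniz, derivation_wick, d1B, d3B, d1B', d3B', smul_eq_mul]
    simp only [pderiv_X_self, pderiv_X_of_ne (show (0 : Fin 4) ≠ 1 by decide),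
      pderiv_X_of_ne (show (0 : Fin 4) ≠ 3 by decide),
      pderiv_X_of_ne (show (1 : Fin 4) ≠ 3 by decide), mul_zero, zero_add, mul_one, add_zero]
    rw [map_add]
    have f1 : wick n' m' (X 0) (X 1) * ((n : MvPolynomial (Fin 4) ℂ) * wick m (n - 1) B B' * C (conj c))
        = C (conj c) * ((n : MvPolynomial (Fin 4) ℂ) * (wick n' m' (X 0) (X 1) * wick m (n - 1) B B')) := by ring
    have f2 : wick n' m' (X 0) (X 1) * ((n : MvPolynomial (Fin 4) ℂ) * wick m (n - 1) B B' * C (conj s))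
        = C (conj s) * ((n : MvPolynomial (Fin 4) ℂ) * (wick n' m' (X 0) (X 1) * wick m (n - 1) B B')) := by ring
    have f3 : wick m n B B' * ((m' : MvPolynomial (Fin 4) ℂ) * wick n' (m' - 1) (X 0) (X 1))
        = (m' : MvPolynomial (Fin 4) ℂ) * (wick n' (m' - 1) (X 0) (X 1) * wick m n B B') := by ring
    rw [f1, f2, f3, hC, hC, hN, hN]
    linear_combination ((n : ℂ) * gaussianExp (wick n' m' (X 0) (X 1) * wick m (n - 1) B B')) * hcs
  have rec2 : ∀ m' n' m n, gaussianExp (wick n' m' (X 0) (X 1) * wick m (n + 1) B B')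
      = conj c * n' * gaussianExp (wick (n' - 1) m' (X 0) (X 1) * wick m n B B') := by
    intro m' n' m n
    have e : wick n' m' (X 0) (X 1) * wick m (n + 1) B B'
        = C (conj c) * (X 1 * (wick n' m' (X 0) (X 1) * wick m n B B'))
          + C (conj s) * (X 3 * (wick n' m' (X 0) (X 1) * wick m n B B'))
          - (m : MvPolynomial (Fin 4) ℂ) * (wick n' m' (X 0) (X 1) * wick (m - 1) n B B') := by
      rw [wick_succ_right]; simp only [B']; ring
    rw [e, map_sub, map_add, hC, hC, hN, gaussianExp_X_mul 1 0 (by decide),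
      gaussianExp_X_mul 3 2 (by decide)]
    simp only [Derivation.leibniz, derivation_wick, d0B, d2B, d0B', d2B', smul_eq_mul]
    simp only [pderiv_X_self, pderiv_X_of_ne (show (1 : Fin 4) ≠ 0 by decide),
      pderiv_X_of_ne (show (0 : Fin 4) ≠ 2 by decide),
      pderiv_X_of_ne (show (1 : Fin 4) ≠ 2 by decide), mul_zero, mul_one, add_zero]
    rw [map_add]
    have f1 : wick n' m' (X 0) (X 1) * ((m : MvPolynomial (Fin 4) ℂ) * wick (m - 1) n B B' * C c)
        = C c * ((m : MvPolynomial (Fin 4) ℂ) * (wick n' m' (X 0) (X 1) * wick (m - 1) n B B')) := by ring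
    have f2 : wick n' m' (X 0) (X 1) * ((m : MvPolynomial (Fin 4) ℂ) * wick (m - 1) n B B' * C s)
        = C s * ((m : MvPolynomial (Fin 4) ℂ) * (wick n' m' (X 0) (X 1) * wick (m - 1) n B B')) := by ring
    have f3 : wick m n B B' * ((n' : MvPolynomial (Fin 4) ℂ) * wick (n' - 1) m' (X 0) (X 1))
        = (n' : MvPolynomial (Fin 4) ℂ) * (wick (n' - 1) m' (X 0) (X 1) * wick m n B B') := by ring
    rw [f1, f2, f3, hC, hC, hN, hN]
    linear_combination ((m : ℂ) * gaussianExp (wick n' m' (X 0) (X 1) * wick (m - 1) n B B')) * hcs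
  -- A single nontrivial Wick polynomial has mean zero: integration by parts reproduces exactly the
  -- subtracted contraction.
  have base : ∀ m' n', gaussianExp (wick n' m' (X 0) (X 1)) = if 0 = m' ∧ 0 = n' then 1 else 0 := by
    intro m' n'
    cases n' with
    | succ n' =>
      rw [wick_succ_left, map_sub, hN, gaussianExp_X_mul 0 1 (by decide), derivation_wick]
      simp only [pderiv_X_self, pderiv_X_of_ne (show (0 : Fin 4) ≠ 1 by decide), mul_zero, zero_add,
        mul_one, hN]
      simp
    | zero =>
      cases m' with
      | succ m' =>
        rw [wick_succ_right, map_sub, hN, gaussianExp_X_mul 1 0 (by decide), derivation_wick]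
        simp only [pderiv_X_self, pderiv_X_of_ne (show (1 : Fin 4) ≠ 0 by decide), mul_zero, mul_one]
        simp
      | zero =>
        have := gaussianExp_monomial 0 1
        simpa using this
  induction m generalizing m' n' with
  | zero =>
    induction n generalizing m' n' with
    | zero =>
      have := base m' n'
      simpa using this
    | succ n ih =>
      rw [rec2, ih]
      cases n' with
      | zero => simp
      | succ n' =>
        simp only [Nat.add_sub_cancel, Nat.add_right_cancel_iff]
        split_ifs with h
        · obtain ⟨rfl, rfl⟩ := h
          rw [Nat.factorial_succ]; push_cast; ring
        · simp
  | succ m ih =>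
    rw [rec1, ih]
    cases m' with
    | zero => simp
    | succ m' =>
      simp only [Nat.add_sub_cancel, Nat.add_right_cancel_iff]
      split_ifs with h
      · obtain ⟨rfl, rfl⟩ := h
        rw [Nat.factorial_succ]; push_cast; ring
      · simp

theorem integral_conj_wickPower_mul_wickPower {c s : ℂ} (hcs : c * conj c + s * conj s = 1)
    (m' n' m n : ℕ) :
    Integrable (fun x : Fin 2 → ℂ => conj (wickPower m' n' (x 0)) *
        wickPower m n (c * x 0 + s * x 1)) (stdGaussianVector 2) ∧
    ∫ x, conj (wickPower m' n' (x 0)) * wickPower m n (c * x 0 + s * x 1) ∂stdGaussianVector 2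
      = if m = m' ∧ n = n' then (m.factorial * n.factorial : ℂ) * (c ^ m * conj c ^ n) else 0 := by
  rw [← gaussianExp_wick_wick hcs]
  have : ∀ x : Fin 2 → ℂ, conj (wickPower m' n' (x 0)) * wickPower m n (c * x 0 + s * x 1)
      = MvPolynomial.eval (conjVars x) (wick n' m' (MvPolynomial.X 0) (MvPolynomial.X 1) *
        wick m n (MvPolynomial.C c * MvPolynomial.X 0 + MvPolynomial.C s * MvPolynomial.X 2)
          (MvPolynomial.C (conj c) * MvPolynomial.X 1 + MvPolynomial.C (conj s) * MvPolynomial.X 3)) := by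
    intro x
    rw [conj_wickPower, wickPower_eq_wick, wickPower_eq_wick, map_mul, map_wick, map_wick]
    simp [conjVars]
  simp_rw [this]
  exact ⟨integrable_eval_conjVars _, rfl⟩

/-! ### Marginals -/

theorem eq_stdComplexGaussian_of_integral_exp {μ : Measure ℂ} [IsFiniteMeasure μ]
    (h : ∀ v : ℂ, ∫ z, Complex.exp (((v * z).re : ℂ) * Complex.I) ∂μ
      = Complex.exp (-(‖v‖ ^ 2 / 4 : ℝ))) : μ = stdComplexGaussian := by
  refine Measure.ext_of_charFunDual ?_
  funext ℓ
  rw [charFunDual_apply, charFunDual_apply]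
  have hl : ∀ x : ℂ, ℓ x = ((⟨ℓ 1, -ℓ Complex.I⟩ : ℂ) * x).re := by
    intro x
    have h1 : x = x.re • (1 : ℂ) + x.im • Complex.I := by simp [Complex.re_add_im]
    conv_lhs => rw [h1]
    rw [map_add, map_smul, map_smul]
    simp only [smul_eq_mul, Complex.mul_re]
    ring
  have e : (fun x : ℂ => Complex.exp ((ℓ x : ℂ) * Complex.I)) = fun x : ℂ =>
      Complex.exp ((((⟨ℓ 1, -ℓ Complex.I⟩ : ℂ) * x).re : ℂ) * Complex.I) := by
    funext x; rw [← hl]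
  rw [e, h, integral_exp_re_mul_stdComplexGaussian]

/-- The characteristic function of ∑ v_j a_j sees v only through ∑ ‖v_j‖². -/
theorem measurePreserving_sum_mul {m : ℕ} (v : Fin m → ℂ) (hv : ∑ j, ‖v j‖ ^ 2 = 1) :
    MeasurePreserving (fun a : Fin m → ℂ => ∑ j, v j * a j) (stdGaussianVector m)
      stdComplexGaussian := by
  have hm : Measurable (fun a : Fin m → ℂ => ∑ j, v j * a j) := by fun_prop
  refine ⟨hm, ?_⟩
  have := Measure.isProbabilityMeasure_map (μ := stdGaussianVector m) hm.aemeasurable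
  refine eq_stdComplexGaussian_of_integral_exp fun u => ?_
  rw [integral_map hm.aemeasurable (Continuous.aestronglyMeasurable (by fun_prop))]
  have : ∀ a : Fin m → ℂ, u * ∑ j, v j * a j = ∑ j, (u * v j) * a j := by
    intro a; rw [Finset.mul_sum]; simp_rw [mul_assoc]
  simp_rw [this]
  rw [integral_exp_re_sum_stdGaussianVector]
  simp_rw [norm_mul, mul_pow]
  rw [← Finset.mul_sum, hv, mul_one]

/-- The law of `k` i.i.d. pairs of independent standard complex Gaussians. -/
noncomputable def gaussianPairs (k : ℕ) : Measure (Fin k → Fin 2 → ℂ) :=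
  Measure.pi fun _ => stdGaussianVector 2

instance isProbabilityMeasure_gaussianPairs (k : ℕ) : IsProbabilityMeasure (gaussianPairs k) := by
  unfold gaussianPairs; infer_instance

theorem measurePreserving_correlate (k : ℕ) {c s : ℂ} (hcs : ‖c‖ ^ 2 + ‖s‖ ^ 2 = 1) :
    MeasurePreserving (fun (x : Fin k → Fin 2 → ℂ) i => c * x i 0 + s * x i 1)
      (gaussianPairs k) (stdGaussianVector k) := by
  refine measurePreserving_pi (fun _ => stdGaussianVector 2) (fun _ => stdComplexGaussian)
    (f := fun _ (y : Fin 2 → ℂ) => c * y 0 + s * y 1) fun i => ?_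
  have := measurePreserving_sum_mul ![c, s] (by simpa using hcs)
  simpa using this

theorem measurePreserving_fst (k : ℕ) :
    MeasurePreserving (fun (x : Fin k → Fin 2 → ℂ) i => x i 0)
      (gaussianPairs k) (stdGaussianVector k) := by
  have := measurePreserving_correlate k (c := 1) (s := 0) (by simp)
  simpa using this

/-! ### Products of Wick powers -/

variable {k : ℕ}

/-- The product of Wick powers `∏ⱼ :aⱼ^{mⱼ} āⱼ^{nⱼ}:`. -/
def wickProd (m n : Fin k → ℕ) (a : Fin k → ℂ) : ℂ := ∏ j, wickPower (m j) (n j) (a j)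

theorem conj_wickProd (m n : Fin k → ℕ) (a : Fin k → ℂ) :
    conj (wickProd m n a) = wickProd n m a := by
  simp [wickProd, conj_wickPower]

theorem continuous_wickProd (m n : Fin k → ℕ) : Continuous (wickProd m n) := by
  unfold wickProd
  exact continuous_finsetProd _ fun j _ => (continuous_wickPower _ _).comp (continuous_apply j)

/-- Each monomial is bounded by tᴺ ≤ N! eᵗ. Exponential bounds multiply well over the coordinates,
which is why they are preferred to polynomial ones. -/
theorem exists_norm_wickPower_le (m n : ℕ) : ∃ C, 0 ≤ C ∧ ∀ z, ‖wickPower m n z‖ ≤ C * Real.exp ‖z‖ := by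
  refine ⟨∑ r ∈ Finset.range (min m n + 1), ‖(-1) ^ r * (r.factorial : ℂ) * (m.choose r : ℂ) *
    (n.choose r : ℂ)‖ * ((m - r) + (n - r)).factorial, by positivity, fun z => ?_⟩
  unfold wickPower
  rw [Finset.sum_mul]
  refine (norm_sum_le _ _).trans (Finset.sum_le_sum fun r _ => ?_)
  rw [mul_assoc _ (z ^ _), norm_mul, mul_assoc (‖_‖ : ℝ)]
  refine mul_le_mul_of_nonneg_left ?_ (norm_nonneg _)
  rw [norm_mul, norm_pow, norm_pow, RCLike.norm_conj, ← pow_add]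
  have := Real.pow_div_factorial_le_exp ‖z‖ (norm_nonneg z) ((m - r) + (n - r))
  rw [div_le_iff₀ (by positivity)] at this
  linarith

theorem exists_norm_wickProd_le (m n : Fin k → ℕ) :
    ∃ C, ∀ a, ‖wickProd m n a‖ ≤ C * Real.exp (∑ j, ‖a j‖) := by
  choose C hC0 hC using fun j => exists_norm_wickPower_le (m j) (n j)
  refine ⟨∏ j, C j, fun a => ?_⟩
  rw [wickProd, norm_prod, Real.exp_sum, ← Finset.prod_mul_distrib]
  exact Finset.prod_le_prod (fun _ _ => norm_nonneg _) fun j _ => hC j _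

theorem integrable_exp_sum_norm (c : ℝ) :
    Integrable (fun a : Fin k → ℂ => Real.exp (c * ∑ j, ‖a j‖)) (stdGaussianVector k) := by
  simp_rw [Finset.mul_sum, Real.exp_sum]
  exact Integrable.fintype_prod (f := fun _ z => Real.exp (c * ‖z‖)) fun _ => integrable_exp_mul_norm c

theorem memLp_two_of_norm_le_exp {f : (Fin k → ℂ) → ℂ} (hf : Continuous f) {C c : ℝ}
    (h : ∀ a, ‖f a‖ ≤ C * Real.exp (c * ∑ j, ‖a j‖)) : MemLp f 2 (stdGaussianVector k) := by
  have h2 : MemLp (fun a : Fin k → ℂ => Real.exp (c * ∑ j, ‖a j‖)) 2 (stdGaussianVector k) := by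
    refine (memLp_two_iff_integrable_sq (Continuous.aestronglyMeasurable (by fun_prop))).mpr ?_
    refine (integrable_exp_sum_norm (2 * c)).congr (Filter.Eventually.of_forall fun a => ?_)
    simp only [← Real.exp_nat_mul]
    congr 1; push_cast; ring
  exact (h2.const_mul C).mono' hf.aestronglyMeasurable (Filter.Eventually.of_forall h)

theorem memLp_wickProd (m n : Fin k → ℕ) : MemLp (wickProd m n) 2 (stdGaussianVector k) := by
  obtain ⟨C, hC⟩ := exists_norm_wickProd_le m n
  exact memLp_two_of_norm_le_exp (continuous_wickProd m n) (c := 1) (by simpa using hC)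

theorem integral_conj_wickProd_mul_wickProd {c s : ℂ} (hcs : ‖c‖ ^ 2 + ‖s‖ ^ 2 = 1)
    (m' n' m n : Fin k → ℕ) :
    ∫ x, conj (wickProd m' n' fun i => x i 0) * wickProd m n (fun i => c * x i 0 + s * x i 1)
        ∂gaussianPairs k
      = if m = m' ∧ n = n' then ((((∏ j, (m j).factorial) * ∏ j, (n j).factorial : ℕ) : ℂ)) *
          (c ^ (∑ j, m j) * conj c ^ (∑ j, n j)) else 0 := by
  have hcs' : c * conj c + s * conj s = 1 := by
    rw [Complex.mul_conj, Complex.mul_conj, Complex.normSq_eq_norm_sq, Complex.normSq_eq_norm_sq]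
    exact_mod_cast hcs
  have e : ∀ x : Fin k → Fin 2 → ℂ,
      conj (wickProd m' n' fun i => x i 0) * wickProd m n (fun i => c * x i 0 + s * x i 1)
      = ∏ j, (conj (wickPower (m' j) (n' j) (x j 0)) * wickPower (m j) (n j) (c * x j 0 + s * x j 1)) := by
    intro x
    rw [wickProd, wickProd, map_prod, Finset.prod_mul_distrib]
  simp_rw [e]
  rw [gaussianPairs, integral_fintype_prod_eq_prod (f := fun j (y : Fin 2 → ℂ) =>
    conj (wickPower (m' j) (n' j) (y 0)) * wickPower (m j) (n j) (c * y 0 + s * y 1))]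
  simp_rw [(integral_conj_wickPower_mul_wickPower hcs' _ _ _ _).2]
  split_ifs with h
  · obtain ⟨rfl, rfl⟩ := h
    simp only [and_self, if_true]
    rw [Finset.prod_mul_distrib, Finset.prod_mul_distrib, Finset.prod_mul_distrib,
      Finset.prod_pow_eq_pow_sum, Finset.prod_pow_eq_pow_sum]
    push_cast; rfl
  · obtain ⟨j, hj⟩ : ∃ j, ¬ (m j = m' j ∧ n j = n' j) := by
      by_contra! h'
      exact h ⟨funext fun j => (h' j).1, funext fun j => (h' j).2⟩
    exact Finset.prod_eq_zero (Finset.mem_univ j) (if_neg hj)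

/-! ### Completeness of the Wick products -/

/-- The span of the products of Wick powers. -/
def wickSpan (k : ℕ) : Submodule ℂ ((Fin k → ℂ) → ℂ) :=
  Submodule.span ℂ (Set.range fun p : (Fin k → ℕ) × (Fin k → ℕ) => wickProd p.1 p.2)

theorem wickProd_mem_wickSpan (m n : Fin k → ℕ) : wickProd m n ∈ wickSpan k :=
  Submodule.subset_span ⟨(m, n), rfl⟩

theorem wickProd_update (m n : Fin k → ℕ) (j : Fin k) (p q : ℕ) (a : Fin k → ℂ) :
    wickProd (Function.update m j p) (Function.update n j q) a
      = wickPower p q (a j) * ∏ i ∈ Finset.univ.erase j, wickPower (m i) (n i) (a i) := by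
  rw [wickProd, ← Finset.mul_prod_erase _ _ (Finset.mem_univ j)]
  congr 1
  · simp
  · refine Finset.prod_congr rfl fun i hi => ?_
    rw [Function.update_of_ne (Finset.ne_of_mem_erase hi),
      Function.update_of_ne (Finset.ne_of_mem_erase hi)]

/-- The Wick recursion read backwards: a_j times a Wick product is the next Wick product plus n_j
times a lower one. With its conjugate version it shows that the span contains all polynomials in the
coordinates and their conjugates. -/
theorem coord_mul_mem_wickSpan (j : Fin k) {v : (Fin k → ℂ) → ℂ} (hv : v ∈ wickSpan k) :
    (fun a => a j * v a) ∈ wickSpan k := by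
  induction hv using Submodule.span_induction with
  | mem v hv =>
    obtain ⟨⟨m, n⟩, rfl⟩ := hv
    have e : (fun a : Fin k → ℂ => a j * wickProd m n a)
        -- The trivial updates put all indices in the form expected by `wickProd_update`.
        = wickProd (Function.update m j (m j + 1)) (Function.update n j (n j))
          + (n j : ℂ) • wickProd (Function.update m j (m j)) (Function.update n j (n j - 1)) := by
      funext a
      rw [Pi.add_apply, Pi.smul_apply, wickProd_update, wickProd_update, wickPower_eq_wick,
        wick_succ_left, wickProd, ← Finset.mul_prod_erase _ _ (Finset.mem_univ j),
        wickPower_eq_wick, wickPower_eq_wick, smul_eq_mul]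
      ring
    simp only [e]
    exact add_mem (wickProd_mem_wickSpan _ _) (Submodule.smul_mem _ _ (wickProd_mem_wickSpan _ _))
  | zero => simp only [Pi.zero_apply, mul_zero]; exact Submodule.zero_mem _
  | add x y _ _ hx hy => simpa only [Pi.add_apply, mul_add] using! add_mem hx hy
  | smul c x _ hx => simpa only [Pi.smul_apply, smul_eq_mul, mul_left_comm] using! Submodule.smul_mem _ c hx

theorem conj_coord_mul_mem_wickSpan (j : Fin k) {v : (Fin k → ℂ) → ℂ} (hv : v ∈ wickSpan k) :
    (fun a => conj (a j) * v a) ∈ wickSpan k := by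
  induction hv using Submodule.span_induction with
  | mem v hv =>
    obtain ⟨⟨m, n⟩, rfl⟩ := hv
    have e : (fun a : Fin k → ℂ => conj (a j) * wickProd m n a)
        = wickProd (Function.update m j (m j)) (Function.update n j (n j + 1))
          + (m j : ℂ) • wickProd (Function.update m j (m j - 1)) (Function.update n j (n j)) := by
      funext a
      rw [Pi.add_apply, Pi.smul_apply, wickProd_update, wickProd_update, wickPower_eq_wick,
        wick_succ_right, wickProd, ← Finset.mul_prod_erase _ _ (Finset.mem_univ j),
        wickPower_eq_wick, wickPower_eq_wick, smul_eq_mul]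
      ring
    simp only [e]
    exact add_mem (wickProd_mem_wickSpan _ _) (Submodule.smul_mem _ _ (wickProd_mem_wickSpan _ _))
  | zero => simp only [Pi.zero_apply, mul_zero]; exact Submodule.zero_mem _
  | add x y _ _ hx hy => simpa only [Pi.add_apply, mul_add] using! add_mem hx hy
  | smul c x _ hx => simpa only [Pi.smul_apply, smul_eq_mul, mul_left_comm] using! Submodule.smul_mem _ c hx

theorem re_sum_mul_mem_wickSpan (u : Fin k → ℂ) {v : (Fin k → ℂ) → ℂ} (hv : v ∈ wickSpan k) :
    (fun a => ((∑ j, u j * a j).re : ℂ) * v a) ∈ wickSpan k := by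
  have e : (fun a : Fin k → ℂ => ((∑ j, u j * a j).re : ℂ) * v a)
      = ∑ j, ((u j / 2) • (fun a : Fin k → ℂ => a j * v a)
        + (conj (u j) / 2) • (fun a : Fin k → ℂ => conj (a j) * v a)) := by
    funext a
    rw [Finset.sum_apply, Complex.re_sum, Complex.ofReal_sum, Finset.sum_mul]
    refine Finset.sum_congr rfl fun j _ => ?_
    rw [Complex.re_eq_add_conj, map_mul]
    simp only [Pi.add_apply, Pi.smul_apply, smul_eq_mul]
    ring
  rw [e]
  exact Submodule.sum_mem _ fun j _ => add_mem
    (Submodule.smul_mem _ _ (coord_mul_mem_wickSpan j hv))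
    (Submodule.smul_mem _ _ (conj_coord_mul_mem_wickSpan j hv))

theorem re_sum_pow_mem_wickSpan (u : Fin k → ℂ) (N : ℕ) :
    (fun a : Fin k → ℂ => ((∑ j, u j * a j).re : ℂ) ^ N) ∈ wickSpan k := by
  induction N with
  | zero =>
    have : (fun a : Fin k → ℂ => ((∑ j, u j * a j).re : ℂ) ^ 0) = wickProd 0 0 := by
      funext a
      simp [wickProd, wickPower]
    rw [this]
    exact wickProd_mem_wickSpan _ _
  | succ N ih => simpa only [pow_succ'] using re_sum_mul_mem_wickSpan u ih

theorem integral_mul_eq_zero_of_mem_wickSpan {g : (Fin k → ℂ) → ℂ}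
    (hg : MemLp g 2 (stdGaussianVector k))
    (h : ∀ m n, ∫ a, wickProd m n a * g a ∂stdGaussianVector k = 0) {v : (Fin k → ℂ) → ℂ}
    (hv : v ∈ wickSpan k) :
    MemLp v 2 (stdGaussianVector k) ∧ ∫ a, v a * g a ∂stdGaussianVector k = 0 := by
  induction hv using Submodule.span_induction with
  | mem v hv =>
    obtain ⟨⟨m, n⟩, rfl⟩ := hv
    exact ⟨memLp_wickProd m n, h m n⟩
  | zero => exact ⟨MemLp.zero, by simp⟩
  | add x y _ _ hx hy =>
    refine ⟨hx.1.add hy.1, ?_⟩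
    simp only [Pi.add_apply, add_mul]
    rw [integral_add (f := fun a => x a * g a) (g := fun a => y a * g a)
      (hx.1.integrable_mul hg) (hy.1.integrable_mul hg), hx.2, hy.2, add_zero]
  | smul c x _ hx =>
    refine ⟨hx.1.const_smul c, ?_⟩
    simp only [Pi.smul_apply, smul_eq_mul, mul_assoc]
    rw [integral_const_mul, hx.2, mul_zero]

theorem abs_re_sum_le (u : Fin k → ℂ) : ∃ c, 0 ≤ c ∧ ∀ a : Fin k → ℂ, |(∑ j, u j * a j).re| ≤ c * ∑ j, ‖a j‖ := by
  refine ⟨∑ j, ‖u j‖, by positivity, fun a => (Complex.abs_re_le_norm _).trans ((norm_sum_le _ _).trans ?_)⟩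
  rw [Finset.mul_sum]
  refine Finset.sum_le_sum fun j _ => ?_
  rw [norm_mul]
  gcongr
  exact Finset.single_le_sum (f := fun j => ‖u j‖) (fun _ _ => norm_nonneg _) (Finset.mem_univ j)

/-- The exponential is expanded in its power series, whose terms lie in the Wick span. Integration
term by term is justified by exp|Re ∑ u_j a_j| · |g|, a product of two L² functions. -/
theorem integral_exp_mul_eq_zero {g : (Fin k → ℂ) → ℂ} (hg : MemLp g 2 (stdGaussianVector k))
    (h : ∀ m n, ∫ a, wickProd m n a * g a ∂stdGaussianVector k = 0) (u : Fin k → ℂ) :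
    ∫ a, Complex.exp (((∑ j, u j * a j).re : ℂ) * Complex.I) * g a ∂stdGaussianVector k = 0 := by
  obtain ⟨c, hc0, hc⟩ := abs_re_sum_le u
  have hexp : MemLp (fun a : Fin k → ℂ => (Real.exp |(∑ j, u j * a j).re| : ℂ)) 2
      (stdGaussianVector k) := by
    refine memLp_two_of_norm_le_exp (C := 1) (c := c) (by fun_prop) fun a => ?_
    rw [Complex.norm_real, Real.norm_of_nonneg (Real.exp_nonneg _), one_mul]
    exact Real.exp_le_exp.mpr (hc a)
  have hs := hasSum_integral_of_dominated_convergence (μ := stdGaussianVector k)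
    (F := fun (N : ℕ) a => (((N.factorial : ℂ)⁻¹ * Complex.I ^ N)) *
      (((∑ j, u j * a j).re : ℂ) ^ N * g a))
    (f := fun a => Complex.exp (((∑ j, u j * a j).re : ℂ) * Complex.I) * g a)
    (bound := fun N a => (|(∑ j, u j * a j).re| ^ N / (N.factorial : ℝ)) * ‖g a‖)
    (fun N => ((Continuous.aestronglyMeasurable (by fun_prop)).mul hg.1).const_mul _)
    (fun N => Filter.Eventually.of_forall fun a => by
      simp only [norm_mul, norm_inv, norm_pow, Complex.norm_I, one_pow, Complex.norm_real,
        Real.norm_eq_abs, Complex.norm_natCast, mul_one]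
      apply le_of_eq; ring)
    (Filter.Eventually.of_forall fun a => (Real.summable_pow_div_factorial _).mul_right _)
    (by
      have := (hexp.norm.integrable_mul hg.norm)
      refine this.congr (Filter.Eventually.of_forall fun a => ?_)
      simp only [Pi.mul_apply]
      rw [tsum_mul_right, Complex.norm_real, Real.norm_of_nonneg (Real.exp_nonneg _),
        Real.exp_eq_exp_ℝ, NormedSpace.exp_eq_tsum_div])
    (Filter.Eventually.of_forall fun a => by
      have h1 := NormedSpace.expSeries_div_hasSum_exp ((((∑ j, u j * a j).re : ℂ) * Complex.I))
      rw [← Complex.exp_eq_exp_ℂ] at h1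
      refine (h1.mul_right (g a)).congr_fun fun N => ?_
      rw [mul_pow]; ring)
  refine hs.unique ?_
  convert! hasSum_zero using 1
  funext N
  rw [integral_const_mul, (integral_mul_eq_zero_of_mem_wickSpan hg h (re_sum_pow_mem_wickSpan u N)).2,
    mul_zero]

/-- The positive and negative parts of h are densities of two finite measures with equal
characteristic functions. The measures are therefore equal, and so are the densities. -/
theorem ae_eq_zero_of_integral_exp_mul_eq_zero {μ : Measure (Fin k → ℂ)} [IsFiniteMeasure μ]
    {h : (Fin k → ℂ) → ℝ} (hh : Integrable h μ)
    (h0 : ∀ u : Fin k → ℂ, ∫ a, Complex.exp (((∑ j, u j * a j).re : ℂ) * Complex.I) * h a ∂μ = 0) :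
    h =ᵐ[μ] 0 := by
  have hfin : ∀ f : (Fin k → ℂ) → ℝ, Integrable f μ →
      ∫⁻ a, ENNReal.ofReal (f a) ∂μ ≠ ⊤ := fun f hf => by
    exact (lt_of_le_of_lt (lintegral_mono fun a => Real.ofReal_le_enorm (f a)) hf.2).ne
  have hf1 := hfin h hh
  have hf2 := hfin (-h) hh.neg
  have := isFiniteMeasure_withDensity hf1
  have := isFiniteMeasure_withDensity hf2
  have m1 : AEMeasurable (fun a => ENNReal.ofReal (h a)) μ := hh.1.aemeasurable.ennreal_ofReal
  have m2 : AEMeasurable (fun a => ENNReal.ofReal ((-h) a)) μ := hh.neg.1.aemeasurable.ennreal_ofReal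
  have heq : μ.withDensity (fun a => ENNReal.ofReal (h a))
      = μ.withDensity (fun a => ENNReal.ofReal ((-h) a)) := by
    refine Measure.ext_of_charFunDual ?_
    funext ℓ
    obtain ⟨u, hu⟩ := exists_dual_eq_re_sum ℓ
    rw [charFunDual_apply, charFunDual_apply]
    simp_rw [hu]
    rw [integral_withDensity_eq_integral_toReal_smul₀ m1
        (Filter.Eventually.of_forall fun _ => ENNReal.ofReal_lt_top),
      integral_withDensity_eq_integral_toReal_smul₀ m2
        (Filter.Eventually.of_forall fun _ => ENNReal.ofReal_lt_top), ← sub_eq_zero]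
    have hi : ∀ f : (Fin k → ℂ) → ℝ, Integrable f μ → Integrable (fun a =>
        (ENNReal.ofReal (f a)).toReal • Complex.exp (((∑ j, u j * a j).re : ℂ) * Complex.I)) μ := by
      intro f hf
      refine hf.norm.mono' ?_ (Filter.Eventually.of_forall fun a => ?_)
      · exact (hf.1.aemeasurable.ennreal_ofReal.ennreal_toReal.aestronglyMeasurable).smul
          (Continuous.aestronglyMeasurable (by fun_prop))
      · rw [norm_smul, Complex.norm_exp_ofReal_mul_I, mul_one, ENNReal.toReal_ofReal']
        rw [Real.norm_of_nonneg (le_max_right _ _)]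
        exact max_le (le_abs_self _) (abs_nonneg _)
    rw [← integral_sub (hi h hh) (hi (-h) hh.neg), ← h0 u]
    refine integral_congr_ae (Filter.Eventually.of_forall fun a => ?_)
    simp only [Pi.neg_apply]
    rw [← sub_smul, ENNReal.toReal_ofReal', ENNReal.toReal_ofReal', max_zero_sub_max_neg_zero_eq_self,
      Complex.real_smul, mul_comm]
  have := (withDensity_eq_iff m1 m2 hf1).mp heq
  filter_upwards [this] with a ha
  simp only [Pi.neg_apply] at ha
  rcases le_total (h a) 0 with h1 | h1
  · rw [ENNReal.ofReal_of_nonpos h1, eq_comm, ENNReal.ofReal_eq_zero] at ha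
    simp only [Pi.zero_apply]; linarith
  · rw [ENNReal.ofReal_of_nonpos (neg_nonpos.mpr h1), ENNReal.ofReal_eq_zero] at ha
    simp only [Pi.zero_apply]; linarith

/-- Completeness of the Wick products. The uniqueness of the Fourier transform above concerns real
densities, so the real and imaginary parts of g are treated separately. -/
theorem ae_eq_zero_of_integral_wickProd_eq_zero {g : (Fin k → ℂ) → ℂ}
    (hg : MemLp g 2 (stdGaussianVector k))
    (h : ∀ m n, ∫ a, wickProd m n a * g a ∂stdGaussianVector k = 0) :
    g =ᵐ[stdGaussianVector k] 0 := by
  have hexp : ∀ u : Fin k → ℂ, Continuous fun a : Fin k → ℂ =>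
      Complex.exp (((∑ j, u j * a j).re : ℂ) * Complex.I) := fun u => by fun_prop
  have key : ∀ g : (Fin k → ℂ) → ℂ, MemLp g 2 (stdGaussianVector k) →
      (∀ m n, ∫ a, wickProd m n a * g a ∂stdGaussianVector k = 0) →
      (fun a => (g a).re) =ᵐ[stdGaussianVector k] 0 := by
    intro g hg h
    have hgi : Integrable g (stdGaussianVector k) := hg.integrable (by norm_num)
    refine ae_eq_zero_of_integral_exp_mul_eq_zero hgi.re fun u => ?_
    have h1 := integral_exp_mul_eq_zero hg h u
    -- Conjugating the identity at -u restores the frequency u and replaces g by its conjugate;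
    -- adding the two identities isolates Re g.
    have h2 := congrArg conj (integral_exp_mul_eq_zero hg h (-u))
    rw [← integral_conj, map_zero] at h2
    have hint : ∀ f : (Fin k → ℂ) → ℂ, Integrable f (stdGaussianVector k) → Integrable (fun a =>
        Complex.exp (((∑ j, u j * a j).re : ℂ) * Complex.I) * f a) (stdGaussianVector k) := by
      intro f hf
      refine hf.norm.mono' ((hexp u).aestronglyMeasurable.mul hf.1)
        (Filter.Eventually.of_forall fun a => ?_)
      rw [norm_mul, Complex.norm_exp_ofReal_mul_I, one_mul]
    have hconj : Integrable (fun a => conj (g a)) (stdGaussianVector k) :=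
      (Complex.conjLIE.toContinuousLinearEquiv.integrable_comp_iff).mpr hgi
    have e2 : ∀ a, conj (Complex.exp ((((∑ j, (-u) j * a j).re : ℝ) : ℂ) * Complex.I) * g a)
        = Complex.exp (((∑ j, u j * a j).re : ℂ) * Complex.I) * conj (g a) := by
      intro a
      rw [map_mul, ← Complex.exp_conj, map_mul, Complex.conj_ofReal, Complex.conj_I]
      simp only [Pi.neg_apply, neg_mul, Finset.sum_neg_distrib, Complex.neg_re, Complex.ofReal_neg,
        mul_neg, neg_neg]
    simp_rw [e2] at h2
    have h3 : ∫ a, (Complex.exp (((∑ j, u j * a j).re : ℂ) * Complex.I) * g a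
        + Complex.exp (((∑ j, u j * a j).re : ℂ) * Complex.I) * conj (g a)) ∂stdGaussianVector k = 0 := by
      rw [integral_add (hint g hgi) (hint _ hconj), h1, h2, add_zero]
    have h4 : ∀ a, Complex.exp (((∑ j, u j * a j).re : ℂ) * Complex.I) * ((g a).re : ℂ)
        = (1 / 2) * (Complex.exp (((∑ j, u j * a j).re : ℂ) * Complex.I) * g a
        + Complex.exp (((∑ j, u j * a j).re : ℂ) * Complex.I) * conj (g a)) := by
      intro a
      rw [Complex.re_eq_add_conj (g a)]; ring
    change ∫ a, Complex.exp (((∑ j, u j * a j).re : ℂ) * Complex.I) * ((g a).re : ℂ) ∂_ = 0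
    simp_rw [h4]
    rw [integral_const_mul, h3, mul_zero]
  have k1 := key g hg h
  -- Re(-i g) = Im g.
  have k2 := key (fun a => -Complex.I * g a) (hg.const_mul _) fun m n => by
    simp_rw [mul_left_comm]
    rw [integral_const_mul, h, mul_zero]
  filter_upwards [k1, k2] with a h1 h2
  apply Complex.ext
  · simpa using h1
  · simpa using h2

variable {k : ℕ}

theorem eval_smul_of_isHomogeneous {d : ℕ} {Q : MvPolynomial (Fin k) ℂ} (hQ : Q.IsHomogeneous d)
    (ω : ℂ) (a : Fin k → ℂ) :
    MvPolynomial.eval (fun i => ω * a i) Q = ω ^ d * MvPolynomial.eval a Q := by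
  rw [MvPolynomial.eval_eq', MvPolynomial.eval_eq', Finset.mul_sum]
  refine Finset.sum_congr rfl fun s hs => ?_
  have hd : ∑ i, s i = d := by
    have := hQ (MvPolynomial.mem_support_iff.mp hs)
    rw [← this, Finsupp.weight_apply, Finsupp.sum_fintype _ _ (by simp)]
    simp
  simp_rw [mul_pow]
  rw [Finset.prod_mul_distrib, Finset.prod_pow_eq_pow_sum, hd]
  ring

/-! ### The orthonormal basis of normalized Wick products -/

/-- The normalizing factor `√(m! n!)`. -/
noncomputable def wickNorm (m n : Fin k → ℕ) : ℝ :=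
  Real.sqrt (((∏ j, (m j).factorial) * ∏ j, (n j).factorial : ℕ) : ℝ)

theorem wickNorm_sq (m n : Fin k → ℕ) :
    wickNorm m n ^ 2 = (((∏ j, (m j).factorial) * ∏ j, (n j).factorial : ℕ) : ℝ) :=
  Real.sq_sqrt (Nat.cast_nonneg _)

theorem wickNorm_pos (m n : Fin k → ℕ) : 0 < wickNorm m n := by
  refine Real.sqrt_pos.mpr (Nat.cast_pos.mpr (Nat.mul_pos ?_ ?_)) <;>
    exact Finset.prod_pos fun _ _ => Nat.factorial_pos _

/-- The normalized Wick product, as an element of `L²`. -/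
noncomputable def wickLp (p : (Fin k → ℕ) × (Fin k → ℕ)) : Lp ℂ 2 (stdGaussianVector k) :=
  (((memLp_wickProd p.1 p.2).const_mul ((wickNorm p.1 p.2 : ℂ)⁻¹)).toLp _)

theorem coeFn_wickLp (p : (Fin k → ℕ) × (Fin k → ℕ)) :
    wickLp p =ᵐ[stdGaussianVector k] fun a => (wickNorm p.1 p.2 : ℂ)⁻¹ * wickProd p.1 p.2 a :=
  MemLp.coeFn_toLp _

/-- The pairing of two correlated copies is diagonal in the Wick basis; this diagonalization is the
whole content of Mehler's formula. The case c = 1, s = 0 is orthonormality. -/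
theorem inner_comp_wickLp {c s : ℂ} (hcs : ‖c‖ ^ 2 + ‖s‖ ^ 2 = 1)
    (p q : (Fin k → ℕ) × (Fin k → ℕ)) :
    inner ℂ (Lp.compMeasurePreservingₗᵢ ℂ _ (measurePreserving_fst k) (wickLp p))
      (Lp.compMeasurePreservingₗᵢ ℂ _ (measurePreserving_correlate k hcs) (wickLp q))
      = if p = q then c ^ (∑ j, q.1 j) * conj c ^ (∑ j, q.2 j) else 0 := by
  rw [L2.inner_def]
  have h1 := Lp.coeFn_compMeasurePreserving (wickLp p) (measurePreserving_fst k)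
  have h2 := Lp.coeFn_compMeasurePreserving (wickLp q) (measurePreserving_correlate k hcs)
  have h3 := (measurePreserving_fst k).quasiMeasurePreserving.ae_eq_comp (coeFn_wickLp p)
  have h4 := (measurePreserving_correlate k hcs).quasiMeasurePreserving.ae_eq_comp (coeFn_wickLp q)
  have h5 := integral_conj_wickProd_mul_wickProd hcs p.1 p.2 q.1 q.2
  have e : ∫ x, inner ℂ
        ((Lp.compMeasurePreservingₗᵢ ℂ _ (measurePreserving_fst k) (wickLp p)) x)
        ((Lp.compMeasurePreservingₗᵢ ℂ _ (measurePreserving_correlate k hcs) (wickLp q)) x)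
        ∂gaussianPairs k
      = ∫ x, ((wickNorm p.1 p.2 : ℂ)⁻¹ * (wickNorm q.1 q.2 : ℂ)⁻¹) *
        (conj (wickProd p.1 p.2 fun i => x i 0) *
          wickProd q.1 q.2 (fun i => c * x i 0 + s * x i 1)) ∂gaussianPairs k := by
    refine integral_congr_ae ?_
    filter_upwards [h1, h2, h3, h4] with x h1 h2 h3 h4
    change inner ℂ ((Lp.compMeasurePreserving _ (measurePreserving_fst k) (wickLp p)) x)
      ((Lp.compMeasurePreserving _ (measurePreserving_correlate k hcs) (wickLp q)) x) = _
    rw [h1, h2, h3, h4]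
    simp only [Function.comp_apply, RCLike.inner_apply, map_mul, map_inv₀, Complex.conj_ofReal]
    ring
  rw [e, integral_const_mul, h5]
  by_cases hpq : p = q
  · subst hpq
    simp only [and_self, if_true]
    have hn := wickNorm_sq p.1 p.2
    have hp : (wickNorm p.1 p.2 : ℂ) ≠ 0 := by exact_mod_cast (wickNorm_pos p.1 p.2).ne'
    have hn' : (wickNorm p.1 p.2 : ℂ) ^ 2
        = (((∏ j, (p.1 j).factorial) * ∏ j, (p.2 j).factorial : ℕ) : ℂ) := by
      exact_mod_cast congrArg (fun t : ℝ => (t : ℂ)) hn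
    rw [← hn']
    field_simp
  · rw [if_neg hpq, if_neg, mul_zero]
    exact fun h => hpq (Prod.ext h.1.symm h.2.symm)

theorem orthonormal_wickLp : Orthonormal ℂ (wickLp (k := k)) := by
  classical
  rw [orthonormal_iff_ite]
  intro p q
  have h := inner_comp_wickLp (c := 1) (s := 0) (by simp) p q
  have e : Lp.compMeasurePreservingₗᵢ ℂ _ (measurePreserving_correlate k (c := 1) (s := 0) (by simp))
      (wickLp q) = Lp.compMeasurePreservingₗᵢ ℂ _ (measurePreserving_fst k) (wickLp q) := by
    congr 1
    have : (fun (x : Fin k → Fin 2 → ℂ) i => (1 : ℂ) * x i 0 + 0 * x i 1) = fun x i => x i 0 := by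
      funext x i; simp
    simp only [this]
  rw [e, LinearIsometry.inner_map_map] at h
  simpa using h

theorem inner_wickLp (p : (Fin k → ℕ) × (Fin k → ℕ)) (g : Lp ℂ 2 (stdGaussianVector k)) :
    inner ℂ (wickLp p) g
      = (wickNorm p.1 p.2 : ℂ)⁻¹ * ∫ a, g a * wickProd p.2 p.1 a ∂stdGaussianVector k := by
  rw [L2.inner_def, ← integral_const_mul]
  refine integral_congr_ae ?_
  filter_upwards [coeFn_wickLp p] with a ha
  rw [ha, RCLike.inner_apply, map_mul, map_inv₀, Complex.conj_ofReal, conj_wickProd]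
  ring

theorem span_wickLp_orthogonal_eq_bot : (Submodule.span ℂ (Set.range (wickLp (k := k))))ᗮ = ⊥ := by
  rw [Submodule.eq_bot_iff]
  intro g hg
  rw [Submodule.mem_orthogonal] at hg
  refine Lp.eq_zero_iff_ae_eq_zero.mpr (ae_eq_zero_of_integral_wickProd_eq_zero (Lp.memLp g) ?_)
  intro m n
  have := hg _ (Submodule.subset_span ⟨(n, m), rfl⟩)
  rw [inner_wickLp, mul_eq_zero, inv_eq_zero, Complex.ofReal_eq_zero] at this
  simpa [mul_comm] using this.resolve_left (wickNorm_pos _ _).ne'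

/-- The normalized Wick products are a Hilbert basis of `L²` of the Gaussian vector. -/
noncomputable def wickBasis (k : ℕ) : HilbertBasis ((Fin k → ℕ) × (Fin k → ℕ)) ℂ (Lp ℂ 2 (stdGaussianVector k)) :=
  HilbertBasis.mkOfOrthogonalEqBot orthonormal_wickLp span_wickLp_orthogonal_eq_bot

theorem wickBasis_apply (p : (Fin k → ℕ) × (Fin k → ℕ)) : wickBasis k p = wickLp p := by
  rw [wickBasis, HilbertBasis.coe_mkOfOrthogonalEqBot]

/-- The Mehler formula. -/
theorem hasSum_inner_comp {c s : ℂ} (hcs : ‖c‖ ^ 2 + ‖s‖ ^ 2 = 1)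
    (g : Lp ℂ 2 (stdGaussianVector k)) :
    HasSum (fun p : (Fin k → ℕ) × (Fin k → ℕ) => ((‖inner ℂ (wickLp p) g‖ ^ 2 : ℝ) : ℂ) *
        (c ^ (∑ j, p.1 j) * conj c ^ (∑ j, p.2 j)))
      (inner ℂ (Lp.compMeasurePreservingₗᵢ ℂ _ (measurePreserving_fst k) g)
        (Lp.compMeasurePreservingₗᵢ ℂ _ (measurePreserving_correlate k hcs) g)) := by
  set A := Lp.compMeasurePreservingₗᵢ (E := ℂ) (p := 2) ℂ _ (measurePreserving_fst k)
  set B := Lp.compMeasurePreservingₗᵢ (E := ℂ) (p := 2) ℂ _ (measurePreserving_correlate k hcs)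
  have hg := (wickBasis k).hasSum_repr g
  have h1 := (hg.mapL B.toContinuousLinearMap).mapL (innerSL ℂ (A g))
  -- Expanding also the first copy of g, diagonality leaves only its p-th coefficient.
  have h2 : ∀ p, inner ℂ (A g) (B (wickLp p)) = conj (inner ℂ (wickLp p) g) *
      (c ^ (∑ j, p.1 j) * conj c ^ (∑ j, p.2 j)) := by
    intro p
    have h3 := (hg.mapL A.toContinuousLinearMap).mapL (innerSL ℂ (B (wickLp p)))
    have h4 := h3.unique (hasSum_single p fun q hq => by
      simp only [wickBasis_apply, map_smul, innerSL_apply_apply]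
      change (_ : ℂ) • inner ℂ (B (wickLp p)) (A (wickLp q)) = 0
      rw [← inner_conj_symm, inner_comp_wickLp hcs, if_neg hq, map_zero, smul_zero])
    rw [← inner_conj_symm]
    simp only [innerSL_apply_apply, wickBasis_apply, map_smul] at h4
    change inner ℂ (B (wickLp p)) (A g) = _ • inner ℂ (B (wickLp p)) (A (wickLp p)) at h4
    rw [h4, HilbertBasis.repr_apply_apply, wickBasis_apply, smul_eq_mul, map_mul,
      inner_conj_symm (A (wickLp p)), inner_comp_wickLp hcs, if_pos rfl]
  refine h1.congr_fun fun p => ?_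
  simp only [wickBasis_apply, map_smul, innerSL_apply_apply, HilbertBasis.repr_apply_apply]
  change _ = _ • inner ℂ (A g) (B (wickLp p))
  rw [h2, smul_eq_mul, ← mul_assoc (inner ℂ (wickLp p) g), Complex.mul_conj,
    Complex.normSq_eq_norm_sq]

/-! ### The Wick coefficients of `log |Q|` -/

/-- Every term of the Wick power has the same excess m - n of a over ā, so a phase multiplies all of
them equally. -/
theorem wickPower_mul_unit {ω : ℂ} (hω : ‖ω‖ = 1) (m n : ℕ) (z : ℂ) :
    wickPower m n (ω * z) = ω ^ m * conj ω ^ n * wickPower m n z := by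
  have h1 : ω * conj ω = 1 := by
    rw [Complex.mul_conj, Complex.normSq_eq_norm_sq, hω]; simp
  unfold wickPower
  rw [Finset.mul_sum]
  refine Finset.sum_congr rfl fun r hr => ?_
  rw [Finset.mem_range] at hr
  have hm : ω ^ m = ω ^ (m - r) * ω ^ r := by rw [← pow_add]; congr 1; omega
  have hn : conj ω ^ n = conj ω ^ (n - r) * conj ω ^ r := by rw [← pow_add]; congr 1; omega
  have h2 : ω ^ r * conj ω ^ r = 1 := by rw [← mul_pow, h1, one_pow]
  rw [map_mul, mul_pow, mul_pow, hm, hn]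
  linear_combination (-(-1) ^ r * (r.factorial : ℂ) * (m.choose r : ℂ) * (n.choose r : ℂ) *
    ω ^ (m - r) * conj ω ^ (n - r) * z ^ (m - r) * conj z ^ (n - r)) * h2

theorem measurePreserving_mul_unit {ω : ℂ} (hω : ‖ω‖ = 1) :
    MeasurePreserving (fun (a : Fin k → ℂ) i => ω * a i) (stdGaussianVector k)
      (stdGaussianVector k) :=
  measurePreserving_pi _ _ fun _ => map_mul_stdComplexGaussian hω

theorem continuous_eval (Q : MvPolynomial (Fin k) ℂ) :
    Continuous fun a : Fin k → ℂ => MvPolynomial.eval a Q :=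
  MvPolynomial.continuous_eval Q

theorem measurable_log_norm_eval (Q : MvPolynomial (Fin k) ℂ) :
    Measurable fun a : Fin k → ℂ => Real.log ‖MvPolynomial.eval a Q‖ :=
  Real.measurable_log.comp (continuous_eval Q).norm.measurable

theorem wickCoeff_eq (Q : MvPolynomial (Fin k) ℂ) (m n : Fin k → ℕ) :
    wickCoeff Q m n = (wickNorm m n : ℂ)⁻¹ *
      ∫ a, (Real.log ‖MvPolynomial.eval a Q‖ : ℂ) * wickProd n m a ∂stdGaussianVector k := rfl

/-- A common phase leaves both the Gaussian law and |Q| unchanged, but multiplies the Wick product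
by ω^|n| ω̄^|m|. -/
theorem wickCoeff_eq_zero {d : ℕ} {Q : MvPolynomial (Fin k) ℂ} (hQ : Q.IsHomogeneous d)
    {m n : Fin k → ℕ} (hmn : ∑ j, m j ≠ ∑ j, n j) : wickCoeff Q m n = 0 := by
  rw [wickCoeff_eq]
  set M := ∑ j, m j
  set N := ∑ j, n j
  -- Chosen so that ω^N ω̄^M = -1; the integral then equals its own negative.
  set ω : ℂ := Complex.exp (((Real.pi / ((N : ℝ) - M) : ℝ) : ℂ) * Complex.I) with hω
  have hn : ‖ω‖ = 1 := Complex.norm_exp_ofReal_mul_I _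
  have hNM : ((N : ℂ) - M) ≠ 0 := by rw [sub_ne_zero]; exact_mod_cast hmn.symm
  have hpow : ω ^ N * conj ω ^ M = -1 := by
    rw [hω, ← Complex.exp_conj, ← Complex.exp_nat_mul, ← Complex.exp_nat_mul, ← Complex.exp_add,
      ← Complex.exp_pi_mul_I]
    congr 1
    simp only [map_mul, Complex.conj_ofReal, Complex.conj_I]
    push_cast
    field_simp
    ring
  have h1 := (measurePreserving_mul_unit (k := k) hn).map_eq
  have hmeas : Measurable fun a : Fin k → ℂ =>
      (Real.log ‖MvPolynomial.eval a Q‖ : ℂ) * wickProd n m a :=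
    (Complex.measurable_ofReal.comp (measurable_log_norm_eval Q)).mul
      (continuous_wickProd n m).measurable
  have h2 : ∫ a, (Real.log ‖MvPolynomial.eval a Q‖ : ℂ) * wickProd n m a ∂stdGaussianVector k
      = ∫ a, -((Real.log ‖MvPolynomial.eval a Q‖ : ℂ) * wickProd n m a) ∂stdGaussianVector k := by
    conv_lhs => rw [← h1]
    rw [integral_map (measurePreserving_mul_unit hn).measurable.aemeasurable
      hmeas.aestronglyMeasurable]
    refine integral_congr_ae (Filter.Eventually.of_forall fun a => ?_)
    simp only
    have h3 : wickProd n m (fun i => ω * a i) = -wickProd n m a := by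
      unfold wickProd
      simp_rw [wickPower_mul_unit hn]
      rw [Finset.prod_mul_distrib, Finset.prod_mul_distrib, Finset.prod_pow_eq_pow_sum,
        Finset.prod_pow_eq_pow_sum, hpow]
      ring
    rw [eval_smul_of_isHomogeneous hQ, norm_mul, norm_pow, hn, one_pow, one_mul, h3]
    ring
  rw [integral_neg] at h2
  rw [self_eq_neg.mp h2, mul_zero]

/-- Mehler's formula for log|Q|. As only |m| = |n| contributes, the factors c^|m| c̄^|n| become
powers of ‖c‖², and the terms can be collected by degree. -/
theorem hasSum_wickWeight_mul_pow {d : ℕ} {Q : MvPolynomial (Fin k) ℂ} (hQ : Q.IsHomogeneous d)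
    (hL : MemLp (fun a => Real.log ‖MvPolynomial.eval a Q‖) 2 (stdGaussianVector k))
    {c s : ℂ} (hcs : ‖c‖ ^ 2 + ‖s‖ ^ 2 = 1) :
    HasSum (fun p => wickWeight Q p * (‖c‖ ^ 2) ^ p)
      (∫ x, Real.log ‖MvPolynomial.eval (fun i => x i 0) Q‖ *
        Real.log ‖MvPolynomial.eval (fun i => c * x i 0 + s * x i 1) Q‖ ∂gaussianPairs k) := by
  have hLc : MemLp (fun a => (Real.log ‖MvPolynomial.eval a Q‖ : ℂ)) 2 (stdGaussianVector k) :=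
    hL.ofReal
  set g := hLc.toLp _ with hg
  have hgc : g =ᵐ[stdGaussianVector k] fun a => (Real.log ‖MvPolynomial.eval a Q‖ : ℂ) :=
    MemLp.coeFn_toLp _
  have hcoef : ∀ p : (Fin k → ℕ) × (Fin k → ℕ), inner ℂ (wickLp p) g = wickCoeff Q p.1 p.2 := by
    intro p
    rw [inner_wickLp, wickCoeff_eq]
    congr 1
    refine integral_congr_ae ?_
    filter_upwards [hgc] with a ha
    rw [ha]
  have h1 := hasSum_inner_comp hcs g
  simp_rw [hcoef] at h1
  have h2 : inner ℂ (Lp.compMeasurePreservingₗᵢ ℂ _ (measurePreserving_fst k) g)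
        (Lp.compMeasurePreservingₗᵢ ℂ _ (measurePreserving_correlate k hcs) g)
      = ((∫ x, Real.log ‖MvPolynomial.eval (fun i => x i 0) Q‖ *
        Real.log ‖MvPolynomial.eval (fun i => c * x i 0 + s * x i 1) Q‖ ∂gaussianPairs k : ℝ) : ℂ) := by
    rw [L2.inner_def, ← integral_complex_ofReal]
    refine integral_congr_ae ?_
    filter_upwards [Lp.coeFn_compMeasurePreserving g (measurePreserving_fst k),
      Lp.coeFn_compMeasurePreserving g (measurePreserving_correlate k hcs),
      (measurePreserving_fst k).quasiMeasurePreserving.ae_eq_comp hgc,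
      (measurePreserving_correlate k hcs).quasiMeasurePreserving.ae_eq_comp hgc] with x h1 h2 h3 h4
    change inner ℂ ((Lp.compMeasurePreserving _ (measurePreserving_fst k) g) x)
      ((Lp.compMeasurePreserving _ (measurePreserving_correlate k hcs) g) x) = _
    rw [h1, h2, h3, h4]
    simp only [Function.comp_apply, RCLike.inner_apply, Complex.conj_ofReal]
    push_cast
    ring
  rw [h2] at h1
  set F : (Fin k → ℕ) × (Fin k → ℕ) → ℝ := fun p => ‖wickCoeff Q p.1 p.2‖ ^ 2 * (‖c‖ ^ 2) ^ (∑ j, p.1 j)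
  have h3 : HasSum F (∫ x, Real.log ‖MvPolynomial.eval (fun i => x i 0) Q‖ *
        Real.log ‖MvPolynomial.eval (fun i => c * x i 0 + s * x i 1) Q‖ ∂gaussianPairs k) := by
    rw [← Complex.hasSum_ofReal]
    refine h1.congr_fun fun p => ?_
    by_cases hp : ∑ j, p.1 j = ∑ j, p.2 j
    · simp only [F]
      rw [← hp, ← mul_pow, Complex.mul_conj, Complex.normSq_eq_norm_sq]
      push_cast; rfl
    · simp only [F]
      rw [wickCoeff_eq_zero hQ hp]
      simp
  -- Regroup the double family of multi-indices by p = |m|.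
  have h4 := ((Equiv.sigmaFiberEquiv fun p : (Fin k → ℕ) × (Fin k → ℕ) => ∑ j, p.1 j).hasSum_iff).mpr h3
  refine h4.sigma fun p => ?_
  classical
  set T : Finset ((Fin k → ℕ) × (Fin k → ℕ)) :=
    Finset.piAntidiag Finset.univ p ×ˢ Finset.piAntidiag Finset.univ p
  have hT : ∀ q : (Fin k → ℕ) × (Fin k → ℕ), q ∈ T ↔ ∑ j, q.1 j = p ∧ ∑ j, q.2 j = p := by
    intro q; simp [T, Finset.mem_piAntidiag]
  -- The fibre over p is infinite when k > 0, since n is unrestricted; the vanishing for |n| ≠ |m|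
  -- leaves the finite set `T`.
  have h5 : HasSum (fun q : {q : (Fin k → ℕ) × (Fin k → ℕ) // ∑ j, q.1 j = p} => F q)
      (∑ q ∈ T.subtype (fun q => ∑ j, q.1 j = p), F q) := by
    refine hasSum_sum_of_ne_finset_zero fun q hq => ?_
    rw [Finset.mem_subtype, hT, not_and] at hq
    have : ∑ j, q.1.1 j ≠ ∑ j, q.1.2 j := by
      rw [q.2]; exact fun h => hq q.2 h.symm
    simp only [F]
    rw [wickCoeff_eq_zero hQ this]
    simp
  convert! h5 using 1
  rw [Finset.sum_subtype_eq_sum_filter (f := F), Finset.filter_true_of_mem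
    fun q hq => ((hT q).mp hq).1, wickWeight, Finset.sum_product, Finset.sum_mul]
  refine Finset.sum_congr rfl fun m hm => ?_
  rw [Finset.sum_mul]
  refine Finset.sum_congr rfl fun n hn => ?_
  simp only [F]
  rw [(Finset.mem_piAntidiag.mp hm).1]

theorem wickWeight_nonneg (Q : MvPolynomial (Fin k) ℂ) (p : ℕ) : 0 ≤ wickWeight Q p := by
  unfold wickWeight; positivity

/-! ### Square integrability of `log |Q|` -/

/-- With y = x^(-1/2), log y ≤ y gives log²(1/x) ≤ 4/x for x ≤ 1. The factor e offsets the Gaussian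
there, which is inserted so that the bound has a known planar integral. -/
theorem posLog_inv_sq_le (x : ℝ) (hx : 0 < x) :
    Real.posLog x⁻¹ ^ 2 ≤ 4 * Real.exp 1 * (x ^ (-1 : ℝ) * Real.exp (-x ^ (2 : ℝ))) := by
  rcases le_total 1 x with h | h
  · rw [(Real.posLog_eq_zero_iff _).mpr]
    · rw [zero_pow two_ne_zero]; positivity
    · rw [abs_of_pos (by positivity)]; exact inv_le_one_of_one_le₀ h
  · have h1 : (1 : ℝ) ≤ |x⁻¹| := by
      rw [abs_of_pos (by positivity)]; exact (one_le_inv₀ hx).mpr h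
    rw [Real.posLog_eq_log h1]
    set y := Real.sqrt x⁻¹ with hy
    have hy0 : 0 < y := Real.sqrt_pos.mpr (by positivity)
    have hy2 : y ^ 2 = x⁻¹ := Real.sq_sqrt (by positivity)
    have hlog : Real.log x⁻¹ = 2 * Real.log y := by rw [← hy2, Real.log_pow]; norm_num
    have hl : Real.log y ≤ y := (Real.log_le_sub_one_of_pos hy0).trans (by linarith)
    have hl0 : 0 ≤ Real.log x⁻¹ := Real.log_nonneg ((one_le_inv₀ hx).mpr h)
    have h2 : Real.log x⁻¹ ^ 2 ≤ 4 * x⁻¹ := by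
      rw [hlog] at hl0 ⊢
      rw [← hy2]
      nlinarith
    have h3 : Real.exp (-1) ≤ Real.exp (-x ^ (2 : ℝ)) := by
      refine Real.exp_le_exp.mpr ?_
      rw [Real.rpow_ofNat]; nlinarith
    rw [Real.rpow_neg_one]
    calc _ ≤ 4 * x⁻¹ := h2
      _ = 4 * Real.exp 1 * (x⁻¹ * Real.exp (-1)) := by
          rw [Real.exp_neg]; field_simp
      _ ≤ _ := by gcongr

theorem integrable_posLog_inv_norm_sq : Integrable fun z : ℂ => Real.posLog ‖z‖⁻¹ ^ 2 := by
  have h : Integrable fun z : ℂ => ‖z‖ ^ (-1 : ℝ) * Real.exp (-‖z‖ ^ (2 : ℝ)) := by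
    -- The Bochner integral of a nonintegrable function is 0 by convention, so the positive closed
    -- value proves integrability.
    refine Integrable.of_integral_ne_zero ?_
    rw [Complex.integral_rpow_mul_exp_neg_rpow (by norm_num) (by norm_num)]
    have : 0 < Real.Gamma ((-1 + 2) / 2) := Real.Gamma_pos_of_pos (by norm_num)
    positivity
  refine (h.const_mul (4 * Real.exp 1)).mono' ?_ ?_
  · unfold Real.posLog
    exact Measurable.aestronglyMeasurable (by fun_prop)
  · have : ∀ᵐ z : ℂ, z ≠ 0 := by simp [ae_iff]
    filter_upwards [this] with z hz
    rw [Real.norm_of_nonneg (by positivity)]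
    exact posLog_inv_sq_le _ (norm_pos_iff.mpr hz)

open Classical in
/-- The square of `log⁺ (1 / |z|)`, infinite at the origin. -/
noncomputable def negLogSq (z : ℂ) : ℝ≥0∞ :=
  if z = 0 then ⊤ else ENNReal.ofReal (Real.posLog ‖z‖⁻¹ ^ 2)

theorem measurable_negLogSq : Measurable negLogSq := by
  refine Measurable.ite (measurableSet_singleton (0 : ℂ)) measurable_const ?_
  unfold Real.posLog
  fun_prop

/-- Subadditivity of log⁺ and (x + y)² ≤ 2x² + 2y². The value ⊤ at 0 makes the inequality hold
without exceptions. -/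
theorem negLogSq_mul_le (z w : ℂ) : negLogSq (z * w) ≤ 2 * negLogSq z + 2 * negLogSq w := by
  by_cases hz : z = 0
  · simp [negLogSq, hz]
  by_cases hw : w = 0
  · simp [negLogSq, hw]
  rw [negLogSq, negLogSq, negLogSq, if_neg hz, if_neg hw, if_neg (mul_ne_zero hz hw)]
  rw [show (2 : ℝ≥0∞) = ENNReal.ofReal 2 by simp, ← ENNReal.ofReal_mul (by norm_num),
    ← ENNReal.ofReal_mul (by norm_num), ← ENNReal.ofReal_add (by positivity) (by positivity)]
  refine ENNReal.ofReal_le_ofReal ?_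
  have h := Real.posLog_mul (x := ‖z‖⁻¹) (y := ‖w‖⁻¹)
  rw [← mul_inv, ← norm_mul] at h
  have h0 := Real.posLog_nonneg (x := ‖z * w‖⁻¹)
  nlinarith [sq_nonneg (Real.posLog ‖z‖⁻¹ - Real.posLog ‖w‖⁻¹)]

/-- The Gaussian density is at most 1, so Lebesgue measure, which is translation invariant,
dominates. The bound must be uniform in r: below, r is a root that varies with the remaining
variables. -/
theorem exists_lintegral_negLogSq_sub_le :
    ∃ C : ℝ≥0∞, C ≠ ⊤ ∧ ∀ r : ℂ, ∫⁻ z, negLogSq (z - r) ∂stdComplexGaussian ≤ C := by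
  refine ⟨∫⁻ z : ℂ, ENNReal.ofReal (Real.posLog ‖z‖⁻¹ ^ 2), ?_, fun r => ?_⟩
  · exact (lt_of_le_of_lt (lintegral_mono fun a => Real.ofReal_le_enorm _)
      integrable_posLog_inv_norm_sq.2).ne
  · have h1 : stdComplexGaussian ≤ volume := by
      rw [stdComplexGaussian]
      conv_rhs => rw [← withDensity_one (μ := (volume : Measure ℂ))]
      refine withDensity_mono (Filter.Eventually.of_forall fun z => ?_)
      simp only [Pi.one_apply]
      rw [← ENNReal.ofReal_one]
      refine ENNReal.ofReal_le_ofReal ?_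
      refine mul_le_one₀ (inv_le_one_of_one_le₀ (by linarith [Real.pi_gt_three]))
        (Real.exp_nonneg _) (Real.exp_le_one_iff.mpr (by simp))
    refine (lintegral_mono' h1 le_rfl).trans ?_
    rw [lintegral_sub_right_eq_self negLogSq r]
    refine le_of_eq (lintegral_congr_ae ?_)
    have : ∀ᵐ z : ℂ, z ≠ 0 := by simp [ae_iff]
    filter_upwards [this] with z hz
    rw [negLogSq, if_neg hz]

/-- Roots are split off one at a time, each costing a factor 2. The constant depends on the degree
alone, not on the positions of the roots. -/
theorem exists_lintegral_negLogSq_prod_le (n : ℕ) :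
    ∃ C : ℝ≥0∞, C ≠ ⊤ ∧ ∀ (c : ℂ) (s : Multiset ℂ), s.card = n →
      ∫⁻ z, negLogSq (c * (s.map fun r => z - r).prod) ∂stdComplexGaussian
        ≤ 2 ^ n * negLogSq c + C := by
  induction n with
  | zero =>
    refine ⟨0, by simp, fun c s hs => ?_⟩
    rw [Multiset.card_eq_zero.mp hs]
    simp
  | succ n ih =>
    obtain ⟨C, hC, h⟩ := ih
    obtain ⟨D, hD, h'⟩ := exists_lintegral_negLogSq_sub_le
    refine ⟨2 * D + 2 * C, by finiteness, fun c s hs => ?_⟩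
    obtain ⟨r, hr⟩ := Multiset.card_pos_iff_exists_mem.mp (by omega : 0 < s.card)
    obtain ⟨t, rfl⟩ := Multiset.exists_cons_of_mem hr
    rw [Multiset.card_cons, Nat.add_right_cancel_iff] at hs
    calc _ ≤ ∫⁻ z, (2 * negLogSq (z - r) +
          2 * negLogSq (c * (t.map fun r => z - r).prod)) ∂stdComplexGaussian := by
          refine lintegral_mono fun z => ?_
          rw [Multiset.map_cons, Multiset.prod_cons, mul_left_comm]
          exact negLogSq_mul_le _ _
      _ = 2 * ∫⁻ z, negLogSq (z - r) ∂stdComplexGaussian +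
          2 * ∫⁻ z, negLogSq (c * (t.map fun r => z - r).prod) ∂stdComplexGaussian := by
          have m1 : Measurable fun z : ℂ => negLogSq (z - r) := measurable_negLogSq.comp (by fun_prop)
          have m2 : Measurable fun z : ℂ => negLogSq (c * (t.map fun r => z - r).prod) := by
            refine measurable_negLogSq.comp (measurable_const.mul ?_)
            exact (continuous_multiset_prod t fun r _ => by fun_prop).measurable
          rw [lintegral_add_left (m1.const_mul _), lintegral_const_mul _ m1, lintegral_const_mul _ m2]
      _ ≤ 2 * D + 2 * (2 ^ n * negLogSq c + C) := by
          gcongr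
          · exact h' r
          · exact h c t hs
      _ = _ := by ring

/-- Regard Q as a polynomial in the first variable, over polynomials in the others. Integrating in
that variable reduces the bound to the leading coefficient, a nonzero polynomial in fewer variables,
to which the induction hypothesis applies. -/
theorem lintegral_negLogSq_eval_ne_top {k : ℕ} (Q : MvPolynomial (Fin k) ℂ) (hQ : Q ≠ 0) :
    ∫⁻ a, negLogSq (MvPolynomial.eval a Q) ∂stdGaussianVector k ≠ ⊤ := by
  induction k with
  | zero =>
    obtain ⟨c, rfl⟩ := MvPolynomial.C_surjective (Fin 0) Q
    have hc : c ≠ 0 := by rintro rfl; simp at hQ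
    simp [negLogSq, hc]
  | succ k ih =>
    set p := MvPolynomial.finSuccEquiv ℂ k Q with hp
    have hp0 : p ≠ 0 := by
      rw [hp]; exact (EmbeddingLike.map_ne_zero_iff (f := MvPolynomial.finSuccEquiv ℂ k)).mpr hQ
    have hq0 : p.leadingCoeff ≠ 0 := Polynomial.leadingCoeff_ne_zero.mpr hp0
    obtain ⟨C, hC, h⟩ := exists_lintegral_negLogSq_prod_le p.natDegree
    have hmp := measurePreserving_piFinSuccAbove (fun _ : Fin (k + 1) => stdComplexGaussian) 0
    have hmeas : Measurable fun a : Fin (k + 1) → ℂ => negLogSq (MvPolynomial.eval a Q) :=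
      measurable_negLogSq.comp (continuous_eval Q).measurable
    have h1 : ∫⁻ a, negLogSq (MvPolynomial.eval a Q) ∂stdGaussianVector (k + 1)
        = ∫⁻ y, ∫⁻ z, negLogSq (MvPolynomial.eval (Fin.cons z y : Fin (k + 1) → ℂ) Q)
          ∂stdComplexGaussian ∂stdGaussianVector k := by
      have h2 := (hmp.symm _).lintegral_comp hmeas
      rw [stdGaussianVector, ← h2, lintegral_prod_symm']
      · refine lintegral_congr fun y => lintegral_congr fun z => ?_
        rw [MeasurableEquiv.piFinSuccAbove_symm_apply]
        simp [Fin.insertNthEquiv]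
      · exact hmeas.comp (MeasurableEquiv.measurable _)
    rw [h1]
    refine ne_top_of_le_ne_top (b := ∫⁻ y, (2 ^ p.natDegree *
      negLogSq (MvPolynomial.eval y p.leadingCoeff) + C) ∂stdGaussianVector k) ?_ ?_
    · rw [lintegral_add_right _ measurable_const, lintegral_const, measure_univ, mul_one,
        lintegral_const_mul _ (show Measurable fun y => negLogSq (MvPolynomial.eval y p.leadingCoeff)
          from measurable_negLogSq.comp (continuous_eval _).measurable)]
      have := ih p.leadingCoeff hq0
      finiteness
    · refine lintegral_mono fun y => ?_
      by_cases hy : MvPolynomial.eval y p.leadingCoeff = 0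
      · simp only [negLogSq, hy, if_true]
        rw [ENNReal.mul_top (by positivity), top_add]
        exact le_top
      · refine le_trans (le_of_eq ?_) (h (MvPolynomial.eval y p.leadingCoeff)
          (p.map (MvPolynomial.eval y)).roots ?_)
        · refine lintegral_congr fun z => ?_
          rw [MvPolynomial.eval_eq_eval_mv_eval', ← hp,
            (IsAlgClosed.splits (p.map (MvPolynomial.eval y))).eval_eq_prod_roots,
            Polynomial.leadingCoeff_map_of_leadingCoeff_ne_zero _ hy]
        · rw [← (IsAlgClosed.splits (p.map (MvPolynomial.eval y))).natDegree_eq_card_roots,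
            Polynomial.natDegree_map_of_leadingCoeff_ne_zero _ hy]

/-- A finite integral excludes the value ⊤ almost everywhere, and `negLogSq` is ⊤ exactly at 0. -/
theorem ae_eval_ne_zero {k : ℕ} {Q : MvPolynomial (Fin k) ℂ} (hQ : Q ≠ 0) :
    ∀ᵐ a ∂stdGaussianVector k, MvPolynomial.eval a Q ≠ 0 := by
  filter_upwards [ae_lt_top (measurable_negLogSq.comp (continuous_eval Q).measurable)
    (lintegral_negLogSq_eval_ne_top Q hQ)] with a ha h0
  simp [negLogSq, h0] at ha

theorem exists_norm_eval_le {k : ℕ} (Q : MvPolynomial (Fin k) ℂ) :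
    ∃ C c : ℝ, 0 ≤ C ∧ 0 ≤ c ∧ ∀ a, ‖MvPolynomial.eval a Q‖ ≤ C * Real.exp (c * ∑ j, ‖a j‖) := by
  induction Q using MvPolynomial.induction_on with
  | C z => exact ⟨‖z‖, 0, norm_nonneg _, le_rfl, by simp⟩
  | add p q hp hq =>
    obtain ⟨C, c, hC, hc, h⟩ := hp
    obtain ⟨C', c', hC', hc', h'⟩ := hq
    refine ⟨C + C', c + c', by positivity, by positivity, fun a => ?_⟩
    rw [map_add, add_mul C]
    have hs : 0 ≤ ∑ j, ‖a j‖ := by positivity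
    refine (norm_add_le _ _).trans (add_le_add ((h a).trans ?_) ((h' a).trans ?_)) <;>
    · gcongr; linarith
  | mul_X p i hp =>
    obtain ⟨C, c, hC, hc, h⟩ := hp
    refine ⟨C, c + 1, hC, by positivity, fun a => ?_⟩
    rw [map_mul, MvPolynomial.eval_X, norm_mul, add_mul, one_mul, Real.exp_add, ← mul_assoc]
    refine mul_le_mul (h a) ?_ (norm_nonneg _) (by positivity)
    have h1 : ‖a i‖ ≤ ∑ j, ‖a j‖ :=
      Finset.single_le_sum (f := fun j => ‖a j‖) (fun _ _ => norm_nonneg _) (Finset.mem_univ i)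
    have h2 := Real.add_one_le_exp (∑ j, ‖a j‖)
    linarith

/-- Split log x = log⁺ x - log⁺(1/x): the first part is dominated by |Q|, the second by the bound on
`negLogSq`. -/
theorem memLp_log_norm_eval {k : ℕ} {Q : MvPolynomial (Fin k) ℂ} (hQ : Q ≠ 0) :
    MemLp (fun a => Real.log ‖MvPolynomial.eval a Q‖) 2 (stdGaussianVector k) := by
  have h1 : MemLp (fun a => Real.posLog ‖MvPolynomial.eval a Q‖) 2 (stdGaussianVector k) := by
    obtain ⟨C, c, -, -, h⟩ := exists_norm_eval_le Q
    refine (memLp_two_of_norm_le_exp (continuous_eval Q) h).norm.mono' ?_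
      (Filter.Eventually.of_forall fun a => ?_)
    · unfold Real.posLog
      exact (measurable_const.max (measurable_log_norm_eval Q)).aestronglyMeasurable
    · rw [Real.norm_of_nonneg Real.posLog_nonneg, Real.posLog_apply]
      exact max_le (norm_nonneg _) (Real.log_le_self (norm_nonneg _))
  have h2 : MemLp (fun a => Real.posLog ‖MvPolynomial.eval a Q‖⁻¹) 2 (stdGaussianVector k) := by
    have hm : Measurable fun a => Real.posLog ‖MvPolynomial.eval a Q‖⁻¹ := by
      unfold Real.posLog
      have := (continuous_eval Q).measurable
      fun_prop
    rw [memLp_two_iff_integrable_sq hm.aestronglyMeasurable]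
    refine ⟨(hm.pow_const 2).aestronglyMeasurable, ?_⟩
    rw [hasFiniteIntegral_iff_ofReal (Filter.Eventually.of_forall fun a => by positivity)]
    refine lt_of_le_of_lt (lintegral_mono fun a => ?_)
      (lt_top_iff_ne_top.mpr (lintegral_negLogSq_eval_ne_top Q hQ))
    rw [negLogSq]
    split_ifs
    · exact le_top
    · exact le_rfl
  refine (h1.sub h2).ae_eq (Filter.Eventually.of_forall fun a => ?_)
  simp only [Pi.sub_apply]
  exact Real.posLog_sub_posLog_inv

/-! ### Directional derivatives and Green's identity -/

section DirDeriv

variable {E : Type*} [NormedAddCommGroup E] [NormedSpace ℝ E]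

/-- The derivative in the direction `v`. -/
noncomputable def dirDeriv (v : E) (f : E → ℝ) (x : E) : ℝ := fderiv ℝ f x v

theorem contDiffOn_dirDeriv {n m : WithTop ℕ∞} {V : Set E} (hV : IsOpen V) {f : E → ℝ}
    (hf : ContDiffOn ℝ n f V) (hmn : m + 1 ≤ n) (v : E) : ContDiffOn ℝ m (dirDeriv v f) V :=
  (hf.fderiv_of_isOpen hV hmn).clm_apply contDiffOn_const

theorem dirDeriv_dirDeriv {V : Set E} (hV : IsOpen V) {f : E → ℝ} (hf : ContDiffOn ℝ 2 f V)
    {x : E} (hx : x ∈ V) (v w : E) :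
    dirDeriv w (dirDeriv v f) x = iteratedFDeriv ℝ 2 f x ![w, v] := by
  rw [iteratedFDeriv_two_apply]
  have hd : DifferentiableAt ℝ (fderiv ℝ f) x :=
    ((hf.fderiv_of_isOpen hV (m := 1) (by norm_num)).differentiableOn one_ne_zero).differentiableAt
      (hV.mem_nhds hx)
  have : dirDeriv v f = fun y => fderiv ℝ f y v := rfl
  rw [dirDeriv, this, fderiv_clm_apply hd (differentiableAt_const v)]
  simp

theorem tsupport_dirDeriv_subset (v : E) (f : E → ℝ) : tsupport (dirDeriv v f) ⊆ tsupport f := by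
  refine closure_minimal (fun x hx => ?_) (isClosed_tsupport f)
  by_contra h
  refine hx ?_
  have : fderiv ℝ f x = 0 := by
    by_contra h'
    exact h (support_fderiv_subset ℝ h')
  simp [dirDeriv, this]

/-- The product vanishes near every point outside the support of g, so f need only be regular on V.
This is what permits potentials that are smooth only on an open set. -/
theorem continuous_mul_of_tsupport_subset {X : Type*} [TopologicalSpace X] {V : Set X} (hV : IsOpen V)
    {f g : X → ℝ} (hf : ContinuousOn f V) (hg : Continuous g) (hsub : tsupport g ⊆ V) :
    Continuous fun x => f x * g x := by
  refine continuous_of_tsupport fun x hx => ?_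
  have hx' : x ∈ V := hsub (closure_mono (fun y hy => right_ne_zero_of_mul hy) hx)
  exact (hf.continuousAt (hV.mem_nhds hx')).mul hg.continuousAt

variable [MeasurableSpace E] [BorelSpace E] [FiniteDimensional ℝ E] (μ : Measure E) [μ.IsAddHaarMeasure]

theorem integrable_mul_of_tsupport_subset {X : Type*} [TopologicalSpace X] [MeasurableSpace X]
    [OpensMeasurableSpace X] [T2Space X] {μ : Measure X} [IsFiniteMeasureOnCompacts μ]
    {V : Set X} (hV : IsOpen V) {f g : X → ℝ} (hf : ContinuousOn f V)
    (hg : Continuous g) (hc : HasCompactSupport g) (hsub : tsupport g ⊆ V) :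
    Integrable (fun x => f x * g x) μ :=
  (continuous_mul_of_tsupport_subset hV hf hg hsub).integrable_of_hasCompactSupport hc.mul_left

theorem integral_mul_dirDeriv_dirDeriv {V : Set E} (hV : IsOpen V) {u φ : E → ℝ}
    (hu : ContDiffOn ℝ 2 u V) (hφ : ContDiff ℝ 2 φ) (hc : HasCompactSupport φ) (hsub : tsupport φ ⊆ V)
    (v : E) :
    ∫ x, u x * dirDeriv v (dirDeriv v φ) x ∂μ = ∫ x, dirDeriv v (dirDeriv v u) x * φ x ∂μ := by
  have hφ1 : ContDiff ℝ 1 (dirDeriv v φ) := by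
    rw [← contDiffOn_univ] at hφ ⊢
    exact contDiffOn_dirDeriv isOpen_univ hφ (by norm_num) v
  have hφ2 : ContDiff ℝ 0 (dirDeriv v (dirDeriv v φ)) := by
    rw [← contDiffOn_univ] at hφ1 ⊢
    exact contDiffOn_dirDeriv isOpen_univ hφ1 (by norm_num) v
  have hu1 : ContDiffOn ℝ 1 (dirDeriv v u) V := contDiffOn_dirDeriv hV hu (by norm_num) v
  have hu2 : ContDiffOn ℝ 0 (dirDeriv v (dirDeriv v u)) V :=
    contDiffOn_dirDeriv hV hu1 (by norm_num) v
  have s1 := tsupport_dirDeriv_subset v φ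
  have s2 := tsupport_dirDeriv_subset v (dirDeriv v φ)
  have c1 : HasCompactSupport (dirDeriv v φ) := hc.of_isClosed_subset (isClosed_tsupport _) s1
  have c2 : HasCompactSupport (dirDeriv v (dirDeriv v φ)) :=
    c1.of_isClosed_subset (isClosed_tsupport _) s2
  have e1 := integral_mul_fderiv_eq_neg_fderiv_mul_of_integrable (μ := μ) (f := u)
    (g := dirDeriv v φ) (v := v)
    (integrable_mul_of_tsupport_subset hV hu1.continuousOn hφ1.continuous c1 (s1.trans hsub))
    (integrable_mul_of_tsupport_subset hV hu.continuousOn hφ2.continuous c2 (s2.trans (s1.trans hsub)))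
    (integrable_mul_of_tsupport_subset hV hu.continuousOn hφ1.continuous c1 (s1.trans hsub))
    (fun x hx => (hu.differentiableOn two_ne_zero).differentiableAt (hV.mem_nhds (hsub (s1 hx))))
    (fun x _ => (hφ1.differentiable one_ne_zero) x)
  have e2 := integral_mul_fderiv_eq_neg_fderiv_mul_of_integrable (μ := μ) (f := dirDeriv v u)
    (g := φ) (v := v)
    (integrable_mul_of_tsupport_subset hV hu2.continuousOn hφ.continuous hc hsub)
    (integrable_mul_of_tsupport_subset hV hu1.continuousOn hφ1.continuous c1 (s1.trans hsub))
    (integrable_mul_of_tsupport_subset hV hu1.continuousOn hφ.continuous hc hsub)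
    (fun x hx => (hu1.differentiableOn one_ne_zero).differentiableAt (hV.mem_nhds (hsub hx)))
    (fun x _ => (hφ.differentiable two_ne_zero) x)
  calc _ = -∫ x, dirDeriv v u x * dirDeriv v φ x ∂μ := e1
    _ = _ := by
      rw [show ∫ x, dirDeriv v u x * dirDeriv v φ x ∂μ = _ from e2, neg_neg]
      rfl

end DirDeriv

theorem laplacian_eq_dirDeriv {V : Set ℂ} (hV : IsOpen V) {u : ℂ → ℝ} (hu : ContDiffOn ℝ 2 u V)
    {z : ℂ} (hz : z ∈ V) :
    Laplacian.laplacian u z = dirDeriv 1 (dirDeriv 1 u) z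
      + dirDeriv Complex.I (dirDeriv Complex.I u) z := by
  rw [InnerProductSpace.laplacian_eq_iteratedFDeriv_complexPlane, dirDeriv_dirDeriv hV hu hz,
    dirDeriv_dirDeriv hV hu hz]

theorem continuous_laplacian {φ : ℂ → ℝ} (hφ : ContDiff ℝ 2 φ) : Continuous (Laplacian.laplacian φ) := by
  have : Laplacian.laplacian φ = fun z => dirDeriv 1 (dirDeriv 1 φ) z
      + dirDeriv Complex.I (dirDeriv Complex.I φ) z := by
    funext z
    exact laplacian_eq_dirDeriv isOpen_univ (contDiffOn_univ.mpr hφ) (Set.mem_univ z)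
  rw [this]
  have h : ∀ v, Continuous (dirDeriv v (dirDeriv v φ)) := fun v => by
    rw [← contDiffOn_univ] at hφ
    have := contDiffOn_dirDeriv (m := 0) isOpen_univ
      (contDiffOn_dirDeriv (m := 1) isOpen_univ hφ (by norm_num) v) (by norm_num) v
    exact continuousOn_univ.mp this.continuousOn
  exact (h 1).add (h Complex.I)

theorem tsupport_laplacian_subset (φ : ℂ → ℝ) : tsupport (Laplacian.laplacian φ) ⊆ tsupport φ := by
  refine closure_minimal (fun x hx => ?_) (isClosed_tsupport φ)
  by_contra h
  refine hx ?_
  have h0 : φ =ᶠ[nhds x] fun _ => 0 := notMem_tsupport_iff_eventuallyEq.mp h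
  rw [(InnerProductSpace.laplacian_congr_nhds h0).eq_of_nhds]
  simp [InnerProductSpace.laplacian_const]

theorem hasCompactSupport_laplacian {φ : ℂ → ℝ} (hc : HasCompactSupport φ) :
    HasCompactSupport (Laplacian.laplacian φ) :=
  hc.of_isClosed_subset (isClosed_tsupport _) (tsupport_laplacian_subset φ)

/-- Green's identity. -/
theorem integral_mul_laplacian {V : Set ℂ} (hV : IsOpen V) {u φ : ℂ → ℝ}
    (hu : ContDiffOn ℝ 2 u V) (hφ : ContDiff ℝ 2 φ) (hc : HasCompactSupport φ) (hsub : tsupport φ ⊆ V) :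
    ∫ z, u z * Laplacian.laplacian φ z = ∫ z, Laplacian.laplacian u z * φ z := by
  have hd : ∀ {n m : WithTop ℕ∞} {f : ℂ → ℝ} {W : Set ℂ} (_ : IsOpen W) (_ : ContDiffOn ℝ n f W)
      (_ : m + 1 ≤ n) (v : ℂ), ContDiffOn ℝ m (dirDeriv v f) W :=
    fun hW hf hmn v => contDiffOn_dirDeriv hW hf hmn v
  have hφ' := contDiffOn_univ.mpr hφ
  have i1 : ∀ v, Integrable fun z => u z * dirDeriv v (dirDeriv v φ) z := by
    intro v
    have s : tsupport (dirDeriv v (dirDeriv v φ)) ⊆ tsupport φ :=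
      (tsupport_dirDeriv_subset v _).trans (tsupport_dirDeriv_subset v φ)
    refine integrable_mul_of_tsupport_subset hV hu.continuousOn ?_
      (hc.of_isClosed_subset (isClosed_tsupport _) s) (s.trans hsub)
    exact continuousOn_univ.mp
      (hd (m := 0) isOpen_univ (hd (m := 1) isOpen_univ hφ' (by norm_num) v) (by norm_num) v).continuousOn
  have i2 : ∀ v, Integrable fun z => dirDeriv v (dirDeriv v u) z * φ z := fun v =>
    integrable_mul_of_tsupport_subset hV
      (hd (m := 0) hV (hd (m := 1) hV hu (by norm_num) v) (by norm_num) v).continuousOn hφ.continuous hc hsub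
  calc _ = ∫ z, (u z * dirDeriv 1 (dirDeriv 1 φ) z
        + u z * dirDeriv Complex.I (dirDeriv Complex.I φ) z) := by
        refine integral_congr_ae (Filter.Eventually.of_forall fun z => ?_)
        simp only
        rw [laplacian_eq_dirDeriv isOpen_univ hφ' (Set.mem_univ z), mul_add]
    _ = ∫ z, (dirDeriv 1 (dirDeriv 1 u) z * φ z
        + dirDeriv Complex.I (dirDeriv Complex.I u) z * φ z) := by
        rw [integral_add (i1 _) (i1 _), integral_add (i2 _) (i2 _),
          integral_mul_dirDeriv_dirDeriv volume hV hu hφ hc hsub,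
          integral_mul_dirDeriv_dirDeriv volume hV hu hφ hc hsub]
    _ = _ := by
        refine integral_congr_ae (Filter.Eventually.of_forall fun z => ?_)
        simp only
        by_cases hz : z ∈ tsupport φ
        · rw [laplacian_eq_dirDeriv hV hu (hsub hz), add_mul]
        · rw [image_eq_zero_of_notMem_tsupport hz]; ring

/-! ### The fundamental solution -/

theorem norm_sq_add_mul (z v : ℂ) (t : ℝ) :
    ‖z + t • v‖ ^ 2 = (z.re + t * v.re) ^ 2 + (z.im + t * v.im) ^ 2 := by
  rw [← Complex.normSq_eq_norm_sq, Complex.normSq_apply]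
  simp
  ring

theorem contDiff_log_norm_sq_add {ε : ℝ} (hε : 0 < ε) (a : ℂ) :
    ContDiff ℝ ⊤ fun z : ℂ => Real.log (‖z - a‖ ^ 2 + ε) / 2 := by
  refine ContDiff.div_const (ContDiff.log ?_ fun z => by positivity) _
  exact ((contDiff_id.sub contDiff_const).norm_sq ℝ).add contDiff_const

/-- Regularization of log|z - a|. Its Laplacian is an approximate identity of total mass 2π as ε →
0. -/
theorem laplacian_log_norm_sq_add {ε : ℝ} (hε : 0 < ε) (a z : ℂ) :
    Laplacian.laplacian (fun z : ℂ => Real.log (‖z - a‖ ^ 2 + ε) / 2) z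
      = 2 * ε / (‖z - a‖ ^ 2 + ε) ^ 2 := by
  have hcd := contDiff_log_norm_sq_add hε a
  rw [laplacian_eq_dirDeriv isOpen_univ ((hcd.of_le le_top).contDiffOn) (Set.mem_univ z)]
  have hN : ∀ z : ℂ, ‖z - a‖ ^ 2 = (z.re - a.re) ^ 2 + (z.im - a.im) ^ 2 := by
    intro z
    rw [← Complex.normSq_eq_norm_sq, Complex.normSq_apply]; simp; ring
  have d1 : ∀ v : ℂ, dirDeriv v (fun z : ℂ => Real.log (‖z - a‖ ^ 2 + ε) / 2)
      = fun z => ((z.re - a.re) * v.re + (z.im - a.im) * v.im) / (‖z - a‖ ^ 2 + ε) := by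
    intro v; funext z
    rw [dirDeriv, ← ((hcd.differentiable (by simp)) z).lineDeriv_eq_fderiv]
    refine HasLineDerivAt.lineDeriv ?_
    have h1 : HasDerivAt (fun t : ℝ => ‖z + t • v - a‖ ^ 2 + ε)
        (2 * (z.re - a.re) * v.re + 2 * (z.im - a.im) * v.im) 0 := by
      have e : (fun t : ℝ => ‖z + t • v - a‖ ^ 2 + ε) = fun t : ℝ =>
          ((z.re - a.re) + t * v.re) ^ 2 + ((z.im - a.im) + t * v.im) ^ 2 + ε := by
        funext t
        rw [show z + t • v - a = (z - a) + t • v by ring, norm_sq_add_mul]; simp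
      rw [e]
      have := (((((hasDerivAt_id (0 : ℝ)).mul_const v.re).const_add (z.re - a.re)).pow 2).add
        ((((hasDerivAt_id (0 : ℝ)).mul_const v.im).const_add (z.im - a.im)).pow 2)).add_const ε
      refine this.congr_deriv ?_
      simp
    have h2 := (h1.log (by positivity)).div_const 2
    refine h2.congr_deriv ?_
    simp only [zero_smul, add_zero]
    field_simp
  have d2 : ∀ v : ℂ, dirDeriv v (dirDeriv v (fun z : ℂ => Real.log (‖z - a‖ ^ 2 + ε) / 2)) z
      = ((v.re ^ 2 + v.im ^ 2) * (‖z - a‖ ^ 2 + ε)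
        - 2 * ((z.re - a.re) * v.re + (z.im - a.im) * v.im) ^ 2) / (‖z - a‖ ^ 2 + ε) ^ 2 := by
    intro v
    have hc1 : ContDiff ℝ 1 (dirDeriv v (fun z : ℂ => Real.log (‖z - a‖ ^ 2 + ε) / 2)) :=
      contDiffOn_univ.mp (contDiffOn_dirDeriv isOpen_univ (contDiffOn_univ.mpr (hcd.of_le le_top)) le_rfl v)
    rw [dirDeriv, ← ((hc1.differentiable one_ne_zero) z).lineDeriv_eq_fderiv, d1]
    refine HasLineDerivAt.lineDeriv ?_
    have h1 : HasDerivAt (fun t : ℝ => ‖z + t • v - a‖ ^ 2 + ε)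
        (2 * (z.re - a.re) * v.re + 2 * (z.im - a.im) * v.im) 0 := by
      have e : (fun t : ℝ => ‖z + t • v - a‖ ^ 2 + ε) = fun t : ℝ =>
          ((z.re - a.re) + t * v.re) ^ 2 + ((z.im - a.im) + t * v.im) ^ 2 + ε := by
        funext t
        rw [show z + t • v - a = (z - a) + t • v by ring, norm_sq_add_mul]; simp
      rw [e]
      have := (((((hasDerivAt_id (0 : ℝ)).mul_const v.re).const_add (z.re - a.re)).pow 2).add
        ((((hasDerivAt_id (0 : ℝ)).mul_const v.im).const_add (z.im - a.im)).pow 2)).add_const ε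
      refine this.congr_deriv ?_
      simp
    have h3 : HasDerivAt (fun t : ℝ => ((z + t • v).re - a.re) * v.re + ((z + t • v).im - a.im) * v.im)
        (v.re ^ 2 + v.im ^ 2) 0 := by
      have e : (fun t : ℝ => ((z + t • v).re - a.re) * v.re + ((z + t • v).im - a.im) * v.im)
          = fun t : ℝ => t * (v.re ^ 2 + v.im ^ 2) + ((z.re - a.re) * v.re + (z.im - a.im) * v.im) := by
        funext t; simp; ring
      rw [e]
      exact (((hasDerivAt_id (0 : ℝ)).mul_const _).add_const _).congr_deriv (by simp)
    refine (h3.div h1 (by positivity)).congr_deriv ?_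
    simp only [zero_smul, add_zero]
    congr 1
    ring
  rw [d2, d2]
  have hp : 0 < ‖z - a‖ ^ 2 + ε := by positivity
  simp only [Complex.one_re, Complex.one_im, Complex.I_re, Complex.I_im]
  rw [← add_div]
  congr 1
  rw [hN]
  ring

theorem integral_two_div_one_add_norm_sq :
    ∫ u : ℂ, 2 / (‖u‖ ^ 2 + 1) ^ 2 = 2 * Real.pi := by
  rw [← Complex.integral_comp_polarCoord_symm, polarCoord_target]
  simp_rw [Complex.norm_polarCoord_symm, smul_eq_mul, sq_abs]
  have h := setIntegral_prod_mul (μ := (volume : Measure ℝ)) (ν := (volume : Measure ℝ))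
    (fun r : ℝ => r * (2 / (r ^ 2 + 1) ^ 2)) (fun _ : ℝ => (1 : ℝ)) (Set.Ioi 0)
    (Set.Ioo (-Real.pi) Real.pi)
  simp only [mul_one] at h
  rw [← Measure.volume_eq_prod] at h
  rw [h]
  have h1 : ∫ r in Set.Ioi (0 : ℝ), r * (2 / (r ^ 2 + 1) ^ 2) = 0 - (-1 / ((0 : ℝ) ^ 2 + 1)) := by
    refine integral_Ioi_of_hasDerivAt_of_nonneg' (g := fun r : ℝ => -1 / (r ^ 2 + 1)) ?_ ?_ ?_
    · intro r _
      have hd : HasDerivAt (fun r : ℝ => r ^ 2 + 1) (2 * r) r := by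
        simpa using (hasDerivAt_pow 2 r).add_const 1
      refine ((hasDerivAt_const r (-1 : ℝ)).div hd (by positivity)).congr_deriv ?_
      field_simp; ring
    · intro r hr
      have : 0 < r := hr
      positivity
    · refine Filter.Tendsto.div_atTop tendsto_const_nhds ?_
      exact Filter.tendsto_atTop_add_const_right _ _ (Filter.tendsto_pow_atTop two_ne_zero)
  rw [h1, integral_const, measureReal_restrict_apply MeasurableSet.univ, Set.univ_inter,
    Measure.real, Real.volume_Ioo, ENNReal.toReal_ofReal (by linarith [Real.pi_pos])]
  norm_num
  ring

/-- A crude majorant, with log⁺(1/x) squared so that only `integrable_posLog_inv_norm_sq` is needed.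
-/
theorem abs_log_le (x : ℝ) : |Real.log x| ≤ |x| + 1 + Real.posLog x⁻¹ ^ 2 := by
  rw [← Real.posLog_sub_posLog_inv]
  have h1 : Real.posLog x ≤ |x| := by
    rw [← Real.posLog_abs, Real.posLog_apply]
    exact max_le (abs_nonneg _) (Real.log_le_self (abs_nonneg _))
  have h2 := Real.posLog_nonneg (x := x)
  have h3 := Real.posLog_nonneg (x := x⁻¹)
  rw [abs_le]
  constructor <;> nlinarith [sq_nonneg (Real.posLog x⁻¹ - 1)]

theorem integrable_mul_posLog_sq {ψ : ℂ → ℝ} (hψ : Continuous ψ) (hc : HasCompactSupport ψ) (a : ℂ) :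
    Integrable fun z => (‖z - a‖ ^ 2 + ‖z - a‖ + 1 + Real.posLog ‖z - a‖⁻¹ ^ 2) * ψ z := by
  obtain ⟨C, hC⟩ := hc.exists_bound_of_continuous hψ
  have h1 : Integrable fun z => (‖z - a‖ ^ 2 + ‖z - a‖ + 1) * ψ z :=
    integrable_mul_of_tsupport_subset isOpen_univ (by fun_prop) hψ hc (Set.subset_univ _)
  have h2 : Integrable fun z => Real.posLog ‖z - a‖⁻¹ ^ 2 * ψ z :=
    (integrable_posLog_inv_norm_sq.comp_sub_right a).mul_bdd (c := C) hψ.aestronglyMeasurable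
      (Filter.Eventually.of_forall hC)
  refine (h1.add h2).congr (Filter.Eventually.of_forall fun z => ?_)
  simp only [Pi.add_apply]; ring

theorem integrable_log_norm_sub_mul {ψ : ℂ → ℝ} (hψ : Continuous ψ) (hc : HasCompactSupport ψ) (a : ℂ) :
    Integrable fun z => Real.log ‖z - a‖ * ψ z := by
  refine (integrable_mul_posLog_sq hψ hc a).norm.mono' ?_ (Filter.Eventually.of_forall fun z => ?_)
  · exact (Measurable.aestronglyMeasurable (by fun_prop)).mul hψ.aestronglyMeasurable
  · rw [norm_mul, norm_mul]
    refine mul_le_mul_of_nonneg_right ?_ (norm_nonneg _)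
    refine (abs_log_le _).trans (le_trans ?_ (le_abs_self _))
    rw [abs_of_nonneg (norm_nonneg _)]
    nlinarith [sq_nonneg ‖z - a‖]

/-- Δ log|z - a| = 2π δ_a as a distribution, obtained as the limit of Green's identity for the
regularized logarithm. -/
theorem integral_log_norm_sub_mul_laplacian {φ : ℂ → ℝ} (hφ : ContDiff ℝ 2 φ)
    (hc : HasCompactSupport φ) (a : ℂ) :
    ∫ z, Real.log ‖z - a‖ * Laplacian.laplacian φ z = 2 * Real.pi * φ a := by
  have hδ : Filter.Tendsto (fun n : ℕ => 1 / ((n : ℝ) + 1)) Filter.atTop (nhds 0) :=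
    tendsto_one_div_add_atTop_nhds_zero_nat
  have hψ := continuous_laplacian hφ
  have hψc := hasCompactSupport_laplacian hc
  -- The regularization e = 1/(n+1) satisfies e ≤ 1, so r² + e² lies between r² and r² + 1; this
  -- gives a majorant independent of n.
  have lim1 : Filter.Tendsto (fun n : ℕ => ∫ z, Real.log (‖z - a‖ ^ 2 + (1 / ((n : ℝ) + 1)) ^ 2) / 2 *
      Laplacian.laplacian φ z) Filter.atTop
      (nhds (∫ z, Real.log ‖z - a‖ * Laplacian.laplacian φ z)) := by
    refine tendsto_integral_of_dominated_convergence _ (fun n => ?_)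
      (integrable_mul_posLog_sq hψ hψc a).norm (fun n => ?_) ?_
    · exact (Measurable.aestronglyMeasurable (by fun_prop)).mul hψ.aestronglyMeasurable
    · have : ∀ᵐ z : ℂ, z ≠ a := by simp [ae_iff]
      filter_upwards [this] with z hz
      rw [norm_mul, norm_mul]
      refine mul_le_mul_of_nonneg_right (le_trans ?_ (le_abs_self _)) (norm_nonneg _)
      have hr : 0 < ‖z - a‖ := norm_pos_iff.mpr (sub_ne_zero.mpr hz)
      set r := ‖z - a‖
      set e := (1 / ((n : ℝ) + 1))
      have he0 : 0 < e := by positivity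
      have he1 : e ≤ 1 := by
        rw [div_le_one (by positivity)]; linarith [(Nat.cast_nonneg n : (0 : ℝ) ≤ n)]
      have up : Real.log (r ^ 2 + e ^ 2) ≤ r ^ 2 := by
        refine (Real.log_le_sub_one_of_pos (by positivity)).trans ?_
        nlinarith
      have lo : 2 * Real.log r ≤ Real.log (r ^ 2 + e ^ 2) := by
        rw [← Nat.cast_two (R := ℝ), ← Real.log_pow]
        exact Real.log_le_log (by positivity) (by nlinarith)
      have hb := (abs_le.mp (abs_log_le r)).1
      rw [abs_of_pos hr] at hb
      rw [Real.norm_eq_abs, abs_le]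
      constructor <;> nlinarith [sq_nonneg (Real.posLog r⁻¹)]
    · have : ∀ᵐ z : ℂ, z ≠ a := by simp [ae_iff]
      filter_upwards [this] with z hz
      have hr : 0 < ‖z - a‖ := norm_pos_iff.mpr (sub_ne_zero.mpr hz)
      refine Filter.Tendsto.mul_const _ ?_
      have h1 : Filter.Tendsto (fun n : ℕ => ‖z - a‖ ^ 2 + (1 / ((n : ℝ) + 1)) ^ 2) Filter.atTop
          (nhds (‖z - a‖ ^ 2)) := by
        simpa using (hδ.pow 2).const_add (‖z - a‖ ^ 2)
      have h2 := (h1.log (by positivity)).div_const 2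
      rw [Real.log_pow] at h2
      simpa using h2
  -- After Green's identity, the substitution z = a + e u moves the dependence on n from the kernel
  -- into the test function.
  have eq2 : ∀ n : ℕ, ∫ z, Real.log (‖z - a‖ ^ 2 + (1 / ((n : ℝ) + 1)) ^ 2) / 2 *
      Laplacian.laplacian φ z = ∫ u : ℂ, 2 / (‖u‖ ^ 2 + 1) ^ 2 * φ (a + (1 / ((n : ℝ) + 1)) • u) := by
    intro n
    set e := (1 / ((n : ℝ) + 1))
    have he0 : 0 < e := by positivity
    rw [integral_mul_laplacian isOpen_univ
      ((contDiff_log_norm_sq_add (by positivity : 0 < e ^ 2) a).of_le le_top).contDiffOn hφ hc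
      (Set.subset_univ _)]
    simp_rw [laplacian_log_norm_sq_add (by positivity : 0 < e ^ 2)]
    rw [← integral_add_left_eq_self _ a]
    have h := Measure.integral_comp_smul (volume : Measure ℂ)
      (fun z : ℂ => 2 * e ^ 2 / (‖a + z - a‖ ^ 2 + e ^ 2) ^ 2 * φ (a + z)) e
    rw [Complex.finrank_real_complex, abs_of_pos (by positivity), smul_eq_mul, eq_comm,
      inv_mul_eq_iff_eq_mul₀ (by positivity)] at h
    rw [h, ← integral_const_mul]
    refine integral_congr_ae (Filter.Eventually.of_forall fun u => ?_)
    simp only [add_sub_cancel_left, norm_smul, Real.norm_eq_abs, mul_pow, sq_abs]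
    have : e ^ 2 * ‖u‖ ^ 2 + e ^ 2 = e ^ 2 * (‖u‖ ^ 2 + 1) := by ring
    rw [this]
    field_simp
  simp_rw [eq2] at lim1
  refine tendsto_nhds_unique lim1 ?_
  rw [← integral_two_div_one_add_norm_sq, ← integral_mul_const]
  obtain ⟨C, hC⟩ := hc.exists_bound_of_continuous hφ.continuous
  have hint : Integrable fun u : ℂ => 2 / (‖u‖ ^ 2 + 1) ^ 2 := by
    refine Integrable.of_integral_ne_zero ?_
    rw [integral_two_div_one_add_norm_sq]
    positivity
  refine tendsto_integral_of_dominated_convergence (fun u => 2 / (‖u‖ ^ 2 + 1) ^ 2 * C) (fun n => ?_)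
    (hint.mul_const C) (fun n => Filter.Eventually.of_forall fun u => ?_)
    (Filter.Eventually.of_forall fun u => ?_)
  · have := hφ.continuous
    exact (hint.1).mul (Continuous.aestronglyMeasurable (by fun_prop))
  · rw [norm_mul, Real.norm_of_nonneg (by positivity)]
    gcongr
    exact hC _
  · refine Filter.Tendsto.const_mul _ ?_
    have h1 : Filter.Tendsto (fun n : ℕ => a + (1 / ((n : ℝ) + 1)) • u) Filter.atTop (nhds (a + (0 : ℝ) • u)) :=
      (hδ.smul_const u).const_add a
    rw [zero_smul, add_zero] at h1
    exact (hφ.continuous.tendsto a).comp h1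

/-! ### The Poincaré–Lelong formula -/

theorem lintegral_zeroMeasure (Ω : Set ℂ) (F : ℂ → ℂ) (φ : ℂ → ℝ≥0∞) :
    ∫⁻ z, φ z ∂zeroMeasure Ω F = ∑' z : Ω, ((analyticOrderAt F z : ℕ∞) : ℝ≥0∞) * φ z := by
  rw [zeroMeasure, lintegral_sum_measure]
  refine tsum_congr fun z => ?_
  rw [lintegral_smul_measure, lintegral_dirac, smul_eq_mul]

theorem exists_open_superset_analytic {T : Set ℂ} {g : ℂ → ℂ} (hg : AnalyticOnNhd ℂ g T)
    (hg0 : ∀ z ∈ T, g z ≠ 0) :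
    ∃ V, IsOpen V ∧ T ⊆ V ∧ ∀ z ∈ V, AnalyticAt ℂ g z ∧ g z ≠ 0 := by
  refine ⟨{z | AnalyticAt ℂ g z ∧ g z ≠ 0}, ?_, fun z hz => ⟨hg z hz, hg0 z hz⟩, fun z hz => hz⟩
  rw [isOpen_iff_eventually]
  intro z hz
  exact hz.1.eventually_analyticAt.and (hz.1.continuousAt.eventually_ne hz.2)

/-- The logarithm of a zero-free analytic function is harmonic, so Green's identity gives zero. -/
theorem integral_log_norm_mul_laplacian_eq_zero {φ : ℂ → ℝ} (hφ : ContDiff ℝ 2 φ)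
    (hc : HasCompactSupport φ) {g : ℂ → ℂ} (hg : AnalyticOnNhd ℂ g (tsupport φ))
    (hg0 : ∀ z ∈ tsupport φ, g z ≠ 0) :
    Integrable (fun z => Real.log ‖g z‖ * Laplacian.laplacian φ z) ∧
    ∫ z, Real.log ‖g z‖ * Laplacian.laplacian φ z = 0 := by
  obtain ⟨V, hV, hTV, hgV⟩ := exists_open_superset_analytic hg hg0
  have hh := fun z hz => (hgV z hz).1.harmonicAt_log_norm (hgV z hz).2
  have hu : ContDiffOn ℝ 2 (fun z => Real.log ‖g z‖) V := fun z hz => (hh z hz).1.contDiffWithinAt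
  refine ⟨integrable_mul_of_tsupport_subset hV hu.continuousOn (continuous_laplacian hφ)
    (hasCompactSupport_laplacian hc) ((tsupport_laplacian_subset φ).trans hTV), ?_⟩
  rw [integral_mul_laplacian hV hu hφ hc hTV]
  refine integral_eq_zero_of_ae (Filter.Eventually.of_forall fun z => ?_)
  by_cases hz : z ∈ tsupport φ
  · simp only [(hh z (hTV hz)).2.eq_of_nhds, Pi.zero_apply, zero_mul]
  · simp only [image_eq_zero_of_notMem_tsupport hz, mul_zero, Pi.zero_apply]

/-- On the compact support of φ, F is a finite product of powers of z - u times a zero-free factor.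
Each linear factor contributes 2π φ(u), the zero-free one nothing. Nonnegativity is recorded because
`ENNReal.ofReal` would discard a negative value. -/
theorem lintegral_ofReal_zeroMeasure {Ω : Set ℂ} {F : ℂ → ℂ} (hF : AnalyticOnNhd ℂ F Ω)
    (hF0 : ∀ z ∈ Ω, analyticOrderAt F z ≠ ⊤) {φ : ℂ → ℝ} (hφ : ContDiff ℝ 2 φ)
    (hc : HasCompactSupport φ) (hsub : tsupport φ ⊆ Ω) (hφ0 : ∀ z, 0 ≤ φ z) :
    0 ≤ ∫ z, Real.log ‖F z‖ * Laplacian.laplacian φ z ∧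
    ∫⁻ z, ENNReal.ofReal (φ z) ∂zeroMeasure Ω F
      = ENNReal.ofReal ((2 * Real.pi)⁻¹ * ∫ z, Real.log ‖F z‖ * Laplacian.laplacian φ z) := by
  classical
  set T := tsupport φ with hT
  have hTc : IsCompact T := hc
  have hFT : AnalyticOnNhd ℂ F T := hF.mono hsub
  have hFm : MeromorphicOn F T := hFT.meromorphicOn
  have hord : ∀ u : T, meromorphicOrderAt F u ≠ ⊤ := by
    intro u
    rw [(hFT u u.2).meromorphicOrderAt_eq]
    simpa using hF0 u (hsub u.2)
  set D := MeromorphicOn.divisor F T with hD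
  have hfin : D.support.Finite := D.finiteSupport hTc
  obtain ⟨g, hg, hg0, hFg⟩ := hFm.extract_zeros_poles hord hfin
  -- This logarithmic identity holds off a discrete set, hence almost everywhere, which suffices
  -- under the integral.
  have hlog := MeromorphicOn.extract_zeros_poles_log hg0 hFg
  set s := hfin.toFinset with hs
  have hDord : ∀ u ∈ T, (D u : ℝ) = ((analyticOrderAt F u).toNat : ℝ) := by
    intro u hu
    rw [hD, MeromorphicOn.divisor_apply hFm hu, (hFT u hu).meromorphicOrderAt_eq]
    obtain ⟨n, hn⟩ := ENat.ne_top_iff_exists.mp (hF0 u (hsub hu))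
    rw [← hn]
    simp
  have hsum : (∑ᶠ u : ℂ, fun x => (D u : ℝ) * Real.log ‖x - u‖)
      = ∑ u ∈ s, fun x => (D u : ℝ) * Real.log ‖x - u‖ := by
    refine finsum_eq_sum_of_support_subset _ fun u hu => ?_
    rw [hs, Set.Finite.coe_toFinset]
    intro h0
    refine hu ?_
    funext x
    simp only [h0, Int.cast_zero, zero_mul, Pi.zero_apply]
  rw [hsum] at hlog
  have hae : ∀ᵐ z ∂volume.restrict T, Real.log ‖F z‖
      = (∑ u ∈ s, (D u : ℝ) * Real.log ‖z - u‖) + Real.log ‖g z‖ := by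
    have := ae_restrict_le_codiscreteWithin (μ := (volume : Measure ℂ)) hTc.measurableSet hlog
    filter_upwards [this] with z hz
    simpa using hz
  rw [ae_restrict_iff' hTc.measurableSet] at hae
  have hg' := integral_log_norm_mul_laplacian_eq_zero hφ hc hg fun z hz => hg0 ⟨z, hz⟩
  have hψ := continuous_laplacian hφ
  have hψc := hasCompactSupport_laplacian hc
  have e1 : ∫ z, Real.log ‖F z‖ * Laplacian.laplacian φ z = ∑ u ∈ s, (D u : ℝ) * (2 * Real.pi * φ u) := by
    calc _ = ∫ z, ((∑ u ∈ s, (D u : ℝ) * (Real.log ‖z - u‖ * Laplacian.laplacian φ z))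
          + Real.log ‖g z‖ * Laplacian.laplacian φ z) := by
          refine integral_congr_ae ?_
          filter_upwards [hae] with z hz
          by_cases hzT : z ∈ T
          · rw [hz hzT, add_mul, Finset.sum_mul]
            simp_rw [mul_assoc]
          · rw [image_eq_zero_of_notMem_tsupport
              (fun h => hzT (tsupport_laplacian_subset φ h))]
            simp
      _ = _ := by
          rw [integral_add (integrable_finsetSum _ fun u _ =>
            (integrable_log_norm_sub_mul hψ hψc u).const_mul _) hg'.1, hg'.2, add_zero,
            integral_finsetSum _ fun u _ => (integrable_log_norm_sub_mul hψ hψc u).const_mul _]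
          refine Finset.sum_congr rfl fun u _ => ?_
          rw [integral_const_mul, integral_log_norm_sub_mul_laplacian hφ hc]
  have hsT : ∀ u ∈ s, u ∈ T := by
    intro u hu
    rw [hs, Set.Finite.mem_toFinset] at hu
    exact D.supportWithinDomain hu
  refine ⟨?_, ?_⟩
  · rw [e1]
    refine Finset.sum_nonneg fun u hu => ?_
    rw [hDord u (hsT u hu)]
    have := hφ0 u
    positivity
  rw [e1, Finset.mul_sum, lintegral_zeroMeasure]
  have e2 : ∀ u ∈ s, (2 * Real.pi)⁻¹ * ((D u : ℝ) * (2 * Real.pi * φ u))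
      = ((analyticOrderAt F u).toNat : ℝ) * φ u := by
    intro u hu
    rw [hDord u (hsT u hu)]
    field_simp
  rw [Finset.sum_congr rfl e2, ENNReal.ofReal_sum_of_nonneg fun u _ => mul_nonneg (Nat.cast_nonneg _) (hφ0 u),
    tsum_subtype Ω (fun z => ((analyticOrderAt F z : ℕ∞) : ℝ≥0∞) * ENNReal.ofReal (φ z)),
    tsum_eq_sum (s := s)]
  · refine Finset.sum_congr rfl fun u hu => ?_
    rw [Set.indicator_of_mem (hsub (hsT u hu)), ENNReal.ofReal_mul (Nat.cast_nonneg _),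
      ENNReal.ofReal_natCast]
    congr 1
    obtain ⟨n, hn⟩ := ENat.ne_top_iff_exists.mp (hF0 u (hsub (hsT u hu)))
    rw [← hn]
    simp
  · intro u hu
    by_cases huT : u ∈ T
    · rw [Set.indicator_of_mem (hsub huT)]
      have : D u = 0 := by
        by_contra h
        exact hu (by rw [hs, Set.Finite.mem_toFinset]; exact h)
      have h2 := hDord u huT
      rw [this, Int.cast_zero, eq_comm, Nat.cast_eq_zero, ENat.toNat_eq_zero] at h2
      rw [h2.resolve_right (hF0 u (hsub huT))]
      simp
    · have : φ u = 0 := image_eq_zero_of_notMem_tsupport huT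
      rw [Set.indicator_apply, this]
      simp

/-! ### Second moments of complex Gaussian laws -/

theorem memLp_coord (m : ℕ) (j : Fin m) : MemLp (fun a : Fin m → ℂ => a j) 2 (stdGaussianVector m) := by
  refine memLp_two_of_norm_le_exp (C := 1) (c := 1) (continuous_apply j) fun a => ?_
  have h1 : ‖a j‖ ≤ ∑ i, ‖a i‖ :=
    Finset.single_le_sum (f := fun i => ‖a i‖) (fun _ _ => norm_nonneg _) (Finset.mem_univ j)
  have h2 := Real.add_one_le_exp (∑ i, ‖a i‖)
  rw [one_mul, one_mul]
  linarith

theorem integral_coord_mul_conj_coord (m : ℕ) (i j : Fin m) :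
    ∫ a, a i * conj (a j) ∂stdGaussianVector m = if i = j then 1 else 0 := by
  have e : ∀ a : Fin m → ℂ, a i * conj (a j)
      = ∏ l, (a l ^ (if l = i then 1 else 0) * conj (a l) ^ (if l = j then 1 else 0)) := by
    intro a
    rw [Finset.prod_mul_distrib]
    simp [pow_ite, Finset.prod_ite_eq']
  simp_rw [e]
  rw [integral_stdGaussianVector_prod fun l z => z ^ (if l = i then 1 else 0) *
    conj z ^ (if l = j then 1 else 0)]
  simp_rw [integral_pow_mul_conj_pow]
  split_ifs with h
  · subst h
    refine Finset.prod_eq_one fun l _ => ?_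
    by_cases hl : l = i <;> simp [hl]
  · refine Finset.prod_eq_zero (Finset.mem_univ i) ?_
    simp [h]

theorem memLp_mulVec {n m : ℕ} (B : Matrix (Fin n) (Fin m) ℂ) (i : Fin n) :
    MemLp (fun a => B.mulVec a i) 2 (stdGaussianVector m) := by
  have : (fun a : Fin m → ℂ => B.mulVec a i) = fun a => ∑ l, B i l * a l := rfl
  rw [this]
  exact memLp_finsetSum _ fun l _ => (memLp_coord m l).const_mul _

theorem integral_mulVec_mul_conj {n m : ℕ} (B : Matrix (Fin n) (Fin m) ℂ) (i j : Fin n) :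
    ∫ a, B.mulVec a i * conj (B.mulVec a j) ∂stdGaussianVector m = (B * B.conjTranspose) i j := by
  have e : ∀ a : Fin m → ℂ, B.mulVec a i * conj (B.mulVec a j)
      = ∑ l, ∑ l', (B i l * conj (B j l')) * (a l * conj (a l')) := by
    intro a
    simp only [Matrix.mulVec, dotProduct, map_sum, map_mul]
    rw [Finset.sum_mul_sum]
    refine Finset.sum_congr rfl fun l _ => Finset.sum_congr rfl fun l' _ => ?_
    ring
  have hint : ∀ l l' : Fin m, Integrable (fun a : Fin m → ℂ => (B i l * conj (B j l')) *
      (a l * conj (a l'))) (stdGaussianVector m) := by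
    intro l l'
    exact ((memLp_coord m l).integrable_mul (memLp_coord m l').star).const_mul _
  simp_rw [e]
  rw [integral_finsetSum _ fun l _ => integrable_finsetSum _ fun l' _ => hint l l']
  rw [Matrix.mul_apply]
  refine Finset.sum_congr rfl fun l _ => ?_
  rw [integral_finsetSum _ fun l' _ => hint l l']
  simp_rw [integral_const_mul, integral_coord_mul_conj_coord]
  simp [Matrix.conjTranspose_apply]

/-! ### Gaussian analytic functions as maps into L² -/

section OneGAF

variable {S : Type*} [MeasurableSpace S] {P : Measure S} {Ω : Set ℂ}
  {f : S → ℂ → ℂ} {K : ℂ → ℂ → ℂ}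

theorem IsGAF.measurable_pi (hf : IsGAF P Ω f) {n : ℕ} {z : Fin n → ℂ} (hz : ∀ i, z i ∈ Ω) :
    Measurable fun s i => f s (z i) :=
  measurable_pi_lambda _ fun i => hf.measurable _ (hz i)

theorem IsGAF.memLp (hf : IsGAF P Ω f) {z : ℂ} (hz : z ∈ Ω) : MemLp (fun s => f s z) 2 P := by
  obtain ⟨m, B, hB⟩ := hf.gaussian 1 (fun _ => z) fun _ => hz
  have h1 : MemLp (fun x : Fin 1 → ℂ => x 0) 2 (P.map fun s (_ : Fin 1) => f s z) := by
    rw [hB, memLp_map_measure_iff (measurable_pi_apply 0).aestronglyMeasurable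
      (measurable_mulVec B).aemeasurable]
    exact memLp_mulVec B 0
  rw [memLp_map_measure_iff (measurable_pi_apply 0).aestronglyMeasurable
    (hf.measurable_pi fun _ => hz).aemeasurable] at h1
  exact h1

open Classical in
/-- The value at `z` of a Gaussian analytic function, as an element of `L²`. -/
noncomputable def gafLp (P : Measure S) (f : S → ℂ → ℂ) (z : ℂ) : Lp ℂ 2 P :=
  if h : MemLp (fun s => f s z) 2 P then h.toLp _ else 0

theorem IsGAF.coeFn_gafLp (hf : IsGAF P Ω f) {z : ℂ} (hz : z ∈ Ω) :
    gafLp P f z =ᵐ[P] fun s => f s z := by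
  rw [gafLp, dif_pos (hf.memLp hz)]
  exact MemLp.coeFn_toLp _

theorem IsGAF.inner_gafLp (hf : IsGAF P Ω f) (hK : IsCovarianceKernel P Ω f K) {z w : ℂ}
    (hz : z ∈ Ω) (hw : w ∈ Ω) : inner ℂ (gafLp P f w) (gafLp P f z) = K z w := by
  rw [L2.inner_def, hK z hz w hw]
  refine integral_congr_ae ?_
  filter_upwards [hf.coeFn_gafLp hz, hf.coeFn_gafLp hw] with s h1 h2
  rw [h1, h2, RCLike.inner_apply]

theorem IsGAF.covariance_eq (hf : IsGAF P Ω f) (hK : IsCovarianceKernel P Ω f K) {n m : ℕ}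
    {z : Fin n → ℂ} (hz : ∀ i, z i ∈ Ω) {B : Matrix (Fin n) (Fin m) ℂ}
    (hB : (P.map fun s i => f s (z i)) = (stdGaussianVector m).map fun a => B.mulVec a) (i j : Fin n) :
    (B * B.conjTranspose) i j = K (z i) (z j) := by
  rw [← integral_mulVec_mul_conj, hK _ (hz i) _ (hz j)]
  have hc : Continuous fun x : Fin n → ℂ => x i * conj (x j) := by
    have : Continuous fun z : ℂ => conj z := Complex.continuous_conj
    fun_prop
  have h1 : ∫ x, x i * conj (x j) ∂(P.map fun s i => f s (z i)) = ∫ s, f s (z i) * conj (f s (z j)) ∂P :=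
    integral_map (hf.measurable_pi hz).aemeasurable hc.aestronglyMeasurable
  rw [← h1, hB, integral_map (measurable_mulVec B).aemeasurable hc.aestronglyMeasurable]

/-- Links laws with Hilbert space geometry: the characteristic function of a linear combination of
values determines its L² norm. -/
theorem IsGAF.integral_exp (hf : IsGAF P Ω f) {n : ℕ} {z : Fin n → ℂ} (hz : ∀ i, z i ∈ Ω)
    (u : Fin n → ℂ) :
    ∫ s, Complex.exp (((∑ j, u j * f s (z j)).re : ℂ) * Complex.I) ∂P
      = Complex.exp (-(‖∑ j, u j • gafLp P f (z j)‖ ^ 2 / 4 : ℝ)) := by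
  obtain ⟨m, B, hB⟩ := hf.gaussian n z hz
  have h1 : ∫ x, Complex.exp (((∑ j, u j * x j).re : ℂ) * Complex.I) ∂(P.map fun s i => f s (z i))
      = ∫ s, Complex.exp (((∑ j, u j * f s (z j)).re : ℂ) * Complex.I) ∂P :=
    integral_map (hf.measurable_pi hz).aemeasurable (Continuous.aestronglyMeasurable (by fun_prop))
  rw [← h1, hB, integral_exp_re_sum_map_mulVec]
  congr 1
  set K' : ℂ → ℂ → ℂ := fun z w => ∫ s, f s z * conj (f s w) ∂P
  have hK' : IsCovarianceKernel P Ω f K' := fun z _ w _ => rfl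
  have h2 : ((‖∑ j, u j • gafLp P f (z j)‖ ^ 2 : ℝ) : ℂ)
      = dotProduct u ((B * B.conjTranspose).mulVec (star u)) := by
    push_cast
    have h3 := inner_self_eq_norm_sq_to_K (𝕜 := ℂ) (∑ j, u j • gafLp P f (z j))
    rw [RCLike.ofReal_eq_complex_ofReal] at h3
    rw [← h3, sum_inner]
    simp_rw [inner_sum, inner_smul_left, inner_smul_right, hf.inner_gafLp hK' (hz _) (hz _)]
    rw [Finset.sum_comm]
    simp only [dotProduct, Matrix.mulVec, Pi.star_apply, hf.covariance_eq hK' hz hB]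
    refine Finset.sum_congr rfl fun i _ => ?_
    rw [Finset.mul_sum]
    refine Finset.sum_congr rfl fun j _ => ?_
    rw [Complex.star_def]
    ring
  rw [← h2]
  push_cast
  ring

variable [IsProbabilityMeasure P]

/-- A Gaussian analytic function is holomorphic as a map to `L²`. -/
theorem IsGAF.differentiableOn_gafLp (hΩ : IsOpen Ω) (hf : IsGAF P Ω f) :
    DifferentiableOn ℂ (gafLp P f) Ω := by
  intro z hz
  have hΩz : ∀ᶠ y in nhdsWithin z {z}ᶜ, y ∈ Ω := nhdsWithin_le_nhds (hΩ.mem_nhds hz)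
  set l := nhdsWithin z {z}ᶜ
  set Φ := gafLp P f
  -- Sample paths are differentiable, so differences of two slopes at z tend to 0 pointwise and
  -- their characteristic functions tend to 1. These are exp(-‖·‖²/4), so the L² norms tend to 0 and
  -- the slopes are Cauchy in L². Gaussianity replaces a domination argument.
  have hsl : ∀ y ∈ Ω, ∀ y' ∈ Ω, ∫ s, Complex.exp (((slope (f s) z y - slope (f s) z y').re : ℂ) * Complex.I) ∂P
      = Complex.exp (-(‖slope Φ z y - slope Φ z y'‖ ^ 2 / 4 : ℝ)) := by
    intro y hy y' hy'
    have h := hf.integral_exp (z := ![y, z, y']) (by intro i; fin_cases i <;> assumption)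
      ![(y - z)⁻¹, (y' - z)⁻¹ - (y - z)⁻¹, -(y' - z)⁻¹]
    simp only [Fin.sum_univ_three, Matrix.cons_val_zero, Matrix.cons_val_one, Matrix.cons_val] at h
    have e1 : ∀ s, slope (f s) z y - slope (f s) z y' = (y - z)⁻¹ * f s y
        + ((y' - z)⁻¹ - (y - z)⁻¹) * f s z + -(y' - z)⁻¹ * f s y' := by
      intro s
      simp only [slope_def_module, smul_eq_mul]
      ring
    have e2 : slope Φ z y - slope Φ z y' = (y - z)⁻¹ • Φ y
        + ((y' - z)⁻¹ - (y - z)⁻¹) • Φ z + -(y' - z)⁻¹ • Φ y' := by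
      simp only [slope_def_module]
      module
    simp_rw [e1, e2]
    exact h
  have hΩ2 : ∀ᶠ p : ℂ × ℂ in l ×ˢ l, p.1 ∈ Ω ∧ p.2 ∈ Ω := hΩz.prod_mk hΩz
  have hT : Filter.Tendsto (fun p : ℂ × ℂ => ∫ s, Complex.exp (((slope (f s) z p.1
      - slope (f s) z p.2).re : ℂ) * Complex.I) ∂P) (l ×ˢ l) (nhds (∫ _, (1 : ℂ) ∂P)) := by
    refine tendsto_integral_filter_of_dominated_convergence (fun _ => 1) ?_ ?_ (integrable_const _) ?_
    · filter_upwards [hΩ2] with p hp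
      have m1 := hf.measurable _ hp.1
      have m2 := hf.measurable _ hp.2
      have m3 := hf.measurable _ hz
      simp only [slope_def_field]
      exact Measurable.aestronglyMeasurable (by fun_prop)
    · refine Filter.Eventually.of_forall fun p => Filter.Eventually.of_forall fun s => ?_
      rw [Complex.norm_exp_ofReal_mul_I]
    · refine Filter.Eventually.of_forall fun s => ?_
      have h1 : Filter.Tendsto (slope (f s) z) l (nhds (deriv (f s) z)) :=
        (hf.analytic s z hz).differentiableAt.hasDerivAt.tendsto_slope
      have h2 := (h1.comp Filter.tendsto_fst).sub (h1.comp Filter.tendsto_snd)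
      rw [sub_self] at h2
      have hc : Continuous fun w : ℂ => Complex.exp ((w.re : ℂ) * Complex.I) := by fun_prop
      have h3 := (hc.tendsto 0).comp h2
      simpa [Function.comp_def] using! h3
  have hT2 : Filter.Tendsto (fun p : ℂ × ℂ => Real.exp (-(‖slope Φ z p.1 - slope Φ z p.2‖ ^ 2 / 4)))
      (l ×ˢ l) (nhds 1) := by
    have h1 := (Complex.continuous_re.tendsto _).comp hT
    simp only [integral_const, probReal_univ, one_smul, Complex.one_re] at h1
    refine h1.congr' ?_
    filter_upwards [hΩ2] with p hp
    simp only [Function.comp_apply]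
    rw [hsl _ hp.1 _ hp.2, ← Complex.ofReal_neg, ← Complex.ofReal_exp, Complex.ofReal_re]
  have hT3 : Filter.Tendsto (fun p : ℂ × ℂ => dist (slope Φ z p.1) (slope Φ z p.2)) (l ×ˢ l) (nhds 0) := by
    have h1 := ((hT2.log one_ne_zero).const_mul (-4)).sqrt
    rw [Real.log_one, mul_zero, Real.sqrt_zero] at h1
    refine h1.congr fun p => ?_
    rw [Real.log_exp, dist_eq_norm, show -4 * -(‖slope Φ z p.1 - slope Φ z p.2‖ ^ 2 / 4)
      = ‖slope Φ z p.1 - slope Φ z p.2‖ ^ 2 by ring, Real.sqrt_sq (norm_nonneg _)]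
  have hcauchy : Cauchy (Filter.map (slope Φ z) l) := by
    rw [cauchy_map_iff']
    rw [Metric.uniformity_eq_comap_nhds_zero, Filter.tendsto_comap_iff]
    exact hT3
  obtain ⟨Φ', h⟩ := cauchy_map_iff_exists_tendsto.mp hcauchy
  exact (hasDerivAt_iff_tendsto_slope.mpr h).differentiableAt.differentiableWithinAt

theorem IsGAF.contDiffOn_gafLp (hΩ : IsOpen Ω) (hf : IsGAF P Ω f) (n : WithTop ℕ∞) :
    ContDiffOn ℝ n (gafLp P f) Ω :=
  (((hf.differentiableOn_gafLp hΩ).analyticOnNhd hΩ).contDiffOn hΩ.uniqueDiffOn).restrict_scalars ℝ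

omit [IsProbabilityMeasure P] in
/-- The law of the values at two points. -/
theorem IsGAF.map_pair (hf : IsGAF P Ω f) (hK : IsCovarianceKernel P Ω f K) {z w : ℂ}
    (hz : z ∈ Ω) (hw : w ∈ Ω) {σ τ t : ℝ} {c : ℂ} (hσ : K z z = (σ : ℂ) ^ 2) (hτ : K w w = (τ : ℂ) ^ 2)
    (hc : K z w = σ * τ * conj c) (ht : ‖c‖ ^ 2 + t ^ 2 = 1) :
    (P.map fun s => ![f s z, f s w])
      = (stdGaussianVector 2).map fun x => ![(σ : ℂ) * x 0, (τ : ℂ) * (c * x 0 + t * x 1)] := by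
  have hzw : ∀ i, ![z, w] i ∈ Ω := by intro i; fin_cases i <;> assumption
  obtain ⟨m, B, hB⟩ := hf.gaussian 2 ![z, w] hzw
  have e1 : (fun s => ![f s z, f s w]) = fun s i => f s (![z, w] i) := by
    funext s i; fin_cases i <;> rfl
  -- The triangular (Cholesky) factor of the covariance matrix of the two values.
  set C : Matrix (Fin 2) (Fin 2) ℂ := !![(σ : ℂ), 0; τ * c, τ * t]
  have e2 : (fun x : Fin 2 → ℂ => ![(σ : ℂ) * x 0, (τ : ℂ) * (c * x 0 + t * x 1)]) = fun x => C.mulVec x := by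
    funext x i
    fin_cases i
    · simp [C, Matrix.mulVec, dotProduct, Fin.sum_univ_two]
    · simp [C, Matrix.mulVec, dotProduct, Fin.sum_univ_two]; ring
  rw [e1, hB, e2]
  refine map_mulVec_eq_of_covariance_eq B C ?_
  have hwz : K w z = σ * τ * c := by
    rw [← hf.inner_gafLp hK hw hz, ← inner_conj_symm, hf.inner_gafLp hK hz hw, hc]
    simp
  have ht' : c * conj c + (t : ℂ) ^ 2 = 1 := by
    rw [Complex.mul_conj, Complex.normSq_eq_norm_sq]
    exact_mod_cast ht
  ext i j
  rw [hf.covariance_eq hK hzw hB]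
  fin_cases i <;> fin_cases j
  · simp [C, Matrix.mul_apply, Fin.sum_univ_two, hσ, Matrix.conjTranspose_apply]; ring
  · simp [C, Matrix.mul_apply, Fin.sum_univ_two, hc, Matrix.conjTranspose_apply]; ring
  · simp [C, Matrix.mul_apply, Fin.sum_univ_two, hwz, Matrix.conjTranspose_apply]; ring
  · simp [C, Matrix.mul_apply, Fin.sum_univ_two, hτ, Matrix.conjTranspose_apply]
    linear_combination (-(τ : ℂ) ^ 2) * ht'

end OneGAF

/-! ### Mean measures of random measures -/

section RandomMeasure

variable {S : Type*} [MeasurableSpace S] {α : Type*} [MeasurableSpace α]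

/-- The mean of `M` on `B` exists and is equal to `ν B`. -/
def HasMean (P : Measure S) (M : S → Measure α) (ν : Measure α) (B : Set α) : Prop :=
  AEMeasurable (fun s => M s B) P ∧ ∫⁻ s, M s B ∂P = ν B

variable {P : Measure S} {M : S → Measure α} {ν : Measure α}

theorem hasMean_iUnion {B : ℕ → Set α} (hd : Pairwise (Function.onFun Disjoint B))
    (hm : ∀ n, MeasurableSet (B n)) (h : ∀ n, HasMean P M ν (B n)) : HasMean P M ν (⋃ n, B n) := by
  have e : (fun s => M s (⋃ n, B n)) = fun s => ∑' n, M s (B n) := by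
    funext s; rw [measure_iUnion hd hm]
  refine ⟨?_, ?_⟩
  · rw [e]; exact AEMeasurable.tsum fun n => (h n).1
  · rw [e, lintegral_tsum fun n => (h n).1, measure_iUnion hd hm]
    exact tsum_congr fun n => (h n).2

/-- A π-λ argument inside V. The finite mean on V makes M s V finite almost surely, so that
complements can be handled by subtraction. -/
theorem hasMean_of_isPiSystem {𝒞 : Set (Set α)} (hpi : IsPiSystem 𝒞)
    (hgen : ‹MeasurableSpace α› = MeasurableSpace.generateFrom 𝒞) {V : Set α} (hV : MeasurableSet V)
    (hVfin : ν V ≠ ⊤) (hVmean : HasMean P M ν V) (h : ∀ C ∈ 𝒞, HasMean P M ν (C ∩ V)) {B : Set α}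
    (hB : MeasurableSet B) : HasMean P M ν (B ∩ V) := by
  induction B, hB using MeasurableSpace.induction_on_inter hgen hpi with
  | empty => simp [HasMean]
  | basic C hC => exact h C hC
  | compl C hC ih =>
    have hfin : ∀ᵐ s ∂P, M s V < ⊤ := ae_lt_top' hVmean.1 (by rw [hVmean.2]; exact hVfin)
    have e : (fun s => M s (Cᶜ ∩ V)) =ᵐ[P] fun s => M s V - M s (C ∩ V) := by
      filter_upwards [hfin] with s hs
      rw [show Cᶜ ∩ V = V \ (C ∩ V) by ext x; simp; tauto,
        measure_sdiff Set.inter_subset_right (hC.inter hV).nullMeasurableSet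
          (ne_top_of_le_ne_top hs.ne (measure_mono Set.inter_subset_right))]
    refine ⟨(hVmean.1.sub ih.1).congr e.symm, ?_⟩
    have hCfin : ν (C ∩ V) ≠ ⊤ := ne_top_of_le_ne_top hVfin (measure_mono Set.inter_subset_right)
    rw [lintegral_congr_ae e, lintegral_sub' ih.1 (by rw [ih.2]; exact hCfin)
      (Filter.Eventually.of_forall fun s => measure_mono Set.inter_subset_right), ih.2, hVmean.2,
      show Cᶜ ∩ V = V \ (C ∩ V) by ext x; simp; tauto,
      measure_sdiff Set.inter_subset_right (hC.inter hV).nullMeasurableSet hCfin]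
  | iUnion B hd hm ih =>
    rw [Set.iUnion_inter]
    exact hasMean_iUnion (fun i j hij => (hd hij).mono Set.inter_subset_left Set.inter_subset_left)
      (fun n => (hm n).inter hV) ih

/-- Second countability yields a countable subcover, which is made disjoint; means add over disjoint
pieces. -/
theorem hasMean_of_locally [TopologicalSpace α] [SecondCountableTopology α] [OpensMeasurableSpace α]
    {U : Set α} (h : ∀ x ∈ U, ∃ V, IsOpen V ∧ x ∈ V ∧
      ∀ B, MeasurableSet B → HasMean P M ν (B ∩ V)) {B : Set α} (hB : MeasurableSet B) (hBU : B ⊆ U) :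
    HasMean P M ν B := by
  rcases B.eq_empty_or_nonempty with rfl | hne
  · simp [HasMean]
  choose! V hVo hxV hV using h
  obtain ⟨t, htU, htc, ht⟩ := TopologicalSpace.countable_cover_nhdsWithin (s := U) (f := V)
    fun x hx => nhdsWithin_le_nhds ((hVo x hx).mem_nhds (hxV x hx))
  have htne : t.Nonempty := by
    by_contra h0
    rw [Set.not_nonempty_iff_eq_empty] at h0
    obtain ⟨x, hx⟩ := hne
    have := ht (hBU hx)
    simp [h0] at this
  obtain ⟨x, rfl⟩ := htc.exists_eq_range htne
  set W : ℕ → Set α := disjointed fun n => V (x n)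
  have hxU : ∀ n, x n ∈ U := fun n => htU ⟨n, rfl⟩
  have hWm : ∀ n, MeasurableSet (W n) :=
    MeasurableSet.disjointed fun n => (hVo _ (hxU n)).measurableSet
  have hBW : B = ⋃ n, B ∩ W n := by
    rw [← Set.inter_iUnion, iUnion_disjointed, eq_comm, Set.inter_eq_left]
    refine hBU.trans (ht.trans ?_)
    simp
  rw [hBW]
  refine hasMean_iUnion (fun i j hij => (disjoint_disjointed _ hij).mono Set.inter_subset_right
    Set.inter_subset_right) (fun n => hB.inter (hWm n)) fun n => ?_
  have : B ∩ W n = (B ∩ W n) ∩ V (x n) := by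
    rw [eq_comm, Set.inter_eq_left]
    exact Set.inter_subset_right.trans (disjointed_subset _ n)
  rw [this]
  exact hV _ (hxU n) _ (hB.inter (hWm n))

end RandomMeasure

/-! ### Smooth approximation of open sets -/

/-- Smooth functions increasing to the indicator of an open set. -/
theorem exists_smooth_seq (m : ℕ) {D : Set ℂ} (hD : IsOpen D) (hDc : IsCompact (closure D)) :
    ∃ φ : ℕ → ℂ → ℝ, (∀ n, ContDiff ℝ m (φ n)) ∧ (∀ n, HasCompactSupport (φ n)) ∧
      (∀ n, tsupport (φ n) ⊆ closure D) ∧ (∀ n z, 0 ≤ φ n z) ∧ (∀ z, Monotone fun n => φ n z) ∧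
      (∀ z, Filter.Tendsto (fun n => φ n z) Filter.atTop (nhds (D.indicator 1 z))) := by
  obtain ⟨χ, hχs, hχ, hχr⟩ := hD.exists_contDiff_support_eq (n := m)
  have hχ0 : ∀ z, 0 ≤ χ z := fun z => (hχr ⟨z, rfl⟩).1
  have hsub : ∀ n : ℕ, tsupport (fun z => Real.smoothTransition (n * χ z)) ⊆ closure D := by
    intro n
    refine closure_mono fun z hz => ?_
    rw [← hχs]
    intro h0
    exact hz (by simp [h0])
  -- Here χ is smooth and positive exactly on D. The transition function is 0 at 0 and 1 from 1 on,
  -- so at each point of D the value is 1 as soon as n χ ≥ 1.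
  refine ⟨fun n z => Real.smoothTransition (n * χ z), fun n => ?_, fun n => ?_, hsub, fun n z =>
    Real.smoothTransition.nonneg _, fun z m n hmn => ?_, fun z => ?_⟩
  · exact Real.smoothTransition.contDiff.comp (contDiff_const.mul hχ)
  · exact hDc.of_isClosed_subset (isClosed_tsupport _) (hsub n)
  · refine Real.smoothTransition.monotone ?_
    have := hχ0 z
    gcongr
  · by_cases hz : z ∈ D
    · rw [Set.indicator_of_mem hz]
      have hpos : 0 < χ z := lt_of_le_of_ne (hχ0 z) (Ne.symm (by rw [← hχs] at hz; exact hz))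
      refine tendsto_const_nhds.congr' ?_
      obtain ⟨N, hN⟩ := exists_nat_gt (1 / χ z)
      filter_upwards [Filter.eventually_ge_atTop N] with n hn
      rw [Pi.one_apply, Real.smoothTransition.one_of_one_le]
      rw [div_lt_iff₀ hpos] at hN
      have : (N : ℝ) ≤ n := by exact_mod_cast hn
      nlinarith
    · rw [Set.indicator_of_notMem hz]
      have h0 : χ z = 0 := by
        by_contra h
        exact hz (by rw [← hχs]; exact h)
      simp [h0]

theorem tendsto_lintegral_of_tendsto_indicator {X : Type*} [MeasurableSpace X] {D : Set X}
    (hD : MeasurableSet D) {φ : ℕ → X → ℝ} (hφ : ∀ n, Measurable (φ n)) (hmono : ∀ z, Monotone fun n => φ n z)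
    (hlim : ∀ z, Filter.Tendsto (fun n => φ n z) Filter.atTop (nhds (D.indicator 1 z)))
    (M : Measure X) :
    Filter.Tendsto (fun n => ∫⁻ z, ENNReal.ofReal (φ n z) ∂M) Filter.atTop (nhds (M D)) := by
  rw [← lintegral_indicator_one hD]
  refine lintegral_tendsto_of_tendsto_of_monotone (fun n => (hφ n).ennreal_ofReal.aemeasurable)
    (Filter.Eventually.of_forall fun z m n hmn => ENNReal.ofReal_le_ofReal (hmono z hmn))
    (Filter.Eventually.of_forall fun z => ?_)
  have h1 := (ENNReal.continuous_ofReal.tendsto _).comp (hlim z)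
  have h2 : ENNReal.ofReal (D.indicator (1 : X → ℝ) z) = D.indicator 1 z := by
    by_cases hz : z ∈ D
    · rw [Set.indicator_of_mem hz, Set.indicator_of_mem hz, Pi.one_apply, Pi.one_apply,
        ENNReal.ofReal_one]
    · rw [Set.indicator_of_notMem hz, Set.indicator_of_notMem hz, ENNReal.ofReal_zero]
  rw [h2] at h1
  exact h1

/-- If ρ were negative at x, a test function supported where ρ < 0 and positive at x would give a
negative integral. -/
theorem nonneg_of_forall_integral_nonneg {X : Type*} [TopologicalSpace X] [MeasurableSpace X]
    [OpensMeasurableSpace X] [T2Space X] {μ : Measure X} [IsFiniteMeasureOnCompacts μ]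
    [μ.IsOpenPosMeasure] {U : Set X} (hU : IsOpen U) {ρ : X → ℝ} (hρ : ContinuousOn ρ U)
    (h : ∀ x ∈ U, ∀ V, IsOpen V → x ∈ V → ∃ χ : X → ℝ, Continuous χ ∧ HasCompactSupport χ ∧
      tsupport χ ⊆ V ∧ (∀ y, 0 ≤ χ y) ∧ 0 < χ x ∧ 0 ≤ ∫ y, ρ y * χ y ∂μ) {x : X} (hx : x ∈ U) :
    0 ≤ ρ x := by
  by_contra! hneg
  have hVo : IsOpen (U ∩ ρ ⁻¹' Set.Iio 0) := hρ.isOpen_inter_preimage hU isOpen_Iio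
  obtain ⟨χ, hχ, hχc, hχV, hχ0, hχx, hint⟩ := h x hx _ hVo ⟨hx, hneg⟩
  have hcont : Continuous fun y => -ρ y * χ y :=
    continuous_mul_of_tsupport_subset hU hρ.neg hχ (hχV.trans Set.inter_subset_left)
  have hpos := hcont.integral_pos_of_hasCompactSupport_nonneg_nonzero (μ := μ) hχc.mul_left
    (fun y => by
      by_cases hy : y ∈ tsupport χ
      · have := (hχV hy).2
        simp only [Set.mem_preimage, Set.mem_Iio] at this
        exact mul_nonneg (by linarith) (hχ0 y)
      · simp [image_eq_zero_of_notMem_tsupport hy])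
    (x := x) (by
      have := mul_pos (neg_pos.mpr hneg) hχx
      exact this.ne')
  simp only [neg_mul] at hpos
  rw [integral_neg] at hpos
  linarith

/-! ### The covariance kernel -/

section Kernel

variable {S : Type*} [MeasurableSpace S] {P : Measure S} {Ω : Set ℂ}
  {f : S → ℂ → ℂ} {K : ℂ → ℂ → ℂ}

theorem IsGAF.norm_sq_gafLp (hf : IsGAF P Ω f) (hK : IsCovarianceKernel P Ω f K) {z : ℂ}
    (hz : z ∈ Ω) : K z z = ((‖gafLp P f z‖ ^ 2 : ℝ) : ℂ) := by
  rw [← hf.inner_gafLp hK hz hz, inner_self_eq_norm_sq_to_K]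
  simp

theorem IsGAF.re_kernel_self (hf : IsGAF P Ω f) (hK : IsCovarianceKernel P Ω f K) {z : ℂ}
    (hz : z ∈ Ω) : (K z z).re = ‖gafLp P f z‖ ^ 2 := by
  rw [hf.norm_sq_gafLp hK hz, Complex.ofReal_re]

theorem IsGAF.kernel_self_eq_re (hf : IsGAF P Ω f) (hK : IsCovarianceKernel P Ω f K) {z : ℂ}
    (hz : z ∈ Ω) : K z z = ((K z z).re : ℂ) := by
  rw [hf.norm_sq_gafLp hK hz, Complex.ofReal_re]

theorem IsGAF.re_kernel_self_pos (hf : IsGAF P Ω f) (hK : IsCovarianceKernel P Ω f K) {z : ℂ}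
    (hz : z ∈ Ω) (h0 : K z z ≠ 0) : 0 < (K z z).re := by
  refine lt_of_le_of_ne (by rw [hf.re_kernel_self hK hz]; positivity) fun h => h0 ?_
  rw [hf.kernel_self_eq_re hK hz, ← h, Complex.ofReal_zero]

theorem IsGAF.norm_kernel_sq_le (hf : IsGAF P Ω f) (hK : IsCovarianceKernel P Ω f K) {z w : ℂ}
    (hz : z ∈ Ω) (hw : w ∈ Ω) : ‖K z w‖ ^ 2 ≤ (K z z).re * (K w w).re := by
  rw [hf.re_kernel_self hK hz, hf.re_kernel_self hK hw, ← hf.inner_gafLp hK hz hw, ← mul_pow,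
    mul_comm ‖gafLp P f z‖]
  gcongr
  exact norm_inner_le_norm _ _

variable [IsProbabilityMeasure P]

theorem IsGAF.contDiffOn_re_kernel_self (hΩ : IsOpen Ω) (hf : IsGAF P Ω f)
    (hK : IsCovarianceKernel P Ω f K) (n : WithTop ℕ∞) :
    ContDiffOn ℝ n (fun z => (K z z).re) Ω := by
  refine ContDiffOn.congr (f := fun z => ‖gafLp P f z‖ ^ 2) ?_ fun z hz => hf.re_kernel_self hK hz
  exact (hf.contDiffOn_gafLp hΩ n).norm_sq ℝ

theorem IsGAF.contDiffOn_norm_kernel_sq (hΩ : IsOpen Ω) (hf : IsGAF P Ω f)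
    (hK : IsCovarianceKernel P Ω f K) (n : WithTop ℕ∞) :
    ContDiffOn ℝ n (fun q : ℂ × ℂ => ‖K q.1 q.2‖ ^ 2) (Ω ×ˢ Ω) := by
  have h1 : ContDiffOn ℝ n (fun q : ℂ × ℂ => gafLp P f q.1) (Ω ×ˢ Ω) :=
    (hf.contDiffOn_gafLp hΩ n).comp contDiffOn_fst fun q hq => hq.1
  have h2 : ContDiffOn ℝ n (fun q : ℂ × ℂ => gafLp P f q.2) (Ω ×ˢ Ω) :=
    (hf.contDiffOn_gafLp hΩ n).comp contDiffOn_snd fun q hq => hq.2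
  refine ContDiffOn.congr (f := fun q : ℂ × ℂ => ‖inner ℂ (gafLp P f q.2) (gafLp P f q.1)‖ ^ 2) ?_
    fun q hq => by rw [hf.inner_gafLp hK hq.1 hq.2]
  exact (h2.inner ℂ h1).norm_sq ℝ

end Kernel

/-! ### Moments of the logarithm -/

section Vector

variable {S : Type*} [MeasurableSpace S] {P : Measure S} [IsProbabilityMeasure P] {Ω : Set ℂ}
  {k d : ℕ} {Q : MvPolynomial (Fin k) ℂ} {f : Fin k → S → ℂ → ℂ} {K : ℂ → ℂ → ℂ}

-- Independence of the functions makes the law of the k pairs a product, so the two-point law of one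
-- function determines it.
omit [IsProbabilityMeasure P] in
theorem map_pairs (hf : ∀ i, IsGAF P Ω (f i)) (hcov : ∀ i, IsCovarianceKernel P Ω (f i) K)
    (hind : iIndepFun (fun (i : Fin k) (s : S) (z : Ω) => f i s z) P) {z w : ℂ}
    (hz : z ∈ Ω) (hw : w ∈ Ω) {σ τ t : ℝ} {c : ℂ} (hσ : K z z = (σ : ℂ) ^ 2)
    (hτ : K w w = (τ : ℂ) ^ 2) (hc : K z w = σ * τ * conj c) (ht : ‖c‖ ^ 2 + t ^ 2 = 1) :
    (P.map fun s i => ![f i s z, f i s w]) = (gaussianPairs k).map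
      fun x i => ![(σ : ℂ) * x i 0, (τ : ℂ) * (c * x i 0 + t * x i 1)] := by
  have hm : ∀ i, Measurable fun s => ![f i s z, f i s w] := fun i => by
    refine measurable_pi_lambda _ fun j => ?_
    fin_cases j
    · exact (hf i).measurable z hz
    · exact (hf i).measurable w hw
  have hi : iIndepFun (fun i s => ![f i s z, f i s w]) P := by
    refine hind.comp (fun i (u : Ω → ℂ) => ![u ⟨z, hz⟩, u ⟨w, hw⟩]) fun i => ?_
    refine measurable_pi_lambda _ fun j => ?_
    fin_cases j
    · exact measurable_pi_apply _
    · exact measurable_pi_apply _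
  have : IsProbabilityMeasure P := hind.isProbabilityMeasure
  rw [(iIndepFun_iff_map_fun_eq_pi_map fun i => (hm i).aemeasurable).mp hi]
  simp_rw [fun i => (hf i).map_pair (hcov i) hz hw hσ hτ hc ht]
  have hm2 : Measurable fun x : Fin 2 → ℂ => ![(σ : ℂ) * x 0, (τ : ℂ) * (c * x 0 + t * x 1)] := by
    refine measurable_pi_lambda _ fun j => ?_
    fin_cases j
    · exact (by fun_prop : Measurable fun x : Fin 2 → ℂ => (σ : ℂ) * x 0)
    · exact (by fun_prop : Measurable fun x : Fin 2 → ℂ => (τ : ℂ) * (c * x 0 + t * x 1))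
  rw [gaussianPairs, Measure.pi_map_pi fun _ => hm2.aemeasurable]

/-- The mean of the logarithm of a polynomial in standard complex Gaussians. -/
noncomputable def meanLog (Q : MvPolynomial (Fin k) ℂ) : ℝ :=
  ∫ a, Real.log ‖MvPolynomial.eval a Q‖ ∂stdGaussianVector k

/-- The squared correlation of the values at two points. -/
noncomputable def overlap (K : ℂ → ℂ → ℂ) (q : ℂ × ℂ) : ℝ :=
  ‖K q.1 q.2‖ ^ 2 / ((K q.1 q.1).re * (K q.2 q.2).re)

theorem normalizedPower_eq (K : ℂ → ℂ → ℂ) (p : ℕ) (z w : ℂ) :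
    normalizedPower K p z w = overlap K (z, w) ^ p := by
  rw [normalizedPower, overlap, div_pow, mul_pow, pow_mul]

theorem overlap_nonneg_of_pos {z w : ℂ} (hz : 0 < (K z z).re) (hw : 0 < (K w w).re) :
    0 ≤ overlap K (z, w) := by
  unfold overlap; positivity

/-- The mean of `log ‖Q (f z)‖`. -/
noncomputable def meanLogAt (d : ℕ) (Q : MvPolynomial (Fin k) ℂ) (K : ℂ → ℂ → ℂ) (z : ℂ) : ℝ :=
  d / 2 * Real.log (K z z).re + meanLog Q

/-- The mean of `log ‖Q (f z)‖ * log ‖Q (f w)‖`. -/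
noncomputable def meanLogMulLog (d : ℕ) (Q : MvPolynomial (Fin k) ℂ) (K : ℂ → ℂ → ℂ) (q : ℂ × ℂ) : ℝ :=
  meanLogAt d Q K q.1 * meanLogAt d Q K q.2 - meanLog Q ^ 2 + ∑' p, wickWeight Q p * overlap K q ^ p

omit [MeasurableSpace S] in
theorem log_norm_eval_smul (hQ : Q.IsHomogeneous d) {σ : ℝ} (hσ : 0 < σ) {a : Fin k → ℂ}
    (ha : MvPolynomial.eval a Q ≠ 0) :
    Real.log ‖MvPolynomial.eval (fun i => (σ : ℂ) * a i) Q‖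
      = d * Real.log σ + Real.log ‖MvPolynomial.eval a Q‖ := by
  rw [eval_smul_of_isHomogeneous hQ, norm_mul, norm_pow, Complex.norm_real, Real.norm_of_nonneg hσ.le,
    Real.log_mul (by positivity) (by simpa using ha), Real.log_pow]

omit [MeasurableSpace S] in
theorem memLp_const_add {X : Type*} [MeasurableSpace X] {μ : Measure X}
    [IsProbabilityMeasure μ] {A : X → ℝ} (hA : MemLp A 2 μ) (a : ℝ) : MemLp (fun x => a + A x) 2 μ :=
  (memLp_const a).add hA

omit [MeasurableSpace S] in
theorem integral_const_add_mul_const_add {X : Type*} [MeasurableSpace X] {μ : Measure X}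
    [IsProbabilityMeasure μ] {A B : X → ℝ} (hA : MemLp A 2 μ) (hB : MemLp B 2 μ) (a b : ℝ) :
    ∫ x, (a + A x) * (b + B x) ∂μ
      = a * b + b * ∫ x, A x ∂μ + a * ∫ x, B x ∂μ + ∫ x, A x * B x ∂μ := by
  have hA1 := hA.integrable (by norm_num)
  have hB1 := hB.integrable (by norm_num)
  have hAB : Integrable (fun x => A x * B x) μ := hA.integrable_mul hB
  have e : ∀ x, (a + A x) * (b + B x) = (a * b + b * A x) + (a * B x + A x * B x) := fun x => by ring
  have h1 : Integrable (fun x => a * b + b * A x) μ := (integrable_const _).add (hA1.const_mul _)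
  have h2 : Integrable (fun x => a * B x + A x * B x) μ := (hB1.const_mul _).add hAB
  have hA2 : ∫ x, b * A x ∂μ = b * ∫ x, A x ∂μ := integral_const_mul b _
  have hB2 : ∫ x, a * B x ∂μ = a * ∫ x, B x ∂μ := integral_const_mul a _
  simp_rw [e]
  rw [integral_add h1 h2, integral_add (integrable_const _) (hA1.const_mul _),
    integral_add (hB1.const_mul _) hAB, hA2, hB2, integral_const, probReal_univ, one_smul]
  ring

-- Everything is transported to the Gaussian model (σ a, τ (c a + t b)). Homogeneity turns each
-- logarithm into a constant plus log|Q| of a standard vector, and Mehler's formula evaluates the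
-- mixed moment.
omit [IsProbabilityMeasure P] in
theorem moments_log_norm_eval (hQ : Q.IsHomogeneous d) (hQ0 : Q ≠ 0)
    (hf : ∀ i, IsGAF P Ω (f i)) (hcov : ∀ i, IsCovarianceKernel P Ω (f i) K)
    (hind : iIndepFun (fun (i : Fin k) (s : S) (z : Ω) => f i s z) P) (hK : ∀ z ∈ Ω, K z z ≠ 0)
    (i₀ : Fin k) {z w : ℂ} (hz : z ∈ Ω) (hw : w ∈ Ω) :
    (∀ᵐ s ∂P, MvPolynomial.eval (fun i => f i s z) Q ≠ 0) ∧
    MemLp (fun s => Real.log ‖MvPolynomial.eval (fun i => f i s z) Q‖) 2 P ∧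
    ∫ s, Real.log ‖MvPolynomial.eval (fun i => f i s z) Q‖ ∂P = meanLogAt d Q K z ∧
    ∫ s, Real.log ‖MvPolynomial.eval (fun i => f i s z) Q‖ *
      Real.log ‖MvPolynomial.eval (fun i => f i s w) Q‖ ∂P = meanLogMulLog d Q K (z, w) := by
  have hrz := (hf i₀).re_kernel_self_pos (hcov i₀) hz (hK z hz)
  have hrw := (hf i₀).re_kernel_self_pos (hcov i₀) hw (hK w hw)
  set σ := Real.sqrt (K z z).re with hσ
  set τ := Real.sqrt (K w w).re with hτ
  have hσ0 : 0 < σ := Real.sqrt_pos.mpr hrz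
  have hτ0 : 0 < τ := Real.sqrt_pos.mpr hrw
  have hσ2 : σ ^ 2 = (K z z).re := Real.sq_sqrt hrz.le
  have hτ2 : τ ^ 2 = (K w w).re := Real.sq_sqrt hrw.le
  have hlogσ : (d : ℝ) * Real.log σ = d / 2 * Real.log (K z z).re := by
    rw [hσ, Real.log_sqrt hrz.le]; ring
  have hlogτ : (d : ℝ) * Real.log τ = d / 2 * Real.log (K w w).re := by
    rw [hτ, Real.log_sqrt hrw.le]; ring
  -- The conjugate appears because E[f(z) conj f(w)] pairs σ a with the conjugate of τ (c a + t b).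
  set c : ℂ := conj (K z w) / (σ * τ) with hc
  have hcn : ‖c‖ ^ 2 = overlap K (z, w) := by
    rw [hc, norm_div, norm_mul, Complex.norm_real, Complex.norm_real, RCLike.norm_conj, div_pow,
      Real.norm_of_nonneg hσ0.le, Real.norm_of_nonneg hτ0.le, mul_pow, hσ2, hτ2, overlap]
  have hc1 : overlap K (z, w) ≤ 1 := by
    rw [overlap]
    exact div_le_one_of_le₀ ((hf i₀).norm_kernel_sq_le (hcov i₀) hz hw) (by positivity)
  set t := Real.sqrt (1 - overlap K (z, w)) with ht
  have ht2 : ‖c‖ ^ 2 + t ^ 2 = 1 := by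
    rw [hcn, ht, Real.sq_sqrt (by linarith)]; ring
  have ht3 : ‖c‖ ^ 2 + ‖(t : ℂ)‖ ^ 2 = 1 := by
    rw [Complex.norm_real, Real.norm_eq_abs, sq_abs]; exact ht2
  have hlaw := map_pairs hf hcov hind hz hw (σ := σ) (τ := τ) (c := c) (t := t)
    (by rw [(hf i₀).kernel_self_eq_re (hcov i₀) hz, ← hσ2]; push_cast; rfl)
    (by rw [(hf i₀).kernel_self_eq_re (hcov i₀) hw, ← hτ2]; push_cast; rfl)
    (by
      rw [hc, map_div₀, Complex.conj_conj, map_mul, Complex.conj_ofReal, Complex.conj_ofReal]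
      have : (σ : ℂ) ≠ 0 := by exact_mod_cast hσ0.ne'
      have : (τ : ℂ) ≠ 0 := by exact_mod_cast hτ0.ne'
      field_simp) ht2
  have hmf : Measurable fun s i => ![f i s z, f i s w] := by
    refine measurable_pi_lambda _ fun i => measurable_pi_lambda _ fun j => ?_
    fin_cases j
    · exact (hf i).measurable z hz
    · exact (hf i).measurable w hw
  have hmx : Measurable fun (x : Fin k → Fin 2 → ℂ) i =>
      ![(σ : ℂ) * x i 0, (τ : ℂ) * (c * x i 0 + t * x i 1)] := by
    refine measurable_pi_lambda _ fun i => measurable_pi_lambda _ fun j => ?_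
    fin_cases j
    · exact (by fun_prop : Measurable fun x : Fin k → Fin 2 → ℂ => (σ : ℂ) * x i 0)
    · exact (by fun_prop : Measurable fun x : Fin k → Fin 2 → ℂ => (τ : ℂ) * (c * x i 0 + t * x i 1))
  set L : (Fin k → ℂ) → ℝ := fun a => Real.log ‖MvPolynomial.eval a Q‖ with hL
  have hLm : Measurable L := measurable_log_norm_eval Q
  have hL2 : MemLp L 2 (stdGaussianVector k) := memLp_log_norm_eval hQ0
  have hp0 := measurePreserving_fst k
  have hp1 := measurePreserving_correlate k ht3
  set M₀ : (Fin k → Fin 2 → ℂ) → ℝ := fun y => L fun i => y i 0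
  set M₁ : (Fin k → Fin 2 → ℂ) → ℝ := fun y => L fun i => y i 1
  have hM₀ : Measurable M₀ := hLm.comp (by fun_prop)
  have hM₁ : Measurable M₁ := hLm.comp (by fun_prop)
  set A : (Fin k → Fin 2 → ℂ) → ℝ := fun x => L fun i => x i 0
  set B : (Fin k → Fin 2 → ℂ) → ℝ := fun x => L fun i => c * x i 0 + t * x i 1
  have hA2 : MemLp A 2 (gaussianPairs k) := hL2.comp_measurePreserving hp0
  have hB2 : MemLp B 2 (gaussianPairs k) := hL2.comp_measurePreserving hp1
  have hA0 : ∀ᵐ x ∂gaussianPairs k, MvPolynomial.eval (fun i => x i 0) Q ≠ 0 :=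
    hp0.quasiMeasurePreserving.ae (ae_eval_ne_zero hQ0)
  have hB0 : ∀ᵐ x ∂gaussianPairs k, MvPolynomial.eval (fun i => c * x i 0 + t * x i 1) Q ≠ 0 :=
    hp1.quasiMeasurePreserving.ae (ae_eval_ne_zero hQ0)
  set T : (Fin k → Fin 2 → ℂ) → (Fin k → Fin 2 → ℂ) := fun x i =>
      ![(σ : ℂ) * x i 0, (τ : ℂ) * (c * x i 0 + t * x i 1)]
  have hAe : (fun x => M₀ (T x)) =ᵐ[gaussianPairs k] fun x => d * Real.log σ + A x := by
    filter_upwards [hA0] with x hx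
    exact log_norm_eval_smul hQ hσ0 hx
  have hBe : (fun x => M₁ (T x)) =ᵐ[gaussianPairs k] fun x => d * Real.log τ + B x := by
    filter_upwards [hB0] with x hx
    exact log_norm_eval_smul hQ hτ0 hx
  have hAi : ∫ x, A x ∂gaussianPairs k = meanLog Q := by
    rw [meanLog, ← hp0.map_eq, integral_map hp0.measurable.aemeasurable hLm.aestronglyMeasurable]
  have hBi : ∫ x, B x ∂gaussianPairs k = meanLog Q := by
    rw [meanLog, ← hp1.map_eq, integral_map hp1.measurable.aemeasurable hLm.aestronglyMeasurable]
  have hAB : ∑' p, wickWeight Q p * overlap K (z, w) ^ p = ∫ x, A x * B x ∂gaussianPairs k := by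
    rw [← hcn]
    exact (hasSum_wickWeight_mul_pow hQ hL2 ht3).tsum_eq
  clear_value A B
  have hAint := hA2.integrable (by norm_num)
  have hBint := hB2.integrable (by norm_num)
  refine ⟨?_, ?_, ?_, ?_⟩
  · have h1 : ∀ᵐ y ∂(P.map fun s i => ![f i s z, f i s w]), MvPolynomial.eval (fun i => y i 0) Q ≠ 0 := by
      rw [hlaw]
      have hms : MeasurableSet {y : Fin k → Fin 2 → ℂ | MvPolynomial.eval (fun i => y i 0) Q ≠ 0} := by
        refine (isClosed_eq ?_ continuous_const).measurableSet.compl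
        exact (continuous_eval Q).comp (by fun_prop)
      rw [ae_map_iff hmx.aemeasurable hms]
      filter_upwards [hA0] with x hx
      have : MvPolynomial.eval (fun i => (σ : ℂ) * x i 0) Q ≠ 0 := by
        rw [eval_smul_of_isHomogeneous hQ]
        have : (σ : ℂ) ≠ 0 := by exact_mod_cast hσ0.ne'
        exact mul_ne_zero (pow_ne_zero _ this) hx
      exact this
    have h2 := ae_of_ae_map hmf.aemeasurable h1
    exact h2
  · have h1 : MemLp M₀ 2 (P.map fun s i => ![f i s z, f i s w]) := by
      rw [hlaw, memLp_map_measure_iff hM₀.aestronglyMeasurable hmx.aemeasurable]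
      have h3 : MemLp (fun x => d * Real.log σ + A x) 2 (gaussianPairs k) := memLp_const_add hA2 _
      exact (memLp_congr_ae hAe).mpr h3
    rw [memLp_map_measure_iff hM₀.aestronglyMeasurable hmf.aemeasurable] at h1
    exact h1
  · have h1 : ∫ y, M₀ y ∂(P.map fun s i => ![f i s z, f i s w])
        = ∫ s, Real.log ‖MvPolynomial.eval (fun i => f i s z) Q‖ ∂P :=
      integral_map hmf.aemeasurable hM₀.aestronglyMeasurable
    rw [← h1, hlaw, integral_map hmx.aemeasurable hM₀.aestronglyMeasurable, integral_congr_ae hAe,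
      integral_add (integrable_const _) hAint, hAi, integral_const, probReal_univ, one_smul, hlogσ, meanLogAt]
  · have h1 : ∫ y, M₀ y * M₁ y ∂(P.map fun s i => ![f i s z, f i s w])
        = ∫ s, Real.log ‖MvPolynomial.eval (fun i => f i s z) Q‖ *
            Real.log ‖MvPolynomial.eval (fun i => f i s w) Q‖ ∂P :=
      integral_map hmf.aemeasurable (hM₀.mul hM₁).aestronglyMeasurable
    have hpt : (fun x => M₀ (T x) * M₁ (T x)) =ᵐ[gaussianPairs k] fun x =>
        (d * Real.log σ + A x) * (d * Real.log τ + B x) := by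
      filter_upwards [hAe, hBe] with x h1 h2
      rw [h1, h2]
    have h2 : ∫ y, M₀ y * M₁ y ∂((gaussianPairs k).map T) = ∫ x, M₀ (T x) * M₁ (T x) ∂gaussianPairs k :=
      integral_map hmx.aemeasurable (hM₀.mul hM₁).aestronglyMeasurable
    rw [← h1, hlaw, h2, integral_congr_ae hpt]
    -- With m = `meanLog Q`, αβ + αm + βm = (α + m)(β + m) - m²; hence the subtracted square in
    -- `meanLogMulLog`.
    rw [integral_const_add_mul_const_add hA2 hB2, hAi, hBi, ← hAB, hlogσ, hlogτ, meanLogMulLog,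
      meanLogAt, meanLogAt]
    ring

end Vector

/-! ### Random subharmonic potentials -/

/-- `(2π)⁻¹ Δ (ℓ s) = X s` almost surely, in the sense of distributions on `Ω`, where `ℓ` is a
random function with mean `g` and second moments `H`. -/
structure IsRandomPotential {S : Type*} [MeasurableSpace S] (P : Measure S) (Ω : Set ℂ)
    (X : S → Measure ℂ) (ℓ : S → ℂ → ℝ) (g : ℂ → ℝ) (H : ℂ × ℂ → ℝ) : Prop where
  measurable : Measurable (Function.uncurry ℓ)
  memLp : ∀ z ∈ Ω, MemLp (fun s => ℓ s z) 2 P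
  mean : ∀ z ∈ Ω, ∫ s, ℓ s z ∂P = g z
  mean_mul : ∀ z ∈ Ω, ∀ w ∈ Ω, ∫ s, ℓ s z * ℓ s w ∂P = H (z, w)
  continuousOn_diag : ContinuousOn (fun z => H (z, z)) Ω
  null_compl : ∀ s, X s Ωᶜ = 0
  laplacian : ∀ᵐ s ∂P, ∀ φ : ℂ → ℝ, ContDiff ℝ 2 φ → HasCompactSupport φ → tsupport φ ⊆ Ω →
    (∀ z, 0 ≤ φ z) → 0 ≤ ∫ z, ℓ s z * Laplacian.laplacian φ z ∧
      ∫⁻ z, ENNReal.ofReal (φ z) ∂X s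
        = ENNReal.ofReal ((2 * Real.pi)⁻¹ * ∫ z, ℓ s z * Laplacian.laplacian φ z)

section Potential

variable {S : Type*} [MeasurableSpace S] {P : Measure S} [IsProbabilityMeasure P] {Ω : Set ℂ}
  {X : S → Measure ℂ} {ℓ : S → ℂ → ℝ} {g : ℂ → ℝ} {H : ℂ × ℂ → ℝ}

namespace IsRandomPotential

/-- Fubini, using |ℓ| ≤ 1 + ℓ² and the continuity of the second moment on the diagonal. -/
theorem integrable_fst (h : IsRandomPotential P Ω X ℓ g H) (hΩ : IsOpen Ω) {ψ : ℂ → ℝ}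
    (hψ : Continuous ψ) (hc : HasCompactSupport ψ) (hsub : tsupport ψ ⊆ Ω) :
    Integrable (fun q : S × ℂ => ℓ q.1 q.2 * ψ q.2) (P.prod volume) := by
  have hm : Measurable fun q : S × ℂ => ℓ q.1 q.2 * ψ q.2 :=
    h.measurable.mul (hψ.measurable.comp measurable_snd)
  have hint : ∀ z, Integrable (fun s => ℓ s z * ψ z) P := by
    intro z
    by_cases hz : z ∈ tsupport ψ
    · exact ((h.memLp z (hsub hz)).integrable (by norm_num)).mul_const _
    · simp [image_eq_zero_of_notMem_tsupport hz]
  rw [integrable_prod_iff' hm.aestronglyMeasurable]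
  refine ⟨Filter.Eventually.of_forall hint, ?_⟩
  have hb : Integrable (fun z => (1 + H (z, z)) * |ψ z|) :=
    integrable_mul_of_tsupport_subset hΩ (continuousOn_const.add h.continuousOn_diag) hψ.abs
      hc.norm ((closure_mono fun z hz => by simpa using hz).trans hsub)
  refine hb.mono' hm.aestronglyMeasurable.norm.prod_swap.integral_prod_right' (Filter.Eventually.of_forall fun z => ?_)
  rw [Real.norm_of_nonneg (integral_nonneg fun s => norm_nonneg _)]
  by_cases hz : z ∈ tsupport ψ
  · have hL := h.memLp z (hsub hz)
    have hLL : Integrable (fun s => ℓ s z * ℓ s z) P := hL.integrable_mul hL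
    have hsq : Integrable (fun s => 1 + ℓ s z * ℓ s z) P := (integrable_const _).add hLL
    calc ∫ s, ‖ℓ s z * ψ z‖ ∂P ≤ ∫ s, (1 + ℓ s z * ℓ s z) * |ψ z| ∂P := by
          refine integral_mono (hint z).norm (hsq.mul_const _) fun s => ?_
          simp only [norm_mul, Real.norm_eq_abs]
          gcongr
          nlinarith [sq_abs (ℓ s z), sq_nonneg (|ℓ s z| - 1), abs_nonneg (ℓ s z)]
      _ = (1 + H (z, z)) * |ψ z| := by
          rw [integral_mul_const, integral_add (integrable_const _) hLL,
            h.mean_mul z (hsub hz) z (hsub hz)]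
          simp
  · simp [image_eq_zero_of_notMem_tsupport hz]

theorem integrable_integral_mul (h : IsRandomPotential P Ω X ℓ g H) (hΩ : IsOpen Ω) {ψ : ℂ → ℝ}
    (hψ : Continuous ψ) (hc : HasCompactSupport ψ) (hsub : tsupport ψ ⊆ Ω) :
    Integrable (fun s => ∫ z, ℓ s z * ψ z) P :=
  (h.integrable_fst hΩ hψ hc hsub).integral_prod_left

theorem integral_integral_mul (h : IsRandomPotential P Ω X ℓ g H) (hΩ : IsOpen Ω) {ψ : ℂ → ℝ}
    (hψ : Continuous ψ) (hc : HasCompactSupport ψ) (hsub : tsupport ψ ⊆ Ω) :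
    ∫ s, (∫ z, ℓ s z * ψ z) ∂P = ∫ z, g z * ψ z := by
  rw [integral_integral_swap (h.integrable_fst hΩ hψ hc hsub)]
  refine integral_congr_ae (Filter.Eventually.of_forall fun z => ?_)
  simp only
  by_cases hz : z ∈ tsupport ψ
  · rw [integral_mul_const, h.mean z (hsub hz)]
  · simp [image_eq_zero_of_notMem_tsupport hz]

/-- |ℓ(z) ℓ(w)| ≤ ℓ(z)² + ℓ(w)², so continuity of H on the diagonal suffices; no regularity of H
elsewhere is used. -/
theorem integrable_snd (h : IsRandomPotential P Ω X ℓ g H) (hΩ : IsOpen Ω) {ψ χ : ℂ → ℝ}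
    (hψ : Continuous ψ) (hψc : HasCompactSupport ψ) (hψs : tsupport ψ ⊆ Ω)
    (hχ : Continuous χ) (hχc : HasCompactSupport χ) (hχs : tsupport χ ⊆ Ω) :
    Integrable (fun q : S × (ℂ × ℂ) => (ℓ q.1 q.2.1 * ψ q.2.1) * (ℓ q.1 q.2.2 * χ q.2.2))
      (P.prod (volume : Measure (ℂ × ℂ))) := by
  have hm : Measurable fun q : S × (ℂ × ℂ) => (ℓ q.1 q.2.1 * ψ q.2.1) * (ℓ q.1 q.2.2 * χ q.2.2) := by
    have h1 : Measurable fun q : S × (ℂ × ℂ) => ℓ q.1 q.2.1 :=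
      h.measurable.comp (measurable_fst.prodMk (measurable_fst.comp measurable_snd))
    have h2 : Measurable fun q : S × (ℂ × ℂ) => ℓ q.1 q.2.2 :=
      h.measurable.comp (measurable_fst.prodMk (measurable_snd.comp measurable_snd))
    exact (h1.mul (hψ.measurable.comp (measurable_fst.comp measurable_snd))).mul
      (h2.mul (hχ.measurable.comp (measurable_snd.comp measurable_snd)))
  have hint : ∀ q : ℂ × ℂ, Integrable (fun s => (ℓ s q.1 * ψ q.1) * (ℓ s q.2 * χ q.2)) P := by
    intro q
    by_cases hz : q.1 ∈ tsupport ψ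
    · by_cases hw : q.2 ∈ tsupport χ
      · have := ((h.memLp _ (hψs hz)).integrable_mul (h.memLp _ (hχs hw))).mul_const (ψ q.1 * χ q.2)
        refine this.congr (Filter.Eventually.of_forall fun s => ?_)
        simp only [Pi.mul_apply]
        ring
      · simp [image_eq_zero_of_notMem_tsupport hw]
    · simp [image_eq_zero_of_notMem_tsupport hz]
  rw [integrable_prod_iff' hm.aestronglyMeasurable]
  refine ⟨Filter.Eventually.of_forall hint, ?_⟩
  have habs : ∀ {η : ℂ → ℝ}, tsupport η ⊆ Ω → tsupport (fun z => |η z|) ⊆ Ω := fun hη =>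
    (closure_mono fun z hz => by simpa using hz).trans hη
  have i1 : Integrable (fun z => H (z, z) * |ψ z|) :=
    integrable_mul_of_tsupport_subset hΩ h.continuousOn_diag hψ.abs hψc.norm (habs hψs)
  have i2 : Integrable (fun z => H (z, z) * |χ z|) :=
    integrable_mul_of_tsupport_subset hΩ h.continuousOn_diag hχ.abs hχc.norm (habs hχs)
  have i3 : Integrable (fun z => |ψ z|) := hψ.abs.integrable_of_hasCompactSupport hψc.norm
  have i4 : Integrable (fun z => |χ z|) := hχ.abs.integrable_of_hasCompactSupport hχc.norm
  have hb : Integrable (fun q : ℂ × ℂ => (H (q.1, q.1) * |ψ q.1|) * |χ q.2|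
      + |ψ q.1| * (H (q.2, q.2) * |χ q.2|)) := (i1.mul_prod i4).add (i3.mul_prod i2)
  refine hb.mono' hm.aestronglyMeasurable.norm.prod_swap.integral_prod_right' (Filter.Eventually.of_forall fun q => ?_)
  rw [Real.norm_of_nonneg (integral_nonneg fun s => norm_nonneg _)]
  by_cases hz : q.1 ∈ tsupport ψ
  · by_cases hw : q.2 ∈ tsupport χ
    · have L1 := h.memLp _ (hψs hz)
      have L2 := h.memLp _ (hχs hw)
      have j1 : Integrable (fun s => ℓ s q.1 * ℓ s q.1) P := L1.integrable_mul L1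
      have j2 : Integrable (fun s => ℓ s q.2 * ℓ s q.2) P := L2.integrable_mul L2
      calc ∫ s, ‖(ℓ s q.1 * ψ q.1) * (ℓ s q.2 * χ q.2)‖ ∂P
          ≤ ∫ s, (ℓ s q.1 * ℓ s q.1 + ℓ s q.2 * ℓ s q.2) * (|ψ q.1| * |χ q.2|) ∂P := by
            refine integral_mono (hint q).norm ((j1.add j2).mul_const _) fun s => ?_
            simp only [norm_mul, Real.norm_eq_abs]
            have : |ℓ s q.1| * |ℓ s q.2| ≤ ℓ s q.1 * ℓ s q.1 + ℓ s q.2 * ℓ s q.2 := by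
              nlinarith [sq_abs (ℓ s q.1), sq_abs (ℓ s q.2), sq_nonneg (|ℓ s q.1| - |ℓ s q.2|),
                sq_nonneg (ℓ s q.1), sq_nonneg (ℓ s q.2)]
            calc _ = (|ℓ s q.1| * |ℓ s q.2|) * (|ψ q.1| * |χ q.2|) := by ring
              _ ≤ _ := by gcongr
        _ = _ := by
            rw [integral_mul_const, integral_add j1 j2, h.mean_mul _ (hψs hz) _ (hψs hz),
              h.mean_mul _ (hχs hw) _ (hχs hw)]
            ring
    · simp [image_eq_zero_of_notMem_tsupport hw]
  · simp [image_eq_zero_of_notMem_tsupport hz]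

omit [MeasurableSpace S] in
theorem integral_prod_factor (ψ χ : ℂ → ℝ) (s : S) :
    ∫ q : ℂ × ℂ, (ℓ s q.1 * ψ q.1) * (ℓ s q.2 * χ q.2)
      = (∫ z, ℓ s z * ψ z) * ∫ w, ℓ s w * χ w :=
  integral_prod_mul (fun z => ℓ s z * ψ z) fun w => ℓ s w * χ w

theorem integrable_integral_mul_integral (h : IsRandomPotential P Ω X ℓ g H) (hΩ : IsOpen Ω)
    {ψ χ : ℂ → ℝ} (hψ : Continuous ψ) (hψc : HasCompactSupport ψ) (hψs : tsupport ψ ⊆ Ω)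
    (hχ : Continuous χ) (hχc : HasCompactSupport χ) (hχs : tsupport χ ⊆ Ω) :
    Integrable (fun s => (∫ z, ℓ s z * ψ z) * ∫ w, ℓ s w * χ w) P := by
  simp_rw [← integral_prod_factor]
  exact (h.integrable_snd hΩ hψ hψc hψs hχ hχc hχs).integral_prod_left

theorem integral_integral_mul_integral (h : IsRandomPotential P Ω X ℓ g H) (hΩ : IsOpen Ω)
    {ψ χ : ℂ → ℝ} (hψ : Continuous ψ) (hψc : HasCompactSupport ψ) (hψs : tsupport ψ ⊆ Ω)
    (hχ : Continuous χ) (hχc : HasCompactSupport χ) (hχs : tsupport χ ⊆ Ω) :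
    ∫ s, (∫ z, ℓ s z * ψ z) * (∫ w, ℓ s w * χ w) ∂P
      = ∫ q : ℂ × ℂ, H q * (ψ q.1 * χ q.2) := by
  simp_rw [← integral_prod_factor]
  rw [integral_integral_swap (h.integrable_snd hΩ hψ hψc hψs hχ hχc hχs)]
  refine integral_congr_ae (Filter.Eventually.of_forall fun q => ?_)
  simp only
  by_cases hz : q.1 ∈ tsupport ψ
  · by_cases hw : q.2 ∈ tsupport χ
    · have e : ∀ s, (ℓ s q.1 * ψ q.1) * (ℓ s q.2 * χ q.2) = (ℓ s q.1 * ℓ s q.2) * (ψ q.1 * χ q.2) :=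
        fun s => by ring
      simp_rw [e]
      rw [integral_mul_const, h.mean_mul _ (hψs hz) _ (hχs hw)]
    · simp [image_eq_zero_of_notMem_tsupport hw]
  · simp [image_eq_zero_of_notMem_tsupport hz]

theorem lintegral_lintegral (h : IsRandomPotential P Ω X ℓ g H) (hΩ : IsOpen Ω) {φ : ℂ → ℝ}
    (hφ : ContDiff ℝ 2 φ) (hc : HasCompactSupport φ) (hsub : tsupport φ ⊆ Ω) (h0 : ∀ z, 0 ≤ φ z) :
    AEMeasurable (fun s => ∫⁻ z, ENNReal.ofReal (φ z) ∂X s) P ∧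
    0 ≤ ∫ z, g z * Laplacian.laplacian φ z ∧
    ∫⁻ s, ∫⁻ z, ENNReal.ofReal (φ z) ∂X s ∂P
      = ENNReal.ofReal ((2 * Real.pi)⁻¹ * ∫ z, g z * Laplacian.laplacian φ z) := by
  have hψ := continuous_laplacian hφ
  have hψc := hasCompactSupport_laplacian hc
  have hψs := (tsupport_laplacian_subset φ).trans hsub
  have hae : (fun s => ∫⁻ z, ENNReal.ofReal (φ z) ∂X s) =ᵐ[P]
      fun s => ENNReal.ofReal ((2 * Real.pi)⁻¹ * ∫ z, ℓ s z * Laplacian.laplacian φ z) := by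
    filter_upwards [h.laplacian] with s hs using (hs φ hφ hc hsub h0).2
  have hpos : 0 ≤ᵐ[P] fun s => ∫ z, ℓ s z * Laplacian.laplacian φ z := by
    filter_upwards [h.laplacian] with s hs using (hs φ hφ hc hsub h0).1
  have hi := h.integrable_integral_mul hΩ hψ hψc hψs
  have hpi : (0 : ℝ) ≤ (2 * Real.pi)⁻¹ := by positivity
  refine ⟨(hi.aemeasurable.const_mul _).ennreal_ofReal.congr hae.symm, ?_, ?_⟩
  · rw [← h.integral_integral_mul hΩ hψ hψc hψs]
    exact integral_nonneg_of_ae hpos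
  · rw [lintegral_congr_ae hae, ← ofReal_integral_eq_lintegral_ofReal (hi.const_mul _),
      integral_const_mul, h.integral_integral_mul hΩ hψ hψc hψs]
    filter_upwards [hpos] with s hs using mul_nonneg hpi hs

/-- The product of two linear statistics is a double integral of ℓ(z) ℓ(w) against the two
Laplacians, whose mean is an integral of H. -/
theorem lintegral_lintegral_mul_lintegral (h : IsRandomPotential P Ω X ℓ g H) (hΩ : IsOpen Ω)
    {φ η : ℂ → ℝ} (hφ : ContDiff ℝ 2 φ) (hφc : HasCompactSupport φ) (hφs : tsupport φ ⊆ Ω)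
    (hφ0 : ∀ z, 0 ≤ φ z) (hη : ContDiff ℝ 2 η) (hηc : HasCompactSupport η) (hηs : tsupport η ⊆ Ω)
    (hη0 : ∀ z, 0 ≤ η z) :
    0 ≤ ∫ q : ℂ × ℂ, H q * (Laplacian.laplacian φ q.1 * Laplacian.laplacian η q.2) ∧
    ∫⁻ s, (∫⁻ z, ENNReal.ofReal (φ z) ∂X s) * (∫⁻ w, ENNReal.ofReal (η w) ∂X s) ∂P
      = ENNReal.ofReal ((2 * Real.pi)⁻¹ ^ 2 *
          ∫ q : ℂ × ℂ, H q * (Laplacian.laplacian φ q.1 * Laplacian.laplacian η q.2)) := by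
  have hψ := continuous_laplacian hφ
  have hψc := hasCompactSupport_laplacian hφc
  have hψs := (tsupport_laplacian_subset φ).trans hφs
  have hχ := continuous_laplacian hη
  have hχc := hasCompactSupport_laplacian hηc
  have hχs := (tsupport_laplacian_subset η).trans hηs
  have hpi : (0 : ℝ) ≤ (2 * Real.pi)⁻¹ := by positivity
  have hpos : 0 ≤ᵐ[P] fun s => (∫ z, ℓ s z * Laplacian.laplacian φ z) *
      ∫ z, ℓ s z * Laplacian.laplacian η z := by
    filter_upwards [h.laplacian] with s hs
    exact mul_nonneg (hs φ hφ hφc hφs hφ0).1 (hs η hη hηc hηs hη0).1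
  have hae : (fun s => (∫⁻ z, ENNReal.ofReal (φ z) ∂X s) * (∫⁻ w, ENNReal.ofReal (η w) ∂X s)) =ᵐ[P]
      fun s => ENNReal.ofReal ((2 * Real.pi)⁻¹ ^ 2 * ((∫ z, ℓ s z * Laplacian.laplacian φ z) *
        ∫ z, ℓ s z * Laplacian.laplacian η z)) := by
    filter_upwards [h.laplacian] with s hs
    rw [(hs φ hφ hφc hφs hφ0).2, (hs η hη hηc hηs hη0).2, ← ENNReal.ofReal_mul
      (mul_nonneg hpi (hs φ hφ hφc hφs hφ0).1)]
    congr 1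
    ring
  have hi := h.integrable_integral_mul_integral hΩ hψ hψc hψs hχ hχc hχs
  rw [← h.integral_integral_mul_integral hΩ hψ hψc hψs hχ hχc hχs]
  refine ⟨integral_nonneg_of_ae hpos, ?_⟩
  rw [lintegral_congr_ae hae, ← ofReal_integral_eq_lintegral_ofReal (hi.const_mul _),
      integral_const_mul]
  filter_upwards [hpos] with s hs using mul_nonneg (by positivity) hs

end IsRandomPotential

end Potential

/-! ### Partial Laplacians -/

section PartialLaplacian

variable {E : Type*} [NormedAddCommGroup E] [NormedSpace ℝ E]

/-- `∂_a² + ∂_b²`. -/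
noncomputable def planeLaplacian (a b : E) (G : E → ℝ) (q : E) : ℝ :=
  dirDeriv a (dirDeriv a G) q + dirDeriv b (dirDeriv b G) q

theorem contDiffOn_planeLaplacian {n m : WithTop ℕ∞} {V : Set E} (hV : IsOpen V) {G : E → ℝ}
    (hG : ContDiffOn ℝ n G V) (hmn : m + 1 + 1 ≤ n) (a b : E) :
    ContDiffOn ℝ m (planeLaplacian a b G) V :=
  (contDiffOn_dirDeriv hV (contDiffOn_dirDeriv hV hG hmn a) le_rfl a).add
    (contDiffOn_dirDeriv hV (contDiffOn_dirDeriv hV hG hmn b) le_rfl b)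

theorem tsupport_planeLaplacian_subset (a b : E) (G : E → ℝ) :
    tsupport (planeLaplacian a b G) ⊆ tsupport G := by
  have h : ∀ v, tsupport (dirDeriv v (dirDeriv v G)) ⊆ tsupport G := fun v =>
    (tsupport_dirDeriv_subset v _).trans (tsupport_dirDeriv_subset v G)
  exact (tsupport_add _ _).trans (Set.union_subset (h a) (h b))

theorem dirDeriv_congr {f g : E → ℝ} {x : E} (h : f =ᶠ[nhds x] g) (v : E) :
    dirDeriv v f =ᶠ[nhds x] dirDeriv v g := by
  filter_upwards [h.fderiv (𝕜 := ℝ)] with y hy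
  rw [dirDeriv, dirDeriv, hy]

theorem planeLaplacian_congr {f g : E → ℝ} {x : E} (h : f =ᶠ[nhds x] g) (a b : E) :
    planeLaplacian a b f x = planeLaplacian a b g x := by
  rw [planeLaplacian, planeLaplacian, (dirDeriv_congr (dirDeriv_congr h a) a).eq_of_nhds,
    (dirDeriv_congr (dirDeriv_congr h b) b).eq_of_nhds]

variable [MeasurableSpace E] [BorelSpace E] [FiniteDimensional ℝ E] (μ : Measure E) [μ.IsAddHaarMeasure]

theorem integral_mul_planeLaplacian {V : Set E} (hV : IsOpen V) {u φ : E → ℝ}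
    (hu : ContDiffOn ℝ 2 u V) (hφ : ContDiff ℝ 2 φ) (hc : HasCompactSupport φ) (hsub : tsupport φ ⊆ V)
    (a b : E) : ∫ q, u q * planeLaplacian a b φ q ∂μ = ∫ q, planeLaplacian a b u q * φ q ∂μ := by
  have hφ' := contDiffOn_univ.mpr hφ
  have i1 : ∀ v, Integrable (fun z => u z * dirDeriv v (dirDeriv v φ) z) μ := by
    intro v
    have s : tsupport (dirDeriv v (dirDeriv v φ)) ⊆ tsupport φ :=
      (tsupport_dirDeriv_subset v _).trans (tsupport_dirDeriv_subset v φ)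
    refine integrable_mul_of_tsupport_subset hV hu.continuousOn ?_
      (hc.of_isClosed_subset (isClosed_tsupport _) s) (s.trans hsub)
    exact continuousOn_univ.mp (contDiffOn_dirDeriv (m := 0) isOpen_univ
      (contDiffOn_dirDeriv (m := 1) isOpen_univ hφ' (by norm_num) v) (by norm_num) v).continuousOn
  have i2 : ∀ v, Integrable (fun z => dirDeriv v (dirDeriv v u) z * φ z) μ := fun v =>
    integrable_mul_of_tsupport_subset hV (contDiffOn_dirDeriv (m := 0) hV
      (contDiffOn_dirDeriv (m := 1) hV hu (by norm_num) v) (by norm_num) v).continuousOn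
      hφ.continuous hc hsub
  simp only [planeLaplacian, mul_add, add_mul]
  rw [integral_add (i1 _) (i1 _), integral_add (i2 _) (i2 _),
    integral_mul_dirDeriv_dirDeriv μ hV hu hφ hc hsub, integral_mul_dirDeriv_dirDeriv μ hV hu hφ hc hsub]

end PartialLaplacian

/-- The Laplacian in the first variable. -/
noncomputable def laplacianFst : (ℂ × ℂ → ℝ) → ℂ × ℂ → ℝ := planeLaplacian (1, 0) (Complex.I, 0)

/-- The Laplacian in the second variable. -/
noncomputable def laplacianSnd : (ℂ × ℂ → ℝ) → ℂ × ℂ → ℝ := planeLaplacian (0, 1) (0, Complex.I)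

theorem dirDeriv_slice_fst {G : ℂ × ℂ → ℝ} {z w : ℂ} (hG : DifferentiableAt ℝ G (z, w)) (v : ℂ) :
    dirDeriv v (fun u => G (u, w)) z = dirDeriv (v, 0) G (z, w) := by
  have h := hG.hasFDerivAt.comp z (hasFDerivAt_prodMk_left (𝕜 := ℝ) z w)
  rw [dirDeriv, dirDeriv]
  rw [show (fun u => G (u, w)) = G ∘ fun u => (u, w) from rfl, h.fderiv]
  simp

theorem dirDeriv_slice_snd {G : ℂ × ℂ → ℝ} {z w : ℂ} (hG : DifferentiableAt ℝ G (z, w)) (v : ℂ) :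
    dirDeriv v (fun u => G (z, u)) w = dirDeriv (0, v) G (z, w) := by
  have h := hG.hasFDerivAt.comp w (hasFDerivAt_prodMk_right (𝕜 := ℝ) z w)
  rw [dirDeriv, dirDeriv]
  rw [show (fun u => G (z, u)) = G ∘ fun u => (z, u) from rfl, h.fderiv]
  simp

section Slice

variable {U : Set (ℂ × ℂ)} {G : ℂ × ℂ → ℝ}

theorem laplacian_slice_fst (hU : IsOpen U) (hG : ContDiffOn ℝ 2 G U) {z w : ℂ} (hq : (z, w) ∈ U) :
    Laplacian.laplacian (fun u => G (u, w)) z = laplacianFst G (z, w) := by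
  have hc : Continuous fun u : ℂ => (u, w) := by fun_prop
  have hV : IsOpen ((fun u : ℂ => (u, w)) ⁻¹' U) := hU.preimage hc
  have hs : ContDiffOn ℝ 2 (fun u => G (u, w)) ((fun u : ℂ => (u, w)) ⁻¹' U) :=
    hG.comp (contDiff_id.prodMk contDiff_const).contDiffOn fun u hu => hu
  have h2 : ∀ v, dirDeriv v (dirDeriv v fun u => G (u, w)) z
      = dirDeriv (v, 0) (dirDeriv (v, 0) G) (z, w) := by
    intro v
    have e : dirDeriv v (fun u => G (u, w)) =ᶠ[nhds z] fun u => dirDeriv (v, 0) G (u, w) := by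
      filter_upwards [hV.mem_nhds hq] with u hu
      exact dirDeriv_slice_fst ((hG.differentiableOn two_ne_zero).differentiableAt (hU.mem_nhds hu)) v
    rw [(dirDeriv_congr e v).eq_of_nhds]
    exact dirDeriv_slice_fst (((contDiffOn_dirDeriv (m := 1) hU hG (by norm_num) _).differentiableOn
      one_ne_zero).differentiableAt (hU.mem_nhds hq)) v
  rw [laplacian_eq_dirDeriv hV hs hq, h2, h2]
  rfl

theorem laplacian_slice_snd (hU : IsOpen U) (hG : ContDiffOn ℝ 2 G U) {z w : ℂ} (hq : (z, w) ∈ U) :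
    Laplacian.laplacian (fun u => G (z, u)) w = laplacianSnd G (z, w) := by
  have hc : Continuous fun u : ℂ => (z, u) := by fun_prop
  have hV : IsOpen ((fun u : ℂ => (z, u)) ⁻¹' U) := hU.preimage hc
  have hs : ContDiffOn ℝ 2 (fun u => G (z, u)) ((fun u : ℂ => (z, u)) ⁻¹' U) :=
    hG.comp (contDiff_const.prodMk contDiff_id).contDiffOn fun u hu => hu
  have h2 : ∀ v, dirDeriv v (dirDeriv v fun u => G (z, u)) w
      = dirDeriv (0, v) (dirDeriv (0, v) G) (z, w) := by
    intro v
    have e : dirDeriv v (fun u => G (z, u)) =ᶠ[nhds w] fun u => dirDeriv (0, v) G (z, u) := by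
      filter_upwards [hV.mem_nhds hq] with u hu
      exact dirDeriv_slice_snd ((hG.differentiableOn two_ne_zero).differentiableAt (hU.mem_nhds hu)) v
    rw [(dirDeriv_congr e v).eq_of_nhds]
    exact dirDeriv_slice_snd (((contDiffOn_dirDeriv (m := 1) hU hG (by norm_num) _).differentiableOn
      one_ne_zero).differentiableAt (hU.mem_nhds hq)) v
  rw [laplacian_eq_dirDeriv hV hs hq, h2, h2]
  rfl

theorem laplacian_laplacian_slice (hU : IsOpen U) (hG : ContDiffOn ℝ 4 G U) {z w : ℂ} (hq : (z, w) ∈ U) :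
    Laplacian.laplacian (fun u => Laplacian.laplacian (fun v => G (u, v)) w) z
      = laplacianFst (laplacianSnd G) (z, w) := by
  have hc : Continuous fun u : ℂ => (u, w) := by fun_prop
  have e : (fun u => Laplacian.laplacian (fun v => G (u, v)) w) =ᶠ[nhds z]
      fun u => laplacianSnd G (u, w) := by
    filter_upwards [(hU.preimage hc).mem_nhds hq] with u hu
    exact laplacian_slice_snd hU (hG.of_le (by norm_num)) hu
  rw [(InnerProductSpace.laplacian_congr_nhds e).eq_of_nhds]
  exact laplacian_slice_fst hU (contDiffOn_planeLaplacian (m := 2) hU hG (by norm_num) _ _) hq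

theorem laplacianFst_mul {φ : ℂ → ℝ} (hφ : ContDiff ℝ 2 φ) {η : ℂ → ℝ} (hη : ContDiff ℝ 2 η) (q : ℂ × ℂ) :
    laplacianFst (fun q => φ q.1 * η q.2) q = Laplacian.laplacian φ q.1 * η q.2 := by
  have h : ContDiff ℝ 2 fun q : ℂ × ℂ => φ q.1 * η q.2 :=
    (hφ.comp contDiff_fst).mul (hη.comp contDiff_snd)
  rw [← Prod.mk.eta (p := q), ← laplacian_slice_fst isOpen_univ (contDiffOn_univ.mpr h) (Set.mem_univ _)]
  simp only [mul_comm _ (η q.2)]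
  exact InnerProductSpace.laplacian_smul (η q.2) hφ.contDiffAt

end Slice

theorem tsupport_mul_subset_prod (φ η : ℂ → ℝ) :
    tsupport (fun q : ℂ × ℂ => φ q.1 * η q.2) ⊆ tsupport φ ×ˢ tsupport η := by
  refine closure_minimal (fun q hq => ?_) ((isClosed_tsupport φ).prod (isClosed_tsupport η))
  exact ⟨subset_tsupport _ (left_ne_zero_of_mul hq), subset_tsupport _ (right_ne_zero_of_mul hq)⟩

/-- View Δφ(z) Δη(w) as iterated partial Laplacians of one test function on the product, and move
them onto H one at a time by Green's identity in ℂ × ℂ. -/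
theorem integral_mul_laplacian_mul_laplacian {U : Set (ℂ × ℂ)} (hU : IsOpen U) {H : ℂ × ℂ → ℝ}
    (hH : ContDiffOn ℝ 4 H U) {φ η : ℂ → ℝ} (hφ : ContDiff ℝ 4 φ) (hφc : HasCompactSupport φ)
    (hη : ContDiff ℝ 4 η) (hηc : HasCompactSupport η) (hs : tsupport φ ×ˢ tsupport η ⊆ U) :
    ∫ q : ℂ × ℂ, H q * (Laplacian.laplacian φ q.1 * Laplacian.laplacian η q.2)
      = ∫ q : ℂ × ℂ, laplacianFst (laplacianSnd H) q * (φ q.1 * η q.2) := by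
  have hφ2 : ContDiff ℝ 2 φ := hφ.of_le (by norm_num)
  have hη2 : ContDiff ℝ 2 η := hη.of_le (by norm_num)
  set Φ : ℂ × ℂ → ℝ := fun q => φ q.1 * η q.2 with hΦ
  have hΦ4 : ContDiff ℝ 4 Φ := (hφ.comp contDiff_fst).mul (hη.comp contDiff_snd)
  have hΦs : tsupport Φ ⊆ tsupport φ ×ˢ tsupport η := tsupport_mul_subset_prod φ η
  have hΦc : HasCompactSupport Φ :=
    (hφc.isCompact.prod hηc.isCompact).of_isClosed_subset (isClosed_tsupport _) hΦs
  have hL : laplacianFst Φ = fun q => Laplacian.laplacian φ q.1 * η q.2 :=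
    funext fun q => laplacianFst_mul hφ2 hη2 q
  have hL2 : ContDiff ℝ 2 (laplacianFst Φ) := contDiffOn_univ.mp
    (contDiffOn_planeLaplacian (m := 2) isOpen_univ (contDiffOn_univ.mpr hΦ4) (by norm_num) _ _)
  have hLs : tsupport (laplacianFst Φ) ⊆ tsupport Φ := tsupport_planeLaplacian_subset _ _ _
  have hLc : HasCompactSupport (laplacianFst Φ) := hΦc.of_isClosed_subset (isClosed_tsupport _) hLs
  have hLL : ∀ q : ℂ × ℂ, Laplacian.laplacian φ q.1 * Laplacian.laplacian η q.2
      = laplacianSnd (laplacianFst Φ) q := by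
    intro q
    rw [← Prod.mk.eta (p := q), ← laplacian_slice_snd isOpen_univ (contDiffOn_univ.mpr hL2)
      (Set.mem_univ _), hL]
    exact (InnerProductSpace.laplacian_smul (Laplacian.laplacian φ q.1) hη2.contDiffAt).symm
  simp_rw [hLL]
  have : (volume : Measure (ℂ × ℂ)).IsAddHaarMeasure := by
    rw [Measure.volume_eq_prod]; infer_instance
  have e1 := integral_mul_planeLaplacian volume hU (hH.of_le (by norm_num)) hL2 hLc
    (hLs.trans (hΦs.trans hs)) (0, 1) (0, Complex.I)
  have e2 := integral_mul_planeLaplacian volume hU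
    (contDiffOn_planeLaplacian (m := 2) hU hH (by norm_num) (0, 1) (0, Complex.I))
    (hΦ4.of_le (by norm_num)) hΦc (hΦs.trans hs) (1, 0) (Complex.I, 0)
  exact e1.trans e2

/-! ### Intensities of random measures with a random potential -/

section Density

variable {α : Type*} [TopologicalSpace α] [T2Space α] [MeasurableSpace α] [BorelSpace α]
  {μ : Measure α} [IsFiniteMeasureOnCompacts μ] {U : Set α} {ρ : α → ℝ}

theorem lintegral_ofReal_withDensity (hU : IsOpen U) (hρ : ContinuousOn ρ U) (hρ0 : ∀ x ∈ U, 0 ≤ ρ x)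
    {φ : α → ℝ} (hφ : Continuous φ) (hc : HasCompactSupport φ) (hsub : tsupport φ ⊆ U)
    (hφ0 : ∀ x, 0 ≤ φ x) :
    ∫⁻ x, ENNReal.ofReal (φ x) ∂(μ.restrict U).withDensity (fun x => ENNReal.ofReal (ρ x))
      = ENNReal.ofReal (∫ x, ρ x * φ x ∂μ) := by
  have hm : AEMeasurable (fun x => ENNReal.ofReal (ρ x)) (μ.restrict U) :=
    (hρ.aemeasurable hU.measurableSet).ennreal_ofReal
  rw [lintegral_withDensity_eq_lintegral_mul₀ hm hφ.measurable.ennreal_ofReal.aemeasurable,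
    ← setIntegral_eq_integral_of_forall_compl_eq_zero (s := U)
      (fun x hx => by rw [image_eq_zero_of_notMem_tsupport fun h => hx (hsub h), mul_zero]),
    ofReal_integral_eq_lintegral_ofReal
      (integrable_mul_of_tsupport_subset hU hρ hφ hc hsub).integrableOn]
  · refine setLIntegral_congr_fun hU.measurableSet fun x hx => ?_
    simp only [Pi.mul_apply]
    rw [ENNReal.ofReal_mul (hρ0 x hx)]
  · filter_upwards [ae_restrict_mem hU.measurableSet] with x hx
    exact mul_nonneg (hρ0 x hx) (hφ0 x)

theorem withDensity_ne_top (hρ : ContinuousOn ρ U) {V : Set α}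
    (hVm : MeasurableSet V) (hV : IsCompact (closure V)) (hVU : closure V ⊆ U) :
    (μ.restrict U).withDensity (fun x => ENNReal.ofReal (ρ x)) V ≠ ⊤ := by
  rw [withDensity_apply _ hVm, Measure.restrict_restrict hVm,
    Set.inter_eq_left.mpr (subset_closure.trans hVU)]
  have h1 : IntegrableOn ρ (closure V) μ := (hρ.mono hVU).integrableOn_compact hV
  exact (h1.mono_set subset_closure).lintegral_lt_top.ne

omit [TopologicalSpace α] [T2Space α] [BorelSpace α] [IsFiniteMeasureOnCompacts μ] in
theorem withDensity_restrict_apply {B : Set α} (hB : MeasurableSet B) (hBU : B ⊆ U) :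
    (μ.restrict U).withDensity (fun x => ENNReal.ofReal (ρ x)) B = ∫⁻ x in B, ENNReal.ofReal (ρ x) ∂μ := by
  rw [withDensity_apply _ hB, Measure.restrict_restrict hB, Set.inter_eq_left.mpr hBU]

end Density

/-- Monotone convergence for each M s, for the expectation and for ν. -/
theorem hasMean_of_tendsto {S : Type*} [MeasurableSpace S] {P : Measure S} {α : Type*}
    [MeasurableSpace α] {M : S → Measure α} {ν : Measure α} {D : Set α} (hD : MeasurableSet D)
    {φ : ℕ → α → ℝ} (hφ : ∀ n, Measurable (φ n)) (hmono : ∀ z, Monotone fun n => φ n z)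
    (hlim : ∀ z, Filter.Tendsto (fun n => φ n z) Filter.atTop (nhds (D.indicator 1 z)))
    (h : ∀ n, AEMeasurable (fun s => ∫⁻ z, ENNReal.ofReal (φ n z) ∂M s) P ∧
      ∫⁻ s, ∫⁻ z, ENNReal.ofReal (φ n z) ∂M s ∂P = ∫⁻ z, ENNReal.ofReal (φ n z) ∂ν) :
    HasMean P M ν D := by
  have hs : ∀ s, Filter.Tendsto (fun n => ∫⁻ z, ENNReal.ofReal (φ n z) ∂M s) Filter.atTop
      (nhds (M s D)) := fun s => tendsto_lintegral_of_tendsto_indicator hD hφ hmono hlim (M s)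
  refine ⟨aemeasurable_of_tendsto_metrizable_ae Filter.atTop (fun n => (h n).1)
    (Filter.Eventually.of_forall hs), ?_⟩
  have h1 := lintegral_tendsto_of_tendsto_of_monotone (fun n => (h n).1)
    (Filter.Eventually.of_forall fun s m n hmn => lintegral_mono fun z =>
      ENNReal.ofReal_le_ofReal (hmono z hmn)) (Filter.Eventually.of_forall hs)
  have h2 := tendsto_lintegral_of_tendsto_indicator hD hφ hmono hlim ν
  simp_rw [fun n => (h n).2] at h1
  exact tendsto_nhds_unique h1 h2

theorem exists_bump {V : Set ℂ} (hV : IsOpen V) {z : ℂ} (hz : z ∈ V) (m : ℕ) :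
    ∃ χ : ℂ → ℝ, ContDiff ℝ m χ ∧ HasCompactSupport χ ∧ tsupport χ ⊆ V ∧ (∀ y, 0 ≤ χ y) ∧
      ∃ W, IsOpen W ∧ z ∈ W ∧ ∀ y ∈ W, χ y = 1 := by
  obtain ⟨r, hr, hrV⟩ := Metric.isOpen_iff.mp hV z hz
  let b : ContDiffBump z := ⟨r / 4, r / 2, by positivity, by linarith⟩
  refine ⟨b, b.contDiff, b.hasCompactSupport, ?_, fun y => b.nonneg, Metric.ball z (r / 4),
    Metric.isOpen_ball, Metric.mem_ball_self (by positivity), fun y hy =>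
    b.one_of_mem_closedBall (Metric.ball_subset_closedBall hy)⟩
  rw [b.tsupport_eq]
  exact (Metric.closedBall_subset_ball (by simp only [b]; linarith)).trans hrV

section Potential

variable {S : Type*} [MeasurableSpace S] {P : Measure S} [IsProbabilityMeasure P] {Ω : Set ℂ}
  {X : S → Measure ℂ} {ℓ : S → ℂ → ℝ} {g : ℂ → ℝ} {H : ℂ × ℂ → ℝ}

namespace IsRandomPotential

-- Needed to factor integrals over (X s).prod (X s). Integrals of test functions are finite, so X s
-- is finite near each point of Ω, and countably many such neighbourhoods cover Ω.
omit [IsProbabilityMeasure P] in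
theorem ae_sigmaFinite (h : IsRandomPotential P Ω X ℓ g H) (hΩ : IsOpen Ω) :
    ∀ᵐ s ∂P, SigmaFinite (X s) := by
  filter_upwards [h.laplacian] with s hs
  have hloc : ∀ z ∈ Ω, ∃ W, IsOpen W ∧ z ∈ W ∧ X s W < ⊤ := by
    intro z hz
    obtain ⟨χ, hχ, hχc, hχs, hχ0, W, hW, hzW, hW1⟩ := exists_bump hΩ hz 2
    refine ⟨W, hW, hzW, ?_⟩
    calc X s W = ∫⁻ _ in W, 1 ∂X s := by simp
      _ = ∫⁻ y in W, ENNReal.ofReal (χ y) ∂X s :=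
        setLIntegral_congr_fun hW.measurableSet fun y hy => by simp [hW1 y hy]
      _ ≤ ∫⁻ y, ENNReal.ofReal (χ y) ∂X s := setLIntegral_le_lintegral _ _
      _ < ⊤ := by
        rw [(hs χ hχ hχc hχs hχ0).2]
        exact ENNReal.ofReal_lt_top
  choose! W hWo hzW hW using hloc
  obtain ⟨t, htΩ, htc, ht⟩ := TopologicalSpace.countable_cover_nhdsWithin (s := Ω) (f := W)
    fun x hx => nhdsWithin_le_nhds ((hWo x hx).mem_nhds (hzW x hx))
  refine Measure.sigmaFinite_of_countable (S := insert Ωᶜ (W '' t)) ((htc.image W).insert _) ?_ ?_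
  · rintro V (rfl | ⟨z, hz, rfl⟩)
    · rw [h.null_compl s]; exact ENNReal.zero_lt_top
    · exact hW z (htΩ hz)
  · rw [Set.sUnion_insert, Set.sUnion_image, Set.eq_univ_iff_forall]
    intro z
    by_cases hz : z ∈ Ω
    · exact Or.inr (ht hz)
    · exact Or.inl hz

/-- Green's identity matches the potential with the density ρ on test functions. This yields both ρ
≥ 0 and the mean on relatively compact open sets, from which all Borel sets follow. -/
theorem isFirstIntensity (h : IsRandomPotential P Ω X ℓ g H) (hΩ : IsOpen Ω)
    (hg : ContDiffOn ℝ 2 g Ω) {ρ : ℂ → ℝ} (hρ : ContinuousOn ρ Ω)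
    (hρg : ∀ z ∈ Ω, ρ z = (2 * Real.pi)⁻¹ * Laplacian.laplacian g z) :
    IsFirstIntensity P X Ω ρ := by
  have hint : ∀ φ : ℂ → ℝ, ContDiff ℝ 2 φ → HasCompactSupport φ → tsupport φ ⊆ Ω →
      ∫ z, ρ z * φ z = (2 * Real.pi)⁻¹ * ∫ z, g z * Laplacian.laplacian φ z := by
    intro φ hφ hc hs
    rw [integral_mul_laplacian hΩ hg hφ hc hs, ← integral_const_mul]
    refine integral_congr_ae (Filter.Eventually.of_forall fun z => ?_)
    simp only
    by_cases hz : z ∈ tsupport φ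
    · rw [hρg z (hs hz), mul_assoc]
    · simp [image_eq_zero_of_notMem_tsupport hz]
  have hpi : (0 : ℝ) ≤ (2 * Real.pi)⁻¹ := by positivity
  have hρ0 : ∀ z ∈ Ω, 0 ≤ ρ z := fun z hz => by
    refine nonneg_of_forall_integral_nonneg (μ := volume) hΩ hρ (fun x hx V hV hxV => ?_) hz
    obtain ⟨χ, hχ, hχc, hχs, hχ0, W, hW, hzW, hW1⟩ := exists_bump (hV.inter hΩ) ⟨hxV, hx⟩ 2
    refine ⟨χ, hχ.continuous, hχc, hχs.trans Set.inter_subset_left, hχ0, by simp [hW1 x hzW], ?_⟩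
    rw [hint χ hχ hχc (hχs.trans Set.inter_subset_right)]
    exact mul_nonneg hpi
      (h.lintegral_lintegral hΩ hχ hχc (hχs.trans Set.inter_subset_right) hχ0).2.1
  set ν : Measure ℂ := (volume.restrict Ω).withDensity fun x => ENNReal.ofReal (ρ x) with hν
  have hopen : ∀ D : Set ℂ, IsOpen D → IsCompact (closure D) → closure D ⊆ Ω → HasMean P X ν D := by
    intro D hD hDc hDΩ
    obtain ⟨φ, hφ, hφc, hφs, hφ0, hmono, hlim⟩ := exists_smooth_seq 2 hD hDc
    refine hasMean_of_tendsto hD.measurableSet (fun n => (hφ n).continuous.measurable) hmono hlim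
      fun n => ?_
    obtain ⟨h1, -, h3⟩ := h.lintegral_lintegral hΩ (hφ n) (hφc n) ((hφs n).trans hDΩ) (hφ0 n)
    refine ⟨h1, ?_⟩
    rw [h3, lintegral_ofReal_withDensity hΩ hρ hρ0 (hφ n).continuous (hφc n) ((hφs n).trans hDΩ) (hφ0 n),
      hint _ (hφ n) (hφc n) ((hφs n).trans hDΩ)]
  have hB : ∀ B : Set ℂ, MeasurableSet B → B ⊆ Ω → HasMean P X ν B := by
    intro B hBm hBΩ
    refine hasMean_of_locally (U := Ω) (fun x hx => ?_) hBm hBΩ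
    obtain ⟨r, hr, hrΩ⟩ := Metric.nhds_basis_closedBall.mem_iff.mp (hΩ.mem_nhds hx)
    have hcl : closure (Metric.ball x r) ⊆ Metric.closedBall x r := Metric.closure_ball_subset_closedBall
    have hsub : ∀ D : Set ℂ, D ⊆ Metric.ball x r → IsCompact (closure D) ∧ closure D ⊆ Ω := fun D hD =>
      ⟨(isCompact_closedBall x r).of_isClosed_subset isClosed_closure ((closure_mono hD).trans hcl),
        ((closure_mono hD).trans hcl).trans hrΩ⟩
    refine ⟨Metric.ball x r, Metric.isOpen_ball, Metric.mem_ball_self hr, fun B hB => ?_⟩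
    refine hasMean_of_isPiSystem isPiSystem_isOpen (BorelSpace.measurable_eq (α := ℂ))
      Metric.isOpen_ball.measurableSet
      (withDensity_ne_top hρ Metric.isOpen_ball.measurableSet (hsub _ subset_rfl).1 (hsub _ subset_rfl).2)
      (hopen _ Metric.isOpen_ball (hsub _ subset_rfl).1 (hsub _ subset_rfl).2) (fun C hC => ?_) hB
    have := hsub (C ∩ Metric.ball x r) Set.inter_subset_right
    exact hopen _ (IsOpen.inter hC Metric.isOpen_ball) this.1 this.2
  refine ⟨hρ0, fun D hD hDΩ => (hB D hD hDΩ).1, fun D hD hDΩ => ?_⟩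
  rw [(hB D hD hDΩ).2, withDensity_restrict_apply hD hDΩ]

/-- The same scheme for the product measure, with open rectangles as generators and products of
one-variable test functions as approximations. -/
theorem isTwoPointCorrelation (h : IsRandomPotential P Ω X ℓ g H) (hΩ : IsOpen Ω)
    {U : Set (ℂ × ℂ)} (hU : IsOpen U) (hUΩ : U ⊆ Ω ×ˢ Ω) (hH : ContDiffOn ℝ 4 H U)
    {ρ : ℂ × ℂ → ℝ} (hρ : ContinuousOn ρ U)
    (hρH : ∀ q ∈ U, ρ q = (2 * Real.pi)⁻¹ ^ 2 * laplacianFst (laplacianSnd H) q) :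
    IsTwoPointCorrelation P X U ρ := by
  have hpi : (0 : ℝ) ≤ (2 * Real.pi)⁻¹ ^ 2 := by positivity
  -- An empty rectangle says nothing about its sides, hence the nonemptiness condition.
  have hprod : ∀ {A B : Set ℂ}, A ×ˢ B ⊆ U → (A ×ˢ B).Nonempty → A ⊆ Ω ∧ B ⊆ Ω := by
    rintro A B hAB ⟨⟨a, b⟩, ha, hb⟩
    exact ⟨fun x hx => (hUΩ (hAB (Set.mk_mem_prod hx hb))).1,
      fun x hx => (hUΩ (hAB (Set.mk_mem_prod ha hx))).2⟩
  have hint : ∀ φ η : ℂ → ℝ, ContDiff ℝ 4 φ → HasCompactSupport φ → ContDiff ℝ 4 η →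
      HasCompactSupport η → tsupport φ ×ˢ tsupport η ⊆ U →
      ∫ q : ℂ × ℂ, ρ q * (φ q.1 * η q.2) = (2 * Real.pi)⁻¹ ^ 2 *
        ∫ q : ℂ × ℂ, H q * (Laplacian.laplacian φ q.1 * Laplacian.laplacian η q.2) := by
    intro φ η hφ hφc hη hηc hs
    rw [integral_mul_laplacian_mul_laplacian hU hH hφ hφc hη hηc hs, ← integral_const_mul]
    refine integral_congr_ae (Filter.Eventually.of_forall fun q => ?_)
    simp only
    by_cases hq : q ∈ tsupport φ ×ˢ tsupport η
    · rw [hρH q (hs hq), mul_assoc]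
    · have : φ q.1 * η q.2 = 0 := by
        by_contra h0
        exact hq ⟨subset_tsupport _ (left_ne_zero_of_mul h0), subset_tsupport _ (right_ne_zero_of_mul h0)⟩
      simp [this]
  have hρ0 : ∀ q ∈ U, 0 ≤ ρ q := fun q hq => by
    refine nonneg_of_forall_integral_nonneg (μ := volume) hU hρ (fun x hx V hV hxV => ?_) hq
    obtain ⟨A, B, hA, hxA, hB, hxB, hAB⟩ := mem_nhds_prod_iff'.mp ((hV.inter hU).mem_nhds ⟨hxV, hx⟩)
    obtain ⟨φ, hφ, hφc, hφs, hφ0, W₁, -, hz1, hW1⟩ := exists_bump hA hxA 4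
    obtain ⟨η, hη, hηc, hηs, hη0, W₂, -, hz2, hW2⟩ := exists_bump hB hxB 4
    have hs : tsupport φ ×ˢ tsupport η ⊆ V ∩ U := (Set.prod_mono hφs hηs).trans hAB
    have hsΩ := hprod (hAB.trans Set.inter_subset_right) ⟨x, hxA, hxB⟩
    have hts := tsupport_mul_subset_prod φ η
    refine ⟨fun q => φ q.1 * η q.2, (hφ.continuous.comp continuous_fst).mul
      (hη.continuous.comp continuous_snd), (hφc.isCompact.prod hηc.isCompact).of_isClosed_subset
      (isClosed_tsupport _) hts, (hts.trans hs).trans Set.inter_subset_left, fun q =>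
      mul_nonneg (hφ0 _) (hη0 _), by simp [hW1 _ hz1, hW2 _ hz2], ?_⟩
    rw [hint φ η hφ hφc hη hηc (hs.trans Set.inter_subset_right)]
    exact mul_nonneg hpi (h.lintegral_lintegral_mul_lintegral hΩ (hφ.of_le (by norm_num)) hφc
      (hφs.trans hsΩ.1) hφ0 (hη.of_le (by norm_num)) hηc (hηs.trans hsΩ.2) hη0).1
  set M : S → Measure (ℂ × ℂ) := fun s => (X s).prod (X s) with hM
  set ν : Measure (ℂ × ℂ) := (volume.restrict U).withDensity fun x => ENNReal.ofReal (ρ x) with hν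
  have hopen : ∀ A B : Set ℂ, IsOpen A → IsCompact (closure A) → IsOpen B → IsCompact (closure B) →
      closure A ×ˢ closure B ⊆ U → HasMean P M ν (A ×ˢ B) := by
    intro A B hA hAc hB hBc hAB
    rcases (A ×ˢ B).eq_empty_or_nonempty with he | hne
    · rw [he]; simp [HasMean]
    have hΩ2 := hprod hAB (hne.mono (Set.prod_mono subset_closure subset_closure))
    obtain ⟨φ, hφ, hφc, hφs, hφ0, hφm, hφl⟩ := exists_smooth_seq 4 hA hAc
    obtain ⟨η, hη, hηc, hηs, hη0, hηm, hηl⟩ := exists_smooth_seq 4 hB hBc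
    have hcont : ∀ n, Continuous fun q : ℂ × ℂ => φ n q.1 * η n q.2 := fun n =>
      ((hφ n).continuous.comp continuous_fst).mul ((hη n).continuous.comp continuous_snd)
    refine hasMean_of_tendsto (hA.measurableSet.prod hB.measurableSet)
      (φ := fun n q => φ n q.1 * η n q.2) (fun n => (hcont n).measurable)
      (fun q m n hmn => mul_le_mul (hφm q.1 hmn) (hηm q.2 hmn) (hη0 _ _) (hφ0 _ _)) (fun q => ?_)
      fun n => ?_
    · have := (hφl q.1).mul (hηl q.2)
      refine this.trans_eq ?_
      by_cases h1 : q.1 ∈ A <;> by_cases h2 : q.2 ∈ B <;> simp [Set.indicator, h1, h2]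
    · have hs : tsupport (φ n) ×ˢ tsupport (η n) ⊆ U := (Set.prod_mono (hφs n) (hηs n)).trans hAB
      have hts := tsupport_mul_subset_prod (φ n) (η n)
      have hφ2 : ContDiff ℝ 2 (φ n) := (hφ n).of_le (by norm_num)
      have hη2 : ContDiff ℝ 2 (η n) := (hη n).of_le (by norm_num)
      have hφΩ := (hφs n).trans hΩ2.1
      have hηΩ := (hηs n).trans hΩ2.2
      have e : (fun s => ∫⁻ q, ENNReal.ofReal (φ n q.1 * η n q.2) ∂M s) =ᵐ[P]
          fun s => (∫⁻ z, ENNReal.ofReal (φ n z) ∂X s) * ∫⁻ w, ENNReal.ofReal (η n w) ∂X s := by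
        filter_upwards [h.ae_sigmaFinite hΩ] with s hs
        simp_rw [ENNReal.ofReal_mul (hφ0 n _)]
        exact lintegral_prod_mul (hφ n).continuous.measurable.ennreal_ofReal.aemeasurable
          (hη n).continuous.measurable.ennreal_ofReal.aemeasurable
      refine ⟨((h.lintegral_lintegral hΩ hφ2 (hφc n) hφΩ (hφ0 n)).1.mul
        (h.lintegral_lintegral hΩ hη2 (hηc n) hηΩ (hη0 n)).1).congr e.symm, ?_⟩
      rw [lintegral_congr_ae e, (h.lintegral_lintegral_mul_lintegral hΩ hφ2 (hφc n) hφΩ (hφ0 n)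
        hη2 (hηc n) hηΩ (hη0 n)).2, lintegral_ofReal_withDensity hU hρ hρ0 (hcont n)
        (((hφc n).isCompact.prod (hηc n).isCompact).of_isClosed_subset (isClosed_tsupport _) hts)
        (hts.trans hs) (fun q => mul_nonneg (hφ0 _ _) (hη0 _ _)),
        hint _ _ (hφ n) (hφc n) (hη n) (hηc n) hs]
  have hB : ∀ B : Set (ℂ × ℂ), MeasurableSet B → B ⊆ U → HasMean P M ν B := by
    intro B hBm hBU
    refine hasMean_of_locally (U := U) (fun x hx => ?_) hBm hBU
    obtain ⟨r, hr, hrU⟩ := Metric.nhds_basis_closedBall.mem_iff.mp (hU.mem_nhds hx)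
    rw [← Prod.mk.eta (p := x), ← closedBall_prod_same] at hrU
    have hsub : ∀ {y : ℂ} {D : Set ℂ}, D ⊆ Metric.ball y r →
        IsCompact (closure D) ∧ closure D ⊆ Metric.closedBall y r := fun {y D} hD =>
      have hc := (closure_mono hD).trans Metric.closure_ball_subset_closedBall
      ⟨(isCompact_closedBall y r).of_isClosed_subset isClosed_closure hc, hc⟩
    have hball : ∀ A C : Set ℂ, IsOpen A → IsOpen C → A ⊆ Metric.ball x.1 r → C ⊆ Metric.ball x.2 r →
        HasMean P M ν (A ×ˢ C) := fun A C hA hC hAx hCx =>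
      hopen A C hA (hsub hAx).1 hC (hsub hCx).1 ((Set.prod_mono (hsub hAx).2 (hsub hCx).2).trans hrU)
    set V : Set (ℂ × ℂ) := Metric.ball x.1 r ×ˢ Metric.ball x.2 r with hV
    have hVo : IsOpen V := Metric.isOpen_ball.prod Metric.isOpen_ball
    have hVc : closure V ⊆ Metric.closedBall x.1 r ×ˢ Metric.closedBall x.2 r := by
      rw [hV, closure_prod_eq]
      exact Set.prod_mono Metric.closure_ball_subset_closedBall Metric.closure_ball_subset_closedBall
    refine ⟨V, hVo, ⟨Metric.mem_ball_self hr, Metric.mem_ball_self hr⟩, fun B hB => ?_⟩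
    have hgen : (inferInstance : MeasurableSpace (ℂ × ℂ)) = MeasurableSpace.generateFrom
        (Set.image2 (· ×ˢ ·) {s : Set ℂ | IsOpen s} {s : Set ℂ | IsOpen s}) := by
      refine (generateFrom_eq_prod (BorelSpace.measurable_eq (α := ℂ)).symm
        (BorelSpace.measurable_eq (α := ℂ)).symm ?_ ?_).symm <;>
      exact ⟨fun _ => Set.univ, fun _ => (isOpen_univ : IsOpen (Set.univ : Set ℂ)), Set.iUnion_const _⟩
    refine hasMean_of_isPiSystem (isPiSystem_isOpen.prod isPiSystem_isOpen) hgen hVo.measurableSet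
      (withDensity_ne_top hρ hVo.measurableSet (((isCompact_closedBall _ _).prod
        (isCompact_closedBall _ _)).of_isClosed_subset isClosed_closure hVc) (hVc.trans hrU))
      (hball _ _ Metric.isOpen_ball Metric.isOpen_ball subset_rfl subset_rfl) ?_ hB
    rintro _ ⟨A, hA, C, hC, rfl⟩
    have e : A ×ˢ C ∩ V = (A ∩ Metric.ball x.1 r) ×ˢ (C ∩ Metric.ball x.2 r) := Set.prod_inter_prod
    simp only
    rw [e]
    exact hball _ _ (IsOpen.inter hA Metric.isOpen_ball) (IsOpen.inter hC Metric.isOpen_ball)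
      Set.inter_subset_right Set.inter_subset_right
  refine ⟨hρ0, fun D hD hDU => (hB D hD hDU).1, fun D hD hDU => ?_⟩
  rw [(hB D hD hDU).2, withDensity_restrict_apply hD hDU]

end IsRandomPotential

end Potential

/-! ### Termwise differentiation of power series in a smooth function -/

/-- The `j`-th derivative of the power series with coefficients `c`. -/
noncomputable def powerSeriesDeriv (c : ℕ → ℝ) (j : ℕ) (τ : ℝ) : ℝ :=
  ∑' p, c p * ((p.descFactorial j : ℝ) * τ ^ (p - j))

theorem summable_descFactorial_mul_pow {r : ℝ} (hr : |r| < 1) (j : ℕ) :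
    Summable fun p : ℕ => (p.descFactorial j : ℝ) * r ^ (p - j) := by
  rw [← summable_nat_add_iff j]
  simpa using summable_descFactorial_mul_geometric_of_norm_lt_one (R := ℝ) j (r := r) hr

theorem summable_powerSeriesDeriv {c : ℕ → ℝ} {C : ℝ} (hc : ∀ p, |c p| ≤ C) {r : ℝ} (hr : |r| < 1) (j : ℕ) :
    Summable fun p => c p * ((p.descFactorial j : ℝ) * r ^ (p - j)) := by
  have h := (summable_descFactorial_mul_pow (r := |r|) (by rwa [abs_abs]) j).mul_left C
  refine h.of_norm_bounded fun p => ?_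
  rw [norm_mul, norm_mul, norm_pow, Real.norm_natCast, Real.norm_eq_abs, Real.norm_eq_abs]
  exact mul_le_mul_of_nonneg_right (hc p) (by positivity)

/-- Bounded coefficients give a geometric majorant for the derived series on |y| < r, for any r with
|τ| < r < 1. -/
theorem hasDerivAt_powerSeriesDeriv {c : ℕ → ℝ} {C : ℝ} (hc : ∀ p, |c p| ≤ C) {τ : ℝ} (hτ : |τ| < 1)
    (j : ℕ) : HasDerivAt (powerSeriesDeriv c j) (powerSeriesDeriv c (j + 1) τ) τ := by
  obtain ⟨r, hτr, hr1⟩ := exists_between hτ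
  have hr0 : 0 ≤ r := (abs_nonneg τ).trans hτr.le
  have hu := (summable_descFactorial_mul_pow (r := r) (by rwa [abs_of_nonneg hr0]) (j + 1)).mul_left C
  have hg : ∀ (p : ℕ) (y : ℝ), HasDerivAt (fun y => c p * ((p.descFactorial j : ℝ) * y ^ (p - j)))
      (c p * ((p.descFactorial (j + 1) : ℝ) * y ^ (p - (j + 1)))) y := by
    intro p y
    have h := ((hasDerivAt_pow (p - j) y).const_mul (p.descFactorial j : ℝ)).const_mul (c p)
    refine h.congr_deriv ?_
    rw [Nat.descFactorial_succ, ← Nat.sub_sub, Nat.cast_mul]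
    ring
  have hb : ∀ (p : ℕ) (y : ℝ), y ∈ Set.Ioo (-r) r →
      ‖c p * ((p.descFactorial (j + 1) : ℝ) * y ^ (p - (j + 1)))‖
        ≤ C * ((p.descFactorial (j + 1) : ℝ) * r ^ (p - (j + 1))) := by
    intro p y hy
    rw [norm_mul, norm_mul, norm_pow, Real.norm_natCast, Real.norm_eq_abs, Real.norm_eq_abs]
    have hy' : |y| ≤ r := (abs_lt.mpr hy).le
    exact mul_le_mul (hc p) (mul_le_mul_of_nonneg_left (pow_le_pow_left₀ (abs_nonneg _) hy' _)
      (Nat.cast_nonneg _)) (by positivity) ((abs_nonneg _).trans (hc p))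
  exact hasDerivAt_tsum_of_isPreconnected hu isOpen_Ioo isPreconnected_Ioo
    (fun p y _ => hg p y) hb (abs_lt.mp hτr) (summable_powerSeriesDeriv hc hτ j) (abs_lt.mp hτr)

theorem contDiffOn_powerSeriesDeriv {c : ℕ → ℝ} {C : ℝ} (hc : ∀ p, |c p| ≤ C) (n j : ℕ) :
    ContDiffOn ℝ n (powerSeriesDeriv c j) (Set.Ioo (-1) 1) := by
  induction n generalizing j with
  | zero =>
    exact contDiffOn_zero.mpr fun τ hτ =>
      (hasDerivAt_powerSeriesDeriv hc (abs_lt.mpr hτ) j).continuousAt.continuousWithinAt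
  | succ n ih =>
    push_cast
    rw [contDiffOn_succ_iff_deriv_of_isOpen isOpen_Ioo]
    refine ⟨fun τ hτ => (hasDerivAt_powerSeriesDeriv hc (abs_lt.mpr hτ) j).differentiableAt.differentiableWithinAt,
      by simp, (ih (j + 1)).congr fun τ hτ => (hasDerivAt_powerSeriesDeriv hc (abs_lt.mpr hτ) j).deriv⟩

theorem powerSeriesDeriv_single (p j : ℕ) (τ : ℝ) :
    powerSeriesDeriv (Pi.single p 1) j τ = (p.descFactorial j : ℝ) * τ ^ (p - j) := by
  rw [powerSeriesDeriv, tsum_eq_single p]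
  · simp
  · intro q hq
    simp [hq]

section PowerSeriesOperator

variable {E : Type*} [NormedAddCommGroup E] [NormedSpace ℝ E]

/-- A family `T c` of functions that depends on the coefficients `c` through the derivatives of
the power series at `θ`. -/
def IsPowerSeriesOperator (U : Set E) (θ : E → ℝ) (T : (ℕ → ℝ) → E → ℝ) : Prop :=
  ∃ (J : ℕ) (A : ℕ → E → ℝ), (∀ j, ∀ n : ℕ, ContDiffOn ℝ n (A j) U) ∧
    ∀ c C, (∀ p, |c p| ≤ C) → ∀ x ∈ U, T c x = ∑ j ∈ Finset.range J, powerSeriesDeriv c j (θ x) * A j x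

variable {U : Set E} {θ : E → ℝ} {T T' : (ℕ → ℝ) → E → ℝ}

theorem isPowerSeriesOperator_comp :
    IsPowerSeriesOperator U θ fun c x => powerSeriesDeriv c 0 (θ x) :=
  ⟨1, fun _ _ => 1, fun _ _ => contDiffOn_const, fun c C _ x _ => by simp⟩

/-- Both representations are padded with zero coefficients to a common length J + J'. -/
theorem IsPowerSeriesOperator.add (h : IsPowerSeriesOperator U θ T) (h' : IsPowerSeriesOperator U θ T') :
    IsPowerSeriesOperator U θ fun c x => T c x + T' c x := by
  obtain ⟨J, A, hA, hT⟩ := h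
  obtain ⟨J', A', hA', hT'⟩ := h'
  refine ⟨J + J', fun j x => (if j < J then A j x else 0) + if j < J' then A' j x else 0,
    fun j n => ?_, fun c C hc x hx => ?_⟩
  · refine ContDiffOn.add ?_ ?_
    · split_ifs
      · exact hA j n
      · exact contDiffOn_const
    · split_ifs
      · exact hA' j n
      · exact contDiffOn_const
  · have e : ∀ {N M : ℕ} (B : ℕ → E → ℝ), N ≤ M → ∑ j ∈ Finset.range M, powerSeriesDeriv c j (θ x) *
        (if j < N then B j x else 0) = ∑ j ∈ Finset.range N, powerSeriesDeriv c j (θ x) * B j x := by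
      intro N M B hNM
      simp_rw [mul_ite, mul_zero]
      rw [← Finset.sum_filter]
      congr 1
      ext j
      simp only [Finset.mem_filter, Finset.mem_range]
      omega
    simp_rw [mul_add]
    rw [Finset.sum_add_distrib, e A (Nat.le_add_right _ _), e A' (Nat.le_add_left _ _), hT c C hc x hx,
      hT' c C hc x hx]

/-- By the product and chain rules, each term yields one with the coefficient function
differentiated, and one with the order of the series derivative raised by 1 and the factor ∂_v θ. -/
theorem IsPowerSeriesOperator.dirDeriv (h : IsPowerSeriesOperator U θ T) (hU : IsOpen U)
    (hθ : ∀ n : ℕ, ContDiffOn ℝ n θ U) (hθ1 : ∀ x ∈ U, |θ x| < 1) (v : E) :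
    IsPowerSeriesOperator U θ fun c => dirDeriv v (T c) := by
  obtain ⟨J, A, hA, hT⟩ := h
  have hdiff : ∀ {B : E → ℝ}, (∀ n : ℕ, ContDiffOn ℝ n B U) → ∀ x ∈ U, DifferentiableAt ℝ B x :=
    fun hB x hx => ((hB 1).differentiableOn (by norm_num)).differentiableAt (hU.mem_nhds hx)
  have hsm : ∀ {B : E → ℝ}, (∀ n : ℕ, ContDiffOn ℝ n B U) → ∀ n : ℕ, ContDiffOn ℝ n (Polygaf.dirDeriv v B) U :=
    fun hB n => contDiffOn_dirDeriv hU (hB (n + 1)) (by push_cast; exact le_rfl) v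
  have h1 : IsPowerSeriesOperator U θ fun c x =>
      ∑ j ∈ Finset.range J, powerSeriesDeriv c j (θ x) * Polygaf.dirDeriv v (A j) x :=
    ⟨J, fun j => Polygaf.dirDeriv v (A j), fun j => hsm (hA j), fun c C _ x _ => rfl⟩
  have h2 : IsPowerSeriesOperator U θ fun c x =>
      ∑ j ∈ Finset.range J, powerSeriesDeriv c (j + 1) (θ x) * (Polygaf.dirDeriv v θ x * A j x) := by
    -- The raised order shifts the index: the coefficient at 0 is 0 and the one at i + 1 comes from
    -- i.
    refine ⟨J + 1, fun j x => Nat.casesOn j 0 fun i => Polygaf.dirDeriv v θ x * A i x, fun j n => ?_,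
      fun c C _ x _ => ?_⟩
    · cases j with
      | zero => exact contDiffOn_const
      | succ j => exact (hsm hθ n).mul (hA j n)
    · rw [Finset.sum_range_succ']
      simp
  obtain ⟨J', A', hA', hT'⟩ := h1.add h2
  refine ⟨J', A', hA', fun c C hc x hx => ?_⟩
  rw [← hT' c C hc x hx]
  have e : T c =ᶠ[nhds x] fun y => ∑ j ∈ Finset.range J, powerSeriesDeriv c j (θ y) * A j y := by
    filter_upwards [hU.mem_nhds hx] with y hy using hT c C hc y hy
  have hd : ∀ j, HasFDerivAt (fun y => powerSeriesDeriv c j (θ y) * A j y)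
      (powerSeriesDeriv c j (θ x) • fderiv ℝ (A j) x
        + A j x • (powerSeriesDeriv c (j + 1) (θ x) • fderiv ℝ θ x)) x := fun j =>
    ((hasDerivAt_powerSeriesDeriv hc (hθ1 x hx) j).comp_hasFDerivAt x (hdiff hθ x hx).hasFDerivAt).mul
      (hdiff (hA j) x hx).hasFDerivAt
  simp only
  rw [(dirDeriv_congr e v).eq_of_nhds, Polygaf.dirDeriv, (HasFDerivAt.fun_sum fun j _ => hd j).fderiv]
  simp only [Polygaf.dirDeriv, sum_apply, add_apply,
    smul_apply, smul_eq_mul]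
  rw [← Finset.sum_add_distrib]
  exact Finset.sum_congr rfl fun j _ => by ring

theorem IsPowerSeriesOperator.planeLaplacian (h : IsPowerSeriesOperator U θ T) (hU : IsOpen U)
    (hθ : ∀ n : ℕ, ContDiffOn ℝ n θ U) (hθ1 : ∀ x ∈ U, |θ x| < 1) (a b : E) :
    IsPowerSeriesOperator U θ fun c => planeLaplacian a b (T c) :=
  ((h.dirDeriv hU hθ hθ1 a).dirDeriv hU hθ hθ1 a).add ((h.dirDeriv hU hθ hθ1 b).dirDeriv hU hθ hθ1 b)

/-- For the coefficients `Pi.single p 1` the power series is the monomial θ^p. The operator is a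
finite sum of absolutely convergent series, so it may be applied term by term. -/
theorem IsPowerSeriesOperator.hasSum (h : IsPowerSeriesOperator U θ T) {c : ℕ → ℝ} {C : ℝ}
    (hc : ∀ p, |c p| ≤ C) {x : E} (hx : x ∈ U) (hθ1 : |θ x| < 1) :
    HasSum (fun p => c p * T (Pi.single p 1) x) (T c x) := by
  obtain ⟨J, A, hA, hT⟩ := h
  have e : ∀ p, c p * T (Pi.single p 1) x
      = ∑ j ∈ Finset.range J, c p * ((p.descFactorial j : ℝ) * θ x ^ (p - j)) * A j x := by
    intro p
    rw [hT (Pi.single p 1) 1 (fun q => ?_) x hx, Finset.mul_sum]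
    · exact Finset.sum_congr rfl fun j _ => by rw [powerSeriesDeriv_single]; ring
    · rcases eq_or_ne q p with rfl | hq
      · simp
      · simp [hq]
  simp_rw [e]
  rw [hT c C hc x hx]
  exact hasSum_sum fun j _ => (summable_powerSeriesDeriv hc hθ1 j).hasSum.mul_right _

end PowerSeriesOperator

/-! ### Linearity of Laplacians -/

theorem planeLaplacian_add {E : Type*} [NormedAddCommGroup E] [NormedSpace ℝ E] {V : Set E}
    (hV : IsOpen V) {f g : E → ℝ} (hf : ContDiffOn ℝ 2 f V) (hg : ContDiffOn ℝ 2 g V) {x : E}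
    (hx : x ∈ V) (a b : E) : planeLaplacian a b (fun y => f y + g y) x
      = planeLaplacian a b f x + planeLaplacian a b g x := by
  have hadd : ∀ {f g : E → ℝ}, ContDiffOn ℝ 1 f V → ContDiffOn ℝ 1 g V → ∀ v, ∀ y ∈ V,
      dirDeriv v (fun y => f y + g y) y = dirDeriv v f y + dirDeriv v g y := by
    intro f g hf hg v y hy
    have h1 := (hf.differentiableOn one_ne_zero).differentiableAt (hV.mem_nhds hy)
    have h2 := (hg.differentiableOn one_ne_zero).differentiableAt (hV.mem_nhds hy)
    simp only [dirDeriv]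
    rw [fderiv_fun_add h1 h2, add_apply]
  have h2 : ∀ v, dirDeriv v (dirDeriv v fun y => f y + g y) x
      = dirDeriv v (dirDeriv v f) x + dirDeriv v (dirDeriv v g) x := by
    intro v
    have e : dirDeriv v (fun y => f y + g y) =ᶠ[nhds x] fun y => dirDeriv v f y + dirDeriv v g y := by
      filter_upwards [hV.mem_nhds hx] with y hy
      exact hadd (hf.of_le (by norm_num)) (hg.of_le (by norm_num)) v y hy
    rw [(dirDeriv_congr e v).eq_of_nhds]
    exact hadd (contDiffOn_dirDeriv hV hf (by norm_num) v) (contDiffOn_dirDeriv hV hg (by norm_num) v) v x hx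
  simp only [planeLaplacian]
  rw [h2, h2]
  ring

theorem laplacianFst_laplacianSnd_add {U : Set (ℂ × ℂ)} (hU : IsOpen U) {f g : ℂ × ℂ → ℝ}
    (hf : ContDiffOn ℝ 4 f U) (hg : ContDiffOn ℝ 4 g U) {q : ℂ × ℂ} (hq : q ∈ U) :
    laplacianFst (laplacianSnd fun y => f y + g y) q
      = laplacianFst (laplacianSnd f) q + laplacianFst (laplacianSnd g) q := by
  have e : laplacianSnd (fun y => f y + g y) =ᶠ[nhds q] fun y => laplacianSnd f y + laplacianSnd g y := by
    filter_upwards [hU.mem_nhds hq] with y hy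
    exact planeLaplacian_add hU (hf.of_le (by norm_num)) (hg.of_le (by norm_num)) hy _ _
  rw [laplacianFst, planeLaplacian_congr e]
  exact planeLaplacian_add hU (contDiffOn_planeLaplacian hU hf (by norm_num) _ _)
    (contDiffOn_planeLaplacian hU hg (by norm_num) _ _) hq _ _

theorem laplacian_const_mul_add_const {u : ℂ → ℝ} {z : ℂ} (hu : ContDiffAt ℝ 2 u z) (a b : ℝ) :
    Laplacian.laplacian (fun y => a * u y + b) z = a * Laplacian.laplacian u z := by
  have h1 : ContDiffAt ℝ 2 (a • u) z := contDiffAt_const.smul hu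
  have h2 : ContDiffAt ℝ 2 (fun _ : ℂ => b) z := contDiffAt_const
  have h3 := h1.laplacian_add h2
  rw [InnerProductSpace.laplacian_smul a hu, InnerProductSpace.laplacian_const] at h3
  rw [Pi.zero_apply, add_zero] at h3
  exact h3

theorem continuousOn_laplacian {V : Set ℂ} (hV : IsOpen V) {u : ℂ → ℝ} (hu : ContDiffOn ℝ 2 u V) :
    ContinuousOn (Laplacian.laplacian u) V := by
  have h : ContinuousOn (planeLaplacian 1 Complex.I u) V :=
    (contDiffOn_planeLaplacian (m := 0) hV hu (by norm_num) _ _).continuousOn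
  exact h.congr fun z hz => laplacian_eq_dirDeriv hV hu hz

/-- The mixed Laplacian separates on a product of one-variable functions; this term yields ρ₁(z)
ρ₁(w). -/
theorem laplacianFst_laplacianSnd_mul_sub_const {Ω : Set ℂ} (hΩ : IsOpen Ω) {g : ℂ → ℝ}
    (hg : ContDiffOn ℝ 4 g Ω) (b : ℝ) {z w : ℂ} (hz : z ∈ Ω) (hw : w ∈ Ω) :
    laplacianFst (laplacianSnd fun q => g q.1 * g q.2 - b) (z, w)
      = Laplacian.laplacian g z * Laplacian.laplacian g w := by
  have hG : ContDiffOn ℝ 4 (fun q : ℂ × ℂ => g q.1 * g q.2 - b) (Ω ×ˢ Ω) :=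
    ((hg.comp contDiffOn_fst fun q hq => hq.1).mul (hg.comp contDiffOn_snd fun q hq => hq.2)).sub
      contDiffOn_const
  have hg2 : ∀ y ∈ Ω, ContDiffAt ℝ 2 g y := fun y hy =>
    (hg.of_le (by norm_num)).contDiffAt (hΩ.mem_nhds hy)
  rw [← laplacian_laplacian_slice (hΩ.prod hΩ) hG (Set.mk_mem_prod hz hw)]
  have e : ∀ u, Laplacian.laplacian (fun v => g u * g v - b) w = Laplacian.laplacian g w * g u + 0 := by
    intro u
    simp only [sub_eq_add_neg]
    rw [laplacian_const_mul_add_const (hg2 w hw)]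
    ring
  simp only [e]
  rw [laplacian_const_mul_add_const (hg2 z hz), mul_comm]

/-! ### Zeros of polynomials in Gaussian analytic functions -/

section Zeros

variable {S : Type*} [MeasurableSpace S] {P : Measure S} [IsProbabilityMeasure P] {Ω : Set ℂ}
  {k d : ℕ} {Q : MvPolynomial (Fin k) ℂ} {f : Fin k → S → ℂ → ℂ} {K : ℂ → ℂ → ℂ}

omit [IsProbabilityMeasure P] in
theorem analyticOnNhd_eval (hf : ∀ i, IsGAF P Ω (f i)) (Q : MvPolynomial (Fin k) ℂ) (s : S) :
    AnalyticOnNhd ℂ (fun z => MvPolynomial.eval (fun i => f i s z) Q) Ω := by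
  have h := AnalyticOnNhd.aeval_mvPolynomial (𝕜 := ℂ) (A := ℂ) (f := fun z i => f i s z) (s := Ω)
    (fun i => (hf i).analytic s) Q
  simpa [MvPolynomial.coe_aeval_eq_eval] using h

theorem zeroMeasure_compl (Ω : Set ℂ) (F : ℂ → ℂ) (hΩ : IsOpen Ω) : zeroMeasure Ω F Ωᶜ = 0 := by
  rw [zeroMeasure, Measure.sum_apply _ hΩ.measurableSet.compl]
  simp [Measure.dirac_apply' _ hΩ.measurableSet.compl]

-- Joint measurability on Ω comes from continuity in z and measurability in s. Outside Ω nothing is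
-- known about the functions, so the value 0 is imposed there.
omit [IsProbabilityMeasure P] in
open Classical in
theorem measurable_log_norm_eval_uncurry (hΩ : IsOpen Ω) (hf : ∀ i, IsGAF P Ω (f i))
    (Q : MvPolynomial (Fin k) ℂ) :
    Measurable (Function.uncurry fun (s : S) (z : ℂ) =>
      if z ∈ Ω then Real.log ‖MvPolynomial.eval (fun i => f i s z) Q‖ else 0) := by
  have h1 : Measurable (Function.uncurry fun (z : Ω) (s : S) =>
      MvPolynomial.eval (fun i => f i s z) Q) := by
    refine measurable_uncurry_of_continuous_of_measurable (fun s => ?_) fun z => ?_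
    · exact continuousOn_iff_continuous_domRestrict.mp (analyticOnNhd_eval hf Q s).continuousOn
    · exact (continuous_eval Q).measurable.comp
        (measurable_pi_lambda _ fun i => (hf i).measurable z z.2)
  have hT : MeasurableSet {q : S × ℂ | q.2 ∈ Ω} := measurable_snd hΩ.measurableSet
  have h2 : Measurable fun q : {q : S × ℂ | q.2 ∈ Ω} =>
      Real.log ‖MvPolynomial.eval (fun i => f i q.1.1 q.1.2) Q‖ := by
    have h3 : Measurable fun q : {q : S × ℂ | q.2 ∈ Ω} => ((⟨q.1.2, q.2⟩ : Ω), q.1.1) :=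
      ((measurable_snd.comp measurable_subtype_coe).subtype_mk).prodMk
        (measurable_fst.comp measurable_subtype_coe)
    exact Real.measurable_log.comp (h1.comp h3).norm
  exact Measurable.dite h2 (measurable_const (a := (0 : ℝ))) hT

theorem isRandomPotential_log_norm_eval (hΩ : IsOpen Ω) (hQ : Q.IsHomogeneous d) (hQ0 : Q ≠ 0)
    (hf : ∀ i, IsGAF P Ω (f i)) (hcov : ∀ i, IsCovarianceKernel P Ω (f i) K)
    (hind : iIndepFun (fun (i : Fin k) (s : S) (z : Ω) => f i s z) P) (hK : ∀ z ∈ Ω, K z z ≠ 0)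
    (i₀ : Fin k) {X : S → Measure ℂ}
    (hX : ∀ s, X s = zeroMeasure Ω fun z => MvPolynomial.eval (fun i => f i s z) Q) :
    ∃ ℓ : S → ℂ → ℝ, IsRandomPotential P Ω X ℓ (meanLogAt d Q K) (meanLogMulLog d Q K) := by
  classical
  have hm := fun {z w : ℂ} (hz : z ∈ Ω) (hw : w ∈ Ω) =>
    moments_log_norm_eval hQ hQ0 hf hcov hind hK i₀ hz hw
  have hpos := fun {z : ℂ} (hz : z ∈ Ω) => (hf i₀).re_kernel_self_pos (hcov i₀) hz (hK z hz)
  have hr := (hf i₀).contDiffOn_re_kernel_self hΩ (hcov i₀) 0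
  refine ⟨fun s z => if z ∈ Ω then Real.log ‖MvPolynomial.eval (fun i => f i s z) Q‖ else 0,
    measurable_log_norm_eval_uncurry hΩ hf Q, fun z hz => ?_, fun z hz => ?_, fun z hz w hw => ?_,
    ?_, fun s => ?_, ?_⟩
  · simpa only [if_pos hz] using (hm hz hz).2.1
  · simpa only [if_pos hz] using (hm hz hz).2.2.1
  · simpa only [if_pos hz, if_pos hw] using (hm hz hw).2.2.2
  · have hg : ContinuousOn (meanLogAt d Q K) Ω :=
      (continuousOn_const.mul (hr.continuousOn.log fun z hz => (hpos hz).ne')).add continuousOn_const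
    -- On the diagonal the overlap is 1, where smoothness inside the disc of convergence does not
    -- apply; but there the series is a constant.
    have e : Set.EqOn (fun z => meanLogMulLog d Q K (z, z)) (fun z => meanLogAt d Q K z * meanLogAt d Q K z
        - meanLog Q ^ 2 + ∑' p, wickWeight Q p * 1 ^ p) Ω := by
      intro z hz
      have : overlap K (z, z) = 1 := by
        have h1 := (hpos hz).ne'
        rw [overlap, (hf i₀).kernel_self_eq_re (hcov i₀) hz, Complex.norm_real, Real.norm_eq_abs, sq_abs,
          Complex.ofReal_re, sq]
        exact div_self (mul_ne_zero h1 h1)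
      simp only [meanLogMulLog, this]
    exact (((hg.mul hg).sub continuousOn_const).add continuousOn_const).congr e
  · rw [hX]; exact zeroMeasure_compl _ _ hΩ
  -- Almost surely F is nonzero at all points of a countable dense subset of Ω, hence it vanishes
  -- identically near no point and all orders are finite.
  · obtain ⟨t, htc, htd⟩ := TopologicalSpace.exists_countable_dense ℂ
    have hae : ∀ᵐ s ∂P, ∀ z ∈ t, z ∈ Ω → MvPolynomial.eval (fun i => f i s z) Q ≠ 0 := by
      rw [ae_ball_iff htc]
      intro z _
      by_cases hz : z ∈ Ω
      · filter_upwards [(hm hz hz).1] with s hs _ using hs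
      · exact Filter.Eventually.of_forall fun s h => absurd h hz
    filter_upwards [hae] with s hs φ hφ hφc hφs hφ0
    have hord : ∀ z ∈ Ω, analyticOrderAt (fun z => MvPolynomial.eval (fun i => f i s z) Q) z ≠ ⊤ := by
      intro z hz htop
      rw [analyticOrderAt_eq_top] at htop
      obtain ⟨V, hV, hVo, hzV⟩ := eventually_nhds_iff.mp htop
      obtain ⟨y, hy, hyt⟩ := htd.inter_open_nonempty (V ∩ Ω) (hVo.inter hΩ) ⟨z, hzV, hz⟩
      exact hs y hyt hy.2 (hV y hy.1)
    have e : ∫ z, (if z ∈ Ω then Real.log ‖MvPolynomial.eval (fun i => f i s z) Q‖ else 0)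
          * Laplacian.laplacian φ z
        = ∫ z, Real.log ‖MvPolynomial.eval (fun i => f i s z) Q‖ * Laplacian.laplacian φ z := by
      refine integral_congr_ae (Filter.Eventually.of_forall fun z => ?_)
      simp only
      by_cases hz : z ∈ Ω
      · rw [if_pos hz]
      · rw [image_eq_zero_of_notMem_tsupport fun h => hz (hφs (tsupport_laplacian_subset φ h)),
          mul_zero, mul_zero]
    rw [e, hX]
    exact lintegral_ofReal_zeroMeasure (analyticOnNhd_eval hf Q s) hord hφ hφc hφs hφ0

/-- Mehler's formula at c = 1, s = 0 is Parseval's identity: the weights are summable, so bounded.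
-/
theorem exists_abs_wickWeight_le (hQ : Q.IsHomogeneous d) (hQ0 : Q ≠ 0) : ∃ C, ∀ p, |wickWeight Q p| ≤ C := by
  have h := (hasSum_wickWeight_mul_pow hQ (memLp_log_norm_eval hQ0) (c := 1) (s := 0) (by simp)).summable
  simp only [norm_one, one_pow, mul_one] at h
  refine ⟨∑' p, wickWeight Q p, fun p => ?_⟩
  rw [abs_of_nonneg (wickWeight_nonneg Q p)]
  exact h.le_tsum p fun q _ => wickWeight_nonneg Q q

theorem normalizedPower_eq_powerSeriesDeriv (K : ℂ → ℂ → ℂ) (p : ℕ) (z w : ℂ) :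
    normalizedPower K p z w = powerSeriesDeriv (Pi.single p 1) 0 (overlap K (z, w)) := by
  rw [normalizedPower_eq, powerSeriesDeriv_single]
  simp

theorem meanLogMulLog_eq (d : ℕ) (Q : MvPolynomial (Fin k) ℂ) (K : ℂ → ℂ → ℂ) :
    meanLogMulLog d Q K = fun q => (meanLogAt d Q K q.1 * meanLogAt d Q K q.2 - meanLog Q ^ 2)
      + powerSeriesDeriv (wickWeight Q) 0 (overlap K q) := by
  funext q
  rw [meanLogMulLog, powerSeriesDeriv]
  simp

theorem exists_intensities (hΩ : IsOpen Ω) (hQ : Q.IsHomogeneous d) (hQ0 : Q ≠ 0)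
    (hf : ∀ i, IsGAF P Ω (f i)) (hcov : ∀ i, IsCovarianceKernel P Ω (f i) K)
    (hind : iIndepFun (fun (i : Fin k) (s : S) (z : Ω) => f i s z) P) (hK : ∀ z ∈ Ω, K z z ≠ 0)
    (i₀ : Fin k) {X : S → Measure ℂ}
    (hX : ∀ s, X s = zeroMeasure Ω fun z => MvPolynomial.eval (fun i => f i s z) Q) :
    ∃ (ρ₁ : ℂ → ℝ) (ρ₂ : ℂ × ℂ → ℝ),
      ContinuousOn ρ₁ Ω ∧
      IsFirstIntensity P X Ω ρ₁ ∧
      (∀ z ∈ Ω, ρ₁ z =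
        d / (4 * Real.pi) * Laplacian.laplacian (fun u : ℂ => Real.log (K u u).re) z) ∧
      ContinuousOn ρ₂ (nondegeneratePairs Ω K) ∧
      IsTwoPointCorrelation P X (nondegeneratePairs Ω K) ρ₂ ∧
      ∀ z w : ℂ, (z, w) ∈ nondegeneratePairs Ω K →
        HasSum
          (fun p : ℕ => (2 * Real.pi)⁻¹ ^ 2 * (wickWeight Q p *
            Laplacian.laplacian
              (fun u : ℂ => Laplacian.laplacian (fun v : ℂ => normalizedPower K p u v) w) z))
          (ρ₂ (z, w) - ρ₁ z * ρ₁ w) := by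
  obtain ⟨ℓ, hℓ⟩ := isRandomPotential_log_norm_eval hΩ hQ hQ0 hf hcov hind hK i₀ hX
  obtain ⟨C, hC⟩ := exists_abs_wickWeight_le hQ hQ0
  set U := nondegeneratePairs Ω K with hUdef
  have hpos : ∀ z ∈ Ω, 0 < (K z z).re := fun z hz =>
    (hf i₀).re_kernel_self_pos (hcov i₀) hz (hK z hz)
  have hr : ∀ n, ContDiffOn ℝ n (fun z => (K z z).re) Ω :=
    (hf i₀).contDiffOn_re_kernel_self hΩ (hcov i₀)
  have hlog : ∀ n, ContDiffOn ℝ n (fun z => Real.log (K z z).re) Ω := fun n =>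
    (hr n).log fun z hz => (hpos z hz).ne'
  have hg : ∀ n, ContDiffOn ℝ n (meanLogAt d Q K) Ω := fun n =>
    (contDiffOn_const.mul (hlog n)).add contDiffOn_const
  have hrr : ∀ n, ContDiffOn ℝ n (fun q : ℂ × ℂ => (K q.1 q.1).re * (K q.2 q.2).re) (Ω ×ˢ Ω) := fun n =>
    ((hr n).comp contDiffOn_fst fun q hq => hq.1).mul ((hr n).comp contDiffOn_snd fun q hq => hq.2)
  have hKK : ∀ n, ContDiffOn ℝ n (fun q : ℂ × ℂ => ‖K q.1 q.2‖ ^ 2) (Ω ×ˢ Ω) :=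
    (hf i₀).contDiffOn_norm_kernel_sq hΩ (hcov i₀)
  have hUΩ : U ⊆ Ω ×ˢ Ω := fun q hq => ⟨hq.1, hq.2.1⟩
  have hU : IsOpen U := by
    have h := ((hrr 0).continuousOn.sub (hKK 0).continuousOn).isOpen_inter_preimage (hΩ.prod hΩ)
      (isOpen_Ioi (a := (0 : ℝ)))
    have e : U = (Ω ×ˢ Ω) ∩ ((fun q : ℂ × ℂ => (K q.1 q.1).re * (K q.2 q.2).re) -
        fun q : ℂ × ℂ => ‖K q.1 q.2‖ ^ 2) ⁻¹' Set.Ioi 0 := by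
      ext q
      simp [hUdef, nondegeneratePairs, and_assoc]
    rw [e]
    exact h
  have hθ : ∀ n : ℕ, ContDiffOn ℝ n (overlap K) U := fun n =>
    ((hKK n).mono hUΩ).div ((hrr n).mono hUΩ) fun q hq =>
      (mul_pos (hpos _ hq.1) (hpos _ hq.2.1)).ne'
  have hθ1 : ∀ q ∈ U, |overlap K q| < 1 := by
    intro q hq
    have h1 := hpos _ hq.1
    have h2 := hpos _ hq.2.1
    rw [abs_of_nonneg (overlap_nonneg_of_pos h1 h2), overlap, div_lt_one (mul_pos h1 h2)]
    exact hq.2.2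
  have hps : ∀ {c : ℕ → ℝ} {C : ℝ}, (∀ p, |c p| ≤ C) →
      ContDiffOn ℝ 4 (fun q => powerSeriesDeriv c 0 (overlap K q)) U := fun hc =>
    (contDiffOn_powerSeriesDeriv hc 4 0).comp (hθ 4) fun q hq => abs_lt.mp (hθ1 q hq)
  have hgg : ContDiffOn ℝ 4 (fun q : ℂ × ℂ => meanLogAt d Q K q.1 * meanLogAt d Q K q.2 - meanLog Q ^ 2) U :=
    ((((hg 4).comp contDiffOn_fst fun q hq => (hUΩ hq).1).mul
      ((hg 4).comp contDiffOn_snd fun q hq => (hUΩ hq).2)).sub contDiffOn_const)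
  have hH : ContDiffOn ℝ 4 (meanLogMulLog d Q K) U := by
    rw [meanLogMulLog_eq]
    exact hgg.add (hps hC)
  set ρ₁ : ℂ → ℝ := fun z =>
    d / (4 * Real.pi) * Laplacian.laplacian (fun u : ℂ => Real.log (K u u).re) z with hρ₁
  set ρ₂ : ℂ × ℂ → ℝ := fun q =>
    (2 * Real.pi)⁻¹ ^ 2 * laplacianFst (laplacianSnd (meanLogMulLog d Q K)) q with hρ₂
  have hρg : ∀ z ∈ Ω, ρ₁ z = (2 * Real.pi)⁻¹ * Laplacian.laplacian (meanLogAt d Q K) z := by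
    intro z hz
    have h := laplacian_const_mul_add_const ((hlog 2).contDiffAt (hΩ.mem_nhds hz)) (d / 2) (meanLog Q)
    rw [show meanLogAt d Q K = fun y => (d / 2 : ℝ) * Real.log (K y y).re + meanLog Q from rfl, h, hρ₁]
    have := Real.pi_ne_zero
    field_simp
    ring
  have hρ₁c : ContinuousOn ρ₁ Ω := continuousOn_const.mul (continuousOn_laplacian hΩ (hlog 2))
  have hρ₂c : ContinuousOn ρ₂ U := by
    have h1 : ContDiffOn ℝ 2 (laplacianSnd (meanLogMulLog d Q K)) U :=
      contDiffOn_planeLaplacian hU hH (by norm_num) _ _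
    have h2 : ContDiffOn ℝ 0 (laplacianFst (laplacianSnd (meanLogMulLog d Q K))) U :=
      contDiffOn_planeLaplacian hU h1 (by norm_num) _ _
    exact continuousOn_const.mul h2.continuousOn
  refine ⟨ρ₁, ρ₂, hρ₁c, hℓ.isFirstIntensity hΩ (hg 2) hρ₁c hρg, fun z _ => rfl, hρ₂c,
    hℓ.isTwoPointCorrelation hΩ hU hUΩ hH hρ₂c fun q _ => rfl, fun z w hzw => ?_⟩
  -- The mixed Laplacian of a power series in the overlap is again of this form, which permits its
  -- termwise evaluation.
  have hop : IsPowerSeriesOperator U (overlap K) fun c =>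
      laplacianFst (laplacianSnd fun q => powerSeriesDeriv c 0 (overlap K q)) :=
    (isPowerSeriesOperator_comp.planeLaplacian hU hθ hθ1 _ _).planeLaplacian hU hθ hθ1 _ _
  have hsum := (hop.hasSum hC hzw (hθ1 _ hzw)).mul_left ((2 * Real.pi)⁻¹ ^ 2)
  have hval : ρ₂ (z, w) - ρ₁ z * ρ₁ w = (2 * Real.pi)⁻¹ ^ 2 *
      laplacianFst (laplacianSnd fun q => powerSeriesDeriv (wickWeight Q) 0 (overlap K q)) (z, w) := by
    rw [hρg z hzw.1, hρg w hzw.2.1]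
    simp only [hρ₂]
    rw [meanLogMulLog_eq, laplacianFst_laplacianSnd_add hU hgg (hps hC) hzw,
      laplacianFst_laplacianSnd_mul_sub_const hΩ (hg 4) _ hzw.1 hzw.2.1]
    ring
  rw [hval]
  refine hsum.congr_fun fun p => ?_
  have hsingle : ∀ q, |(Pi.single p 1 : ℕ → ℝ) q| ≤ 1 := fun q => by
    rcases eq_or_ne q p with rfl | hq
    · simp
    · simp [hq]
  rw [← laplacian_laplacian_slice hU (hps hsingle) hzw]
  simp only [normalizedPower_eq_powerSeriesDeriv]

-- Without any f_i, nothing ties K to a covariance. But Q is then a nonzero constant, so d = 0,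
-- there are no zeros, and both intensities may be taken to be 0.
omit [IsProbabilityMeasure P] in
theorem exists_intensities_of_isEmpty (Q : MvPolynomial (Fin 0) ℂ) (hQ : Q.IsHomogeneous d) (hQ0 : Q ≠ 0)
    (f : Fin 0 → S → ℂ → ℂ) (K : ℂ → ℂ → ℂ) {X : S → Measure ℂ}
    (hX : ∀ s, X s = zeroMeasure Ω fun z => MvPolynomial.eval (fun i => f i s z) Q) :
    ∃ (ρ₁ : ℂ → ℝ) (ρ₂ : ℂ × ℂ → ℝ),
      ContinuousOn ρ₁ Ω ∧
      IsFirstIntensity P X Ω ρ₁ ∧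
      (∀ z ∈ Ω, ρ₁ z =
        d / (4 * Real.pi) * Laplacian.laplacian (fun u : ℂ => Real.log (K u u).re) z) ∧
      ContinuousOn ρ₂ (nondegeneratePairs Ω K) ∧
      IsTwoPointCorrelation P X (nondegeneratePairs Ω K) ρ₂ ∧
      ∀ z w : ℂ, (z, w) ∈ nondegeneratePairs Ω K →
        HasSum
          (fun p : ℕ => (2 * Real.pi)⁻¹ ^ 2 * (wickWeight Q p *
            Laplacian.laplacian
              (fun u : ℂ => Laplacian.laplacian (fun v : ℂ => normalizedPower K p u v) w) z))
          (ρ₂ (z, w) - ρ₁ z * ρ₁ w) := by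
  obtain ⟨a, rfl⟩ := MvPolynomial.C_surjective (Fin 0) Q
  have ha : a ≠ 0 := by rintro rfl; simp at hQ0
  have hd : d = 0 := by
    have := hQ.totalDegree hQ0
    rw [MvPolynomial.totalDegree_C] at this
    exact this.symm
  have hX0 : ∀ s, X s = 0 := by
    intro s
    rw [hX, zeroMeasure]
    have h0 : ∀ z : ℂ, analyticOrderAt (fun _ : ℂ => a) z = 0 := fun z =>
      (analyticAt_const.analyticOrderAt_eq_zero).mpr ha
    simp [h0]
  refine ⟨0, 0, continuousOn_const, ⟨fun _ _ => le_rfl, fun D _ _ => by simp [hX0], fun D _ _ => by simp [hX0]⟩,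
    fun z _ => by simp [hd], continuousOn_const,
    ⟨fun _ _ => le_rfl, fun D _ _ => by simp [hX0], fun D _ _ => by simp [hX0]⟩, fun z w _ => ?_⟩
  -- For p = 0 the differentiated function is constant; for p > 0 there are no multi-indices of
  -- degree p in zero variables.
  have hz : ∀ p : ℕ, (2 * Real.pi)⁻¹ ^ 2 * (wickWeight (MvPolynomial.C a : MvPolynomial (Fin 0) ℂ) p *
      Laplacian.laplacian
        (fun u : ℂ => Laplacian.laplacian (fun v : ℂ => normalizedPower K p u v) w) z) = 0 := by
    intro p
    rcases Nat.eq_zero_or_pos p with rfl | hp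
    · simp [normalizedPower, InnerProductSpace.laplacian_const]
    · have : wickWeight (MvPolynomial.C a : MvPolynomial (Fin 0) ℂ) p = 0 := by
        rw [wickWeight, Finset.univ_eq_empty, Finset.piAntidiag_empty_of_ne_zero hp.ne']
        simp
      simp [this]
  simp only [hz]
  simp

end Zeros

end Polygaf

theorem mainTheorem10 {S : Type*} [MeasurableSpace S] (P : Measure S) [IsProbabilityMeasure P]
    (Ω : Set ℂ) (hΩ : IsOpen Ω) (K : ℂ → ℂ → ℂ)
    (k d : ℕ) (Q : MvPolynomial (Fin k) ℂ) (hQ : Q.IsHomogeneous d) (hQ0 : Q ≠ 0)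
    (f : Fin k → S → ℂ → ℂ)
    (hf : ∀ i, Polygaf.IsGAF P Ω (f i))
    (hcov : ∀ i, Polygaf.IsCovarianceKernel P Ω (f i) K)
    (hind : iIndepFun (fun (i : Fin k) (s : S) (z : Ω) => f i s z) P)
    (hK : ∀ z ∈ Ω, K z z ≠ 0)
    (X : S → Measure ℂ)
    (hX : ∀ s, X s =
      Polygaf.zeroMeasure Ω fun z => MvPolynomial.eval (fun i => f i s z) Q) :
    MemLp (fun a => Real.log ‖MvPolynomial.eval a Q‖) 2 (Polygaf.stdGaussianVector k) ∧
    ∃ (ρ₁ : ℂ → ℝ) (ρ₂ : ℂ × ℂ → ℝ),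
      ContinuousOn ρ₁ Ω ∧
      Polygaf.IsFirstIntensity P X Ω ρ₁ ∧
      (∀ z ∈ Ω, ρ₁ z =
        d / (4 * Real.pi) *
          Laplacian.laplacian (fun u : ℂ => Real.log (K u u).re) z) ∧
      ContinuousOn ρ₂ (Polygaf.nondegeneratePairs Ω K) ∧
      Polygaf.IsTwoPointCorrelation P X (Polygaf.nondegeneratePairs Ω K) ρ₂ ∧
      ∀ z w : ℂ, (z, w) ∈ Polygaf.nondegeneratePairs Ω K →
        HasSum
          (fun p : ℕ => (2 * Real.pi)⁻¹ ^ 2 * (Polygaf.wickWeight Q p *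
            Laplacian.laplacian
              (fun u : ℂ => Laplacian.laplacian
                (fun v : ℂ => Polygaf.normalizedPower K p u v) w) z))
          (ρ₂ (z, w) - ρ₁ z * ρ₁ w) := by
  refine ⟨Polygaf.memLp_log_norm_eval hQ0, ?_⟩
  -- The general argument reads the positivity and smoothness of K off one of the functions f_i, so
  -- it requires k > 0.
  cases k with
  | zero => exact Polygaf.exists_intensities_of_isEmpty Q hQ hQ0 f K hX
  | succ k => exact Polygaf.exists_intensities hΩ hQ hQ0 hf hcov hind hK 0 hX
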